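/- Let $\Bbbk$ be a commutative ring and $R$ an associative unital $\Bbbk$-algebra. $R$-modules are left modules, $R^\circ$-modules are right $R$-modules. Let $M$ be an $R^\circ$-module, $P\to M$ a projective resolution, and for an $R$-module $N$ let $N\to I$ be an injective resolution with cosyzygies $\Omega^kN=\operatorname{Ker}(I^k\to I^{k+1})$. *Homological functors.* A homological functor is a family $T=\{T_i\}_{i\in\mathbb Z}$ of additive functors from $R$-modules to $\Bbbk$-modules with natural connecting homomorphisms $\delta_i\colon T_i(N'')\to T_{i-1}(N')$ that yield a long exact sequence for every short exact sequence $0\to N'\to N\to N''\to 0$; for example, $\operatorname{Tor}_i(M,-)=H_i(P\otimes_R-)$. Morphisms between families of functors with connecting homomorphisms are families of natural transformations that commute with the connecting homomorphisms. *Complete homology.* The right satellite $S^kT$ of a functor $T$ takes $N$ to $\operatorname{Coker}(T(I^{k-1})\to T(\Omega^kN))$, with $S^0T\cong T$. Complete homology is $$\check{\operatorname{Tor}}_i(M,N)=\lim_{k\ge 0}S^k\operatorname{Tor}_{i+k}(M,N),$$ where the maps of the inverse system are induced by the connecting homomorphisms $\operatorname{Tor}_{i+k+1}(M,\Omega^{k+1}N)\to\operatorname{Tor}_{i+k}(M,\Omega^kN)$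 of the sequences $0\to\Omega^kN\to I^k\to\Omega^{k+1}N\to0$. It has induced connecting homomorphisms, and $\tau_i\colon\check{\operatorname{Tor}}_i(M,-)\to\operatorname{Tor}_i(M,-)$ is the projection to $S^0\operatorname{Tor}_i(M,-)\cong\operatorname{Tor}_i(M,-)$. *Stable homology.* The complex $P\otimes_RI$, with components $\coprod_bP_{b+n}\otimes_RI^b$ and differential $p\otimes x\mapsto\partial p\otimes x+(-1)^{|p|}p\otimes\partial x$, is a subcomplex of the complex $P\mathbin{\bar\otimes_R}I$ with components $\prod_bP_{b+n}\otimes_RI^b$. Let $P\mathbin{\tilde\otimes_R}I$ be the quotient complex. Stable homology is $\widetilde{\operatorname{Tor}}_i(M,N)=H_{i+1}(P\mathbin{\tilde\otimes_R}I)$, with its connecting homomorphisms: if $\psi\colon I''\to I'$ is the map of degree $1$ between injective resolutions of $N''$ and $N'$ that represents the sequence $0\to N'\to N\to N''\to0$, then $\widetilde{\operatorname{Tor}}_i(M,N'')\to\widetilde{\operatorname{Tor}}_{i-1}(M,N')$ is induced by $p\otimes x\mapsto(-1)^{i+1}p\otimes\psi(x)$. The connecting homomorphisms of $0\to P\otimes_RI\to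 P\mathbin{\bar\otimes_R}I\to P\mathbin{\tilde\otimes_R}I\to0$, together with the isomorphisms $H_i(P\otimes_RN)\cong H_i(P\otimes_RI)$ induced by $N\to I$, give a morphism $\eth\colon\widetilde{\operatorname{Tor}}(M,-)\to\operatorname{Tor}(M,-)$. **Proposition.** Assume that $M$ has finite copure flat dimension, i.e. there is an integer $n$ such that $\operatorname{Tor}_i(M,E)=0$ for every injective $R$-module $E$ and all $i\ge n$. Then: 1. $\tau\colon\check{\operatorname{Tor}}(M,-)\to\operatorname{Tor}(M,-)$ is the J-completion of $\operatorname{Tor}(M,-)$: $\check{\operatorname{Tor}}_i(M,E)=0$ for every injective $R$-module $E$ and all $i\in\mathbb Z$, the map $\tau$ is a morphism, and every morphism $\upsilon\colon U\to\operatorname{Tor}(M,-)$ from a homological functor $U$ that vanishes on injective modules factors as $\upsilon=\tau\sigma$ for a unique morphism $\sigma\colon U\to\check{\operatorname{Tor}}(M,-)$. 2. There is a unique morphism $\sigma\colon\widetilde{\operatorname{Tor}}(M,-)\to\check{\operatorname{Tor}}(M,-)$ with $\tau\sigma=\eth$, and for every $i\in\mathbb Z$ the map $\sigma_i\colon\widetilde{\operatorname{Tor}}_i(M,-)\to\check{\operatorname{Tor}}_i(M,-)$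 is an isomorphism of functors on the category of $R$-modules. -/

import Mathlib

open CategoryTheory Limits

universe w u

noncomputable section

namespace CompleteHomology

universe v₁ v₂ u₁ u₂

section General

variable {C : Type u₁} [Category.{v₁} C] [Abelian C] {D : Type u₂} [Category.{v₂} D] [Abelian D]

/-- A family of functors `T i`, `i ∈ ℤ`, together with connecting homomorphisms
`T i (N'') ⟶ T (i - 1) (N')` for every short exact sequence `0 ⟶ N' ⟶ N ⟶ N'' ⟶ 0`. -/
structure ConnectedFamily (C : Type u₁) [Category.{v₁} C] [Abelian C]
    (D : Type u₂) [Category.{v₂} D] [Abelian D] where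
  obj : ℤ → (C ⥤ D)
  δ : ∀ (S : ShortComplex C) (_ : S.ShortExact) (i j : ℤ) (_ : j + 1 = i),
    (obj i).obj S.X₃ ⟶ (obj j).obj S.X₁

/-- A homological functor: a family of additive functors with natural connecting
homomorphisms and a long exact sequence for every short exact sequence. -/
structure HomologicalFunctor (C : Type u₁) [Category.{v₁} C] [Abelian C]
    (D : Type u₂) [Category.{v₂} D] [Abelian D] extends ConnectedFamily C D where
  additive : ∀ i, (obj i).Additive
  naturality : ∀ {S S' : ShortComplex C} (φ : S ⟶ S') (hS : S.ShortExact) (hS' : S'.ShortExact)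
    (i j : ℤ) (h : j + 1 = i),
    δ S hS i j h ≫ (obj j).map φ.τ₁ = (obj i).map φ.τ₃ ≫ δ S' hS' i j h
  comp_δ : ∀ (S : ShortComplex C) (hS : S.ShortExact) (i j : ℤ) (h : j + 1 = i),
    (obj i).map S.g ≫ δ S hS i j h = 0
  δ_comp : ∀ (S : ShortComplex C) (hS : S.ShortExact) (i j : ℤ) (h : j + 1 = i),
    δ S hS i j h ≫ (obj j).map S.f = 0
  map_comp : ∀ (S : ShortComplex C) (_ : S.ShortExact) (i : ℤ),
    (obj i).map S.f ≫ (obj i).map S.g = 0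
  exact₁ : ∀ (S : ShortComplex C) (hS : S.ShortExact) (i j : ℤ) (h : j + 1 = i),
    (ShortComplex.mk _ _ (δ_comp S hS i j h)).Exact
  exact₂ : ∀ (S : ShortComplex C) (hS : S.ShortExact) (i : ℤ),
    (ShortComplex.mk _ _ (map_comp S hS i)).Exact
  exact₃ : ∀ (S : ShortComplex C) (hS : S.ShortExact) (i j : ℤ) (h : j + 1 = i),
    (ShortComplex.mk _ _ (comp_δ S hS i j h)).Exact

/-- A morphism of families of functors: a natural transformation in each degree. -/
abbrev FamilyHom (T T' : ConnectedFamily C D) := ∀ i : ℤ, T.obj i ⟶ T'.obj i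

/-- The morphism commutes with the connecting homomorphisms. -/
def FamilyHom.Connected {T T' : ConnectedFamily C D} (f : FamilyHom T T') : Prop :=
  ∀ (S : ShortComplex C) (hS : S.ShortExact) (i j : ℤ) (h : j + 1 = i),
    T.δ S hS i j h ≫ (f j).app S.X₁ = (f i).app S.X₃ ≫ T'.δ S hS i j h

/-- All functors in the family vanish on injective objects. -/
def VanishesOnInjectives (T : ConnectedFamily C D) : Prop :=
  ∀ (i : ℤ) (E : C), Injective E → IsZero ((T.obj i).obj E)

/-- `τ : V ⟶ T` exhibits `V` as the J-completion of `T`: `V` vanishes on injective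
objects, `τ` is a morphism, and every morphism to `T` from a homological functor that vanishes
on injective objects factors uniquely through `τ`; morphisms are understood to commute with the
connecting homomorphisms. -/
def IsJCompletion (T V : ConnectedFamily C D) (τ : FamilyHom V T) : Prop :=
  VanishesOnInjectives V ∧ τ.Connected ∧
    ∀ (U : HomologicalFunctor C D), VanishesOnInjectives U.toConnectedFamily →
      ∀ υ : FamilyHom U.toConnectedFamily T, υ.Connected →
        ∃! σ : FamilyHom U.toConnectedFamily V, σ.Connected ∧ ∀ i, σ i ≫ τ i = υ i

/-! ### Functors defined through injective resolutions -/

/-- On a complex `I`, the cokernel of `T (I^(k-1)) ⟶ T (Ω^k)`, where `Ω^k` is the kernel of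
`I^k ⟶ I^(k+1)`. For `k = 0` the map `I^(k-1) ⟶ Ω^k` is `0` (here
`(ComplexShape.up ℕ).prev 0 = 0`, and the differential `I^0 ⟶ I^0` is `0`). -/
def satelliteComplex (T : C ⥤ D) (k : ℕ) : CochainComplex C ℕ ⥤ D where
  obj I := cokernel (T.map (I.toCycles ((ComplexShape.up ℕ).prev k) k))
  map φ := cokernel.map _ _ (T.map (φ.f _)) (T.map (HomologicalComplex.cyclesMap φ k)) (by
    rw [← T.map_comp, ← T.map_comp]
    congr 1
    rw [← cancel_mono (HomologicalComplex.iCycles _ k)]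
    simp)
  map_id I := by ext; simp
  map_comp φ ψ := by ext; simp [HomologicalComplex.cyclesMap_comp]

lemma satelliteComplex_homotopy (T : C ⥤ D) (hT : T.Additive) (k : ℕ)
    ⦃K L : CochainComplex C ℕ⦄ (f g : K ⟶ L) (h : Homotopy f g) :
    (satelliteComplex T k).map f = (satelliteComplex T k).map g := by
  have e : HomologicalComplex.cyclesMap f k = HomologicalComplex.cyclesMap g k +
      K.iCycles k ≫ h.hom k ((ComplexShape.up ℕ).prev k) ≫
        L.toCycles ((ComplexShape.up ℕ).prev k) k := by
    rw [← cancel_mono (L.iCycles k)]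
    have hc := h.comm k
    simp only [dNext, prevD, AddMonoidHom.mk'_apply] at hc
    simp only [HomologicalComplex.cyclesMap_i, hc, Preadditive.comp_add, Preadditive.add_comp,
      HomologicalComplex.iCycles_d_assoc, zero_comp, zero_add, Category.assoc,
      HomologicalComplex.toCycles_i]
    rw [add_comm]
  apply coequalizer.hom_ext
  dsimp [satelliteComplex]
  simp only [cokernel.π_desc, e, T.map_add, T.map_comp, Preadditive.add_comp, Category.assoc,
    cokernel.condition, comp_zero, add_zero]

variable [EnoughInjectives C]

/-- The chosen injective resolution of `N`, as a complex. -/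
abbrev res (N : C) : CochainComplex C ℕ := (injectiveResolution N).cocomplex

/-- The chain map of injective resolutions that lifts `f`. -/
abbrev resMap {N N' : C} (f : N ⟶ N') : res N ⟶ res N' :=
  InjectiveResolution.desc f (injectiveResolution N') (injectiveResolution N)

/-- The functor `N ↦ G (I)`, where `I` is an injective resolution of `N`, for a functor `G` on
complexes that does not distinguish between homotopic maps. -/
@[simps]
def ofResolution {D : Type u₂} [Category.{v₂} D] (G : CochainComplex C ℕ ⥤ D)
    (hG : ∀ ⦃K L : CochainComplex C ℕ⦄ (f g : K ⟶ L), Homotopy f g → G.map f = G.map g) :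
    C ⥤ D where
  obj N := G.obj (res N)
  map f := G.map (resMap f)
  map_id N := by
    rw [hG _ _ (InjectiveResolution.descIdHomotopy N (injectiveResolution N)), G.map_id]
  map_comp f g := by
    rw [hG _ _ (InjectiveResolution.descCompHomotopy f g _ (injectiveResolution _) _), G.map_comp]

/-- The short exact sequence `0 ⟶ Ω^k N ⟶ I^k ⟶ Ω^(k+1) N ⟶ 0` of cosyzygies. -/
abbrev cosyzygySES (N : C) (k : ℕ) : ShortComplex C :=
  ShortComplex.mk ((res N).iCycles k) ((res N).toCycles k (k + 1))
    (by rw [← cancel_mono ((res N).iCycles (k + 1))]; simp)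

instance epi_toCycles (N : C) (k : ℕ) : Epi ((res N).toCycles k (k + 1)) := by
  have h := (injectiveResolution N).cocomplex_exactAt_succ k
  have h' := h.isZero_homology
  exact (ShortComplex.exact_iff_epi _
    (h'.eq_of_tgt ((res N).homologyπ (k + 1)) 0)).1
    (ShortComplex.exact_of_g_is_cokernel
      (.mk ((res N).toCycles k (k + 1)) ((res N).homologyπ (k + 1)) (by simp))
      ((res N).homologyIsCokernel k (k + 1) (by simp)))

lemma cosyzygySES_shortExact (N : C) (k : ℕ) : (cosyzygySES N k).ShortExact where
  exact := by
    let φ : cosyzygySES N k ⟶ ShortComplex.mk ((res N).iCycles k) ((res N).d k (k + 1)) (by simp) :=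
      { τ₁ := 𝟙 _, τ₂ := 𝟙 _, τ₃ := (res N).iCycles (k + 1) }
    have : Epi φ.τ₁ := inferInstanceAs (Epi (𝟙 _))
    have : IsIso φ.τ₂ := inferInstanceAs (IsIso (𝟙 _))
    have : Mono φ.τ₃ := inferInstanceAs (Mono ((res N).iCycles (k + 1)))
    rw [ShortComplex.exact_iff_of_epi_of_isIso_of_mono φ]
    exact ShortComplex.exact_of_f_is_kernel _ ((res N).cyclesIsKernel k (k + 1) (by simp))

/-- The augmentation `N ⟶ I^0` of the chosen injective resolution. -/
def aug (N : C) : N ⟶ (res N).X 0 := (injectiveResolution N).ι.f 0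

instance (N : C) : Mono (aug N) := inferInstanceAs (Mono ((injectiveResolution N).ι.f 0))

@[simp]
lemma aug_d (N : C) : aug N ≫ (res N).d 0 1 = 0 :=
  (injectiveResolution N).ι_f_zero_comp_complex_d

lemma aug_d_assoc (N : C) {X : C} (h : (res N).X 1 ⟶ X) :
    aug N ≫ (res N).d 0 1 ≫ h = 0 := by
  rw [← Category.assoc, aug_d, zero_comp]

lemma aug_naturality {N N' : C} (f : N ⟶ N') : aug N ≫ (resMap f).f 0 = f ≫ aug N' :=
  InjectiveResolution.desc_commutes_zero f (injectiveResolution N') (injectiveResolution N)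

/-- `Ω^0 N ⟶ N`, the inverse of the isomorphism given by the augmentation `N ⟶ I^0`. -/
def cosyzygyZero (N : C) : (res N).cycles 0 ⟶ N :=
  (injectiveResolution N).isLimitKernelFork.lift
    (KernelFork.ofι ((res N).iCycles 0) (by simp))

lemma cosyzygyZero_aug (N : C) : cosyzygyZero N ≫ aug N = (res N).iCycles 0 :=
  (injectiveResolution N).isLimitKernelFork.fac _ WalkingParallelPair.zero

lemma cosyzygyZero_aug_assoc (N : C) {X : C} (h : (res N).X 0 ⟶ X) :
    cosyzygyZero N ≫ aug N ≫ h = (res N).iCycles 0 ≫ h := by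
  rw [← Category.assoc, cosyzygyZero_aug]

lemma cosyzygyZero_naturality {N N' : C} (f : N ⟶ N') :
    HomologicalComplex.cyclesMap (resMap f) 0 ≫ cosyzygyZero N' = cosyzygyZero N ≫ f := by
  rw [← cancel_mono (aug N'), Category.assoc, Category.assoc, cosyzygyZero_aug,
    ← aug_naturality f, cosyzygyZero_aug_assoc, HomologicalComplex.cyclesMap_i]

/-- The truncation `I^1 ⟶ I^2 ⟶ ⋯` of an injective resolution as an injective resolution of
the first cosyzygy. -/
def truncRes {N : C} (I : InjectiveResolution N) :
    InjectiveResolution (I.cocomplex.cycles 1) where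
  cocomplex := CochainComplex.truncate.obj I.cocomplex
  injective n := I.injective (n + 1)
  ι := (CochainComplex.fromSingle₀Equiv (CochainComplex.truncate.obj I.cocomplex) _).symm
    ⟨I.cocomplex.iCycles 1, I.cocomplex.iCycles_d 1 2⟩
  quasiIso := ⟨fun n => by
    cases n
    · rw [CochainComplex.quasiIsoAt₀_iff, ShortComplex.quasiIso_iff_of_zeros]
      · refine (ShortComplex.exact_and_mono_f_iff_of_iso ?_).2
          ⟨ShortComplex.exact_of_f_is_kernel
            (.mk (I.cocomplex.iCycles 1) (I.cocomplex.d 1 2) (by simp))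
            (I.cocomplex.cyclesIsKernel 1 2 (by simp)), by dsimp; infer_instance⟩
        exact ShortComplex.isoMk (Iso.refl _) (Iso.refl _) (Iso.refl _)
          ((Category.id_comp (X := I.cocomplex.cycles 1) (Y := I.cocomplex.X 1) _).trans
            ((CochainComplex.fromSingle₀Equiv_symm_apply_f_zero
              (C := CochainComplex.truncate.obj I.cocomplex)
              (I.cocomplex.iCycles 1) (I.cocomplex.iCycles_d 1 2)).symm.trans
              (Category.comp_id (X := I.cocomplex.cycles 1) (Y := I.cocomplex.X 1) _).symm))
          ((Category.id_comp (X := I.cocomplex.X 1) (Y := I.cocomplex.X 2) _).trans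
            (Category.comp_id (X := I.cocomplex.X 1) (Y := I.cocomplex.X 2) _).symm)
      · rfl
      · rfl
      · exact I.cocomplex.shape 1 1 (by simp)
    · rename_i n
      rw [quasiIsoAt_iff_exactAt]
      · rw [HomologicalComplex.exactAt_iff' _ n (n + 1) (n + 2) (by simp) (by simp)]
        exact I.exact_succ (n + 1)
      · apply CochainComplex.exactAt_succ_single_obj⟩

/-- An extension `N ⟶ I^0` of the augmentation `N' ⟶ I^0` to the middle term of a short exact
sequence, where `I` is the injective resolution of `N'`. -/
def extendAug {S : ShortComplex C} (hS : S.ShortExact) : S.X₂ ⟶ (res S.X₁).X 0 :=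
  haveI := hS.mono_f
  haveI : Injective ((res S.X₁).X 0) := (injectiveResolution S.X₁).injective 0
  Injective.factorThru (aug S.X₁) S.f

lemma f_extendAug {S : ShortComplex C} (hS : S.ShortExact) :
    S.f ≫ extendAug hS = aug S.X₁ :=
  haveI := hS.mono_f
  haveI : Injective ((res S.X₁).X 0) := (injectiveResolution S.X₁).injective 0
  Injective.comp_factorThru _ _

lemma f_extendAug_assoc {S : ShortComplex C} (hS : S.ShortExact) {X : C}
    (h : (res S.X₁).X 0 ⟶ X) : S.f ≫ extendAug hS ≫ h = aug S.X₁ ≫ h := by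
  rw [← Category.assoc, f_extendAug]

/-- The map `N'' ⟶ Ω^1 N'` that is induced by the extension `N ⟶ I^0`. -/
def toCosyzygy {S : ShortComplex C} (hS : S.ShortExact) : S.X₃ ⟶ (res S.X₁).cycles 1 :=
  hS.gIsCokernel.desc (CokernelCofork.ofπ (extendAug hS ≫ (res S.X₁).toCycles 0 1) (by
    rw [← cancel_mono ((res S.X₁).iCycles 1), f_extendAug_assoc, Category.assoc,
      HomologicalComplex.toCycles_i, zero_comp, aug_d]))

lemma g_toCosyzygy {S : ShortComplex C} (hS : S.ShortExact) :
    S.g ≫ toCosyzygy hS = extendAug hS ≫ (res S.X₁).toCycles 0 1 :=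
  Cofork.IsColimit.π_desc hS.gIsCokernel

/-- The components `ψ^k : J^k ⟶ I^(k+1)`, where `I` and `J` are the injective resolutions of `N'`
and `N''`, of a chain map from `J` to the truncated complex `I^1 ⟶ I^2 ⟶ ⋯` that lifts the map
`N'' ⟶ Ω^1 N'`. -/
def connLift {S : ShortComplex C} (hS : S.ShortExact) (k : ℕ) :
    (res S.X₃).X k ⟶ (res S.X₁).X (k + 1) :=
  (InjectiveResolution.desc (toCosyzygy hS) (truncRes (injectiveResolution S.X₁))
    (injectiveResolution S.X₃)).f k

lemma connLift_d {S : ShortComplex C} (hS : S.ShortExact) (k l : ℕ) :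
    connLift hS k ≫ (res S.X₁).d (k + 1) (l + 1) = (res S.X₃).d k l ≫ connLift hS l :=
  (InjectiveResolution.desc (toCosyzygy hS) (truncRes (injectiveResolution S.X₁))
    (injectiveResolution S.X₃)).comm k l

/-- The induced maps of cosyzygies `Ω^k N'' ⟶ Ω^(k+1) N'`. -/
def connCosyzygy {S : ShortComplex C} (hS : S.ShortExact) (k : ℕ) :
    (res S.X₃).cycles k ⟶ (res S.X₁).cycles (k + 1) :=
  (res S.X₁).liftCycles ((res S.X₃).iCycles k ≫ connLift hS k) (k + 2) (by simp)
    (by rw [Category.assoc, connLift_d, HomologicalComplex.iCycles_d_assoc, zero_comp])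

@[simp]
lemma connCosyzygy_i {S : ShortComplex C} (hS : S.ShortExact) (k : ℕ) :
    connCosyzygy hS k ≫ (res S.X₁).iCycles (k + 1) = (res S.X₃).iCycles k ≫ connLift hS k :=
  HomologicalComplex.liftCycles_i _ _ _ _ _

@[simp]
lemma connCosyzygy_i_assoc {S : ShortComplex C} (hS : S.ShortExact) (k : ℕ) {X : C}
    (h : (res S.X₁).X (k + 1) ⟶ X) :
    connCosyzygy hS k ≫ (res S.X₁).iCycles (k + 1) ≫ h =
      (res S.X₃).iCycles k ≫ connLift hS k ≫ h := by
  rw [← Category.assoc, connCosyzygy_i, Category.assoc]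

lemma toCycles_connCosyzygy {S : ShortComplex C} (hS : S.ShortExact) (k l : ℕ) :
    (res S.X₃).toCycles k l ≫ connCosyzygy hS l =
      connLift hS k ≫ (res S.X₁).toCycles (k + 1) (l + 1) := by
  rw [← cancel_mono ((res S.X₁).iCycles (l + 1))]
  simp [connLift_d]

/-! ### Satellites and the limit -/

/-- The right satellites of an additive functor `T`: the functor `S^k T` that takes `N` to the
cokernel of `T (I^(k-1)) ⟶ T (Ω^k N)`. -/
def satellite (T : C ⥤ D) (hT : T.Additive) (k : ℕ) : C ⥤ D :=
  ofResolution (satelliteComplex T k) (satelliteComplex_homotopy T hT k)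

/-- The projection `T (Ω^k N) ⟶ S^k T (N)`. -/
def satelliteπ (T : C ⥤ D) (hT : T.Additive) (k : ℕ) (N : C) :
    T.obj ((res N).cycles k) ⟶ (satellite T hT k).obj N :=
  cokernel.π (T.map ((res N).toCycles ((ComplexShape.up ℕ).prev k) k))

lemma satelliteπ_naturality (T : C ⥤ D) (hT : T.Additive) (k : ℕ) {N N' : C} (f : N ⟶ N') :
    satelliteπ T hT k N ≫ (satellite T hT k).map f =
      T.map (HomologicalComplex.cyclesMap (resMap f) k) ≫ satelliteπ T hT k N' :=
  cokernel.π_desc _ _ _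

lemma satelliteπ_naturality_assoc (T : C ⥤ D) (hT : T.Additive) (k : ℕ) {N N' : C} (f : N ⟶ N')
    {X : D} (h : (satellite T hT k).obj N' ⟶ X) :
    satelliteπ T hT k N ≫ (satellite T hT k).map f ≫ h =
      T.map (HomologicalComplex.cyclesMap (resMap f) k) ≫ satelliteπ T hT k N' ≫ h := by
  rw [← Category.assoc, satelliteπ_naturality, Category.assoc]

instance (T : C ⥤ D) (hT : T.Additive) (k : ℕ) (N : C) : Epi (satelliteπ T hT k N) :=
  inferInstanceAs (Epi (cokernel.π _))

lemma toCycles_satelliteπ (T : C ⥤ D) (hT : T.Additive) (k l : ℕ) (N : C) :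
    T.map ((res N).toCycles l k) ≫ satelliteπ T hT k N = 0 := by
  by_cases h : (ComplexShape.up ℕ).Rel l k
  · obtain rfl := (ComplexShape.up ℕ).prev_eq' h
    exact cokernel.condition _
  · rw [(res N).toCycles_eq_zero h, T.map_zero, zero_comp]

/-- Maps out of `S^k T (N)`. -/
def satelliteDesc (T : C ⥤ D) (hT : T.Additive) (k : ℕ) (N : C) {X : D}
    (f : T.obj ((res N).cycles k) ⟶ X)
    (hf : T.map ((res N).toCycles ((ComplexShape.up ℕ).prev k) k) ≫ f = 0) :
    (satellite T hT k).obj N ⟶ X :=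
  cokernel.desc _ f hf

@[simp]
lemma satelliteπ_desc (T : C ⥤ D) (hT : T.Additive) (k : ℕ) (N : C) {X : D}
    (f : T.obj ((res N).cycles k) ⟶ X)
    (hf : T.map ((res N).toCycles ((ComplexShape.up ℕ).prev k) k) ≫ f = 0) :
    satelliteπ T hT k N ≫ satelliteDesc T hT k N f hf = f :=
  cokernel.π_desc _ _ _

lemma satelliteπ_desc_assoc (T : C ⥤ D) (hT : T.Additive) (k : ℕ) (N : C) {X Y : D}
    (f : T.obj ((res N).cycles k) ⟶ X)
    (hf : T.map ((res N).toCycles ((ComplexShape.up ℕ).prev k) k) ≫ f = 0) (h : X ⟶ Y) :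
    satelliteπ T hT k N ≫ satelliteDesc T hT k N f hf ≫ h = f ≫ h := by
  rw [← Category.assoc, satelliteπ_desc]

namespace HomologicalFunctor

variable (T : HomologicalFunctor C D)

/-- The connecting homomorphism `T i (Ω^(k+1) N) ⟶ T (i - 1) (Ω^k N)`. -/
def cosyzygyδ (k : ℕ) (i j : ℤ) (h : j + 1 = i) (N : C) :
    (T.obj i).obj ((res N).cycles (k + 1)) ⟶ (T.obj j).obj ((res N).cycles k) :=
  T.δ (cosyzygySES N k) (cosyzygySES_shortExact N k) i j h

lemma toCycles_cosyzygyδ (k : ℕ) (i j : ℤ) (h : j + 1 = i) (N : C) :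
    (T.obj i).map ((res N).toCycles k (k + 1)) ≫ T.cosyzygyδ k i j h N = 0 :=
  T.comp_δ (cosyzygySES N k) (cosyzygySES_shortExact N k) i j h

lemma cosyzygyδ_naturality (k : ℕ) (i j : ℤ) (h : j + 1 = i) {N N' : C} (f : N ⟶ N') :
    T.cosyzygyδ k i j h N ≫ (T.obj j).map (HomologicalComplex.cyclesMap (resMap f) k) =
      (T.obj i).map (HomologicalComplex.cyclesMap (resMap f) (k + 1)) ≫
        T.cosyzygyδ k i j h N' :=
  T.naturality (S := cosyzygySES N k) (S' := cosyzygySES N' k)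
    { τ₁ := HomologicalComplex.cyclesMap (resMap f) k
      τ₂ := (resMap f).f k
      τ₃ := HomologicalComplex.cyclesMap (resMap f) (k + 1)
      comm₂₃ := by
        dsimp
        rw [← cancel_mono ((res N').iCycles (k + 1))]
        simp } _ _ i j h

lemma cosyzygyδ_naturality_assoc (k : ℕ) (i j : ℤ) (h : j + 1 = i) {N N' : C} (f : N ⟶ N')
    {X : D} (g : (T.obj j).obj ((res N').cycles k) ⟶ X) :
    T.cosyzygyδ k i j h N ≫ (T.obj j).map (HomologicalComplex.cyclesMap (resMap f) k) ≫ g =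
      (T.obj i).map (HomologicalComplex.cyclesMap (resMap f) (k + 1)) ≫
        T.cosyzygyδ k i j h N' ≫ g := by
  rw [← Category.assoc, cosyzygyδ_naturality, Category.assoc]

lemma cosyzygyδ_conn (k : ℕ) (i j : ℤ) (h : j + 1 = i) {S : ShortComplex C}
    (hS : S.ShortExact) :
    T.cosyzygyδ k i j h S.X₃ ≫ (T.obj j).map (connCosyzygy hS k) =
      (T.obj i).map (connCosyzygy hS (k + 1)) ≫ T.cosyzygyδ (k + 1) i j h S.X₁ :=
  T.naturality (S := cosyzygySES S.X₃ k) (S' := cosyzygySES S.X₁ (k + 1))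
    { τ₁ := connCosyzygy hS k
      τ₂ := connLift hS k
      τ₃ := connCosyzygy hS (k + 1)
      comm₁₂ := by simp
      comm₂₃ := (toCycles_connCosyzygy hS k (k + 1)).symm } _ _ i j h

lemma cosyzygyδ_conn_assoc (k : ℕ) (i j : ℤ) (h : j + 1 = i) {S : ShortComplex C}
    (hS : S.ShortExact) {X : D} (g : (T.obj j).obj ((res S.X₁).cycles (k + 1)) ⟶ X) :
    T.cosyzygyδ k i j h S.X₃ ≫ (T.obj j).map (connCosyzygy hS k) ≫ g =
      (T.obj i).map (connCosyzygy hS (k + 1)) ≫ T.cosyzygyδ (k + 1) i j h S.X₁ ≫ g := by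
  rw [← Category.assoc, cosyzygyδ_conn, Category.assoc]

/-- The maps `S^(k+1) T i (N) ⟶ S^k T (i - 1) (N)` of the inverse system: the connecting
homomorphism `T i (Ω^(k+1) N) ⟶ T (i - 1) (Ω^k N)` induces a map from the cokernel
`S^(k+1) T i (N)`, and it is composed with the projection to `S^k T (i - 1) (N)`. -/
def transition (k : ℕ) (i j : ℤ) (h : j + 1 = i) :
    satellite (T.obj i) (T.additive i) (k + 1) ⟶ satellite (T.obj j) (T.additive j) k where
  app N := satelliteDesc _ _ _ _
    (T.cosyzygyδ k i j h N ≫ satelliteπ (T.obj j) (T.additive j) k N) (by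
      have h : (ComplexShape.up ℕ).prev (k + 1) = k := by simp
      rw [h, ← Category.assoc, toCycles_cosyzygyδ, zero_comp])
  naturality N N' f := by
    rw [← cancel_epi (satelliteπ (T.obj i) (T.additive i) (k + 1) N)]
    rw [satelliteπ_naturality_assoc, satelliteπ_desc, satelliteπ_desc_assoc, Category.assoc,
      satelliteπ_naturality, cosyzygyδ_naturality_assoc]

/-- The inverse system `S^k T (i + k)`, `k ≥ 0`. -/
def system (i : ℤ) : ℕᵒᵖ ⥤ (C ⥤ D) :=
  Functor.ofOpSequence
    (X := fun k : ℕ => satellite (T.obj (i + k)) (T.additive (i + k)) k)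
    (fun k => T.transition k (i + (k + 1 : ℕ)) (i + k) (by push_cast; ring))

lemma system_map (i : ℤ) (k : ℕ) :
    (T.system i).map (homOfLE (Nat.le_add_right k 1)).op =
      T.transition k (i + (k + 1 : ℕ)) (i + k) (by push_cast; ring) :=
  Functor.ofOpSequence_map_homOfLE_succ _ _

/-- The map `S^k T i (N'') ⟶ S^k T (i - 1) (N')`, for a short exact sequence
`0 ⟶ N' ⟶ N ⟶ N'' ⟶ 0`, that is induced by the composite
`T i (Ω^k N'') ⟶ T i (Ω^(k+1) N') ⟶ T (i - 1) (Ω^k N')`. -/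
def satelliteδ (k : ℕ) (i j : ℤ) (h : j + 1 = i) {S : ShortComplex C} (hS : S.ShortExact) :
    (satellite (T.obj i) (T.additive i) k).obj S.X₃ ⟶
      (satellite (T.obj j) (T.additive j) k).obj S.X₁ :=
  satelliteDesc _ _ _ _ ((T.obj i).map (connCosyzygy hS k) ≫ T.cosyzygyδ k i j h S.X₁ ≫
    satelliteπ (T.obj j) (T.additive j) k S.X₁) (by
      by_cases h : (ComplexShape.up ℕ).Rel ((ComplexShape.up ℕ).prev k) k
      · generalize (ComplexShape.up ℕ).prev k = l at h
        obtain rfl : l + 1 = k := h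
        rw [← Category.assoc, ← (T.obj i).map_comp, toCycles_connCosyzygy, (T.obj i).map_comp,
          Category.assoc, ← Category.assoc ((T.obj i).map ((res S.X₁).toCycles _ _)),
          toCycles_cosyzygyδ, zero_comp, comp_zero]
      · have := T.additive i
        rw [(res S.X₃).toCycles_eq_zero h, (T.obj i).map_zero, zero_comp])

lemma transition_satelliteδ (k : ℕ) (i j i' j' : ℤ) (h : j + 1 = i) (h' : j' + 1 = i')
    (hi : i' + 1 = i) (hj : j' + 1 = j) {S : ShortComplex C} (hS : S.ShortExact) :
    T.satelliteδ (k + 1) i j h hS ≫ (T.transition k j j' hj).app S.X₁ =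
      (T.transition k i i' hi).app S.X₃ ≫ T.satelliteδ k i' j' h' hS := by
  obtain rfl : j = i' := by omega
  obtain rfl : j' = j - 1 := by omega
  rw [← cancel_epi (satelliteπ (T.obj i) (T.additive i) (k + 1) S.X₃)]
  dsimp only [transition, satelliteδ]
  simp only [satelliteπ_desc_assoc, satelliteπ_desc, Category.assoc]
  rw [T.cosyzygyδ_conn_assoc]

variable [HasLimitsOfShape ℕᵒᵖ D]

/-- The functors `lim_k S^k T (i + k)`. -/
def completionObj (i : ℤ) : C ⥤ D := limit (T.system i)

/-- The projection from the limit to `S^k T (i + k)`. -/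
def completionπ (i : ℤ) (k : ℕ) :
    T.completionObj i ⟶ satellite (T.obj (i + k)) (T.additive (i + k)) k :=
  limit.π (T.system i) (Opposite.op k)

lemma completionπ_transition (i : ℤ) (k : ℕ) :
    T.completionπ i (k + 1) ≫ T.transition k (i + (k + 1 : ℕ)) (i + k) (by push_cast; ring) =
      T.completionπ i k := by
  have h := limit.w (T.system i) (homOfLE (Nat.le_add_right k 1)).op
  rw [system_map] at h
  exact h

lemma completionπ_satelliteδ {S : ShortComplex C} (hS : S.ShortExact) (i j : ℤ) (h : j + 1 = i)
    (k : ℕ) :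
    (T.completionπ i k).app S.X₃ ≫ T.satelliteδ k (i + k) (j + k) (by omega) hS =
      ((T.completionπ i (k + 1)).app S.X₃ ≫
        T.satelliteδ (k + 1) (i + (k + 1 : ℕ)) (j + (k + 1 : ℕ)) (by omega) hS) ≫
          (T.transition k (j + (k + 1 : ℕ)) (j + k) (by push_cast; ring)).app S.X₁ := by
  rw [Category.assoc,
    T.transition_satelliteδ k (i + (k + 1 : ℕ)) (j + (k + 1 : ℕ)) (i + k) (j + k)
      (by omega) (by omega) (by push_cast; ring) (by push_cast; ring),
    ← NatTrans.comp_app_assoc, T.completionπ_transition]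

/-- The connecting homomorphisms `lim_k S^k T (i + k) (N'') ⟶ lim_k S^k T (i - 1 + k) (N')`. -/
def completionδ {S : ShortComplex C} (hS : S.ShortExact) (i j : ℤ) (h : j + 1 = i) :
    (T.completionObj i).obj S.X₃ ⟶ (T.completionObj j).obj S.X₁ :=
  (isLimitOfPreserves ((evaluation C D).obj S.X₁) (limit.isLimit (T.system j))).lift
    { pt := (T.completionObj i).obj S.X₃
      π := NatTrans.ofOpSequence
        (fun k => (T.completionπ i k).app S.X₃ ≫
          T.satelliteδ k (i + k) (j + k) (by omega) hS)
        (fun k => by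
          refine (Category.id_comp _).trans ?_
          refine (T.completionπ_satelliteδ hS i j h k).trans (congrArg _ ?_)
          exact congrArg (fun f => NatTrans.app f S.X₁) (T.system_map j k).symm) }

/-- On the components the connecting homomorphism of the limit is given by the maps
`S^k T (i + k) (N'') ⟶ S^k T (i - 1 + k) (N')`. -/
lemma completionδ_π {S : ShortComplex C} (hS : S.ShortExact) (i j : ℤ) (h : j + 1 = i) (k : ℕ) :
    T.completionδ hS i j h ≫ (T.completionπ j k).app S.X₁ =
      (T.completionπ i k).app S.X₃ ≫ T.satelliteδ k (i + k) (j + k) (by omega) hS :=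
  IsLimit.fac _ _ (Opposite.op k)

/-- The family `lim_k S^k T (i + k)` with its connecting homomorphisms. -/
@[simps]
def completion : ConnectedFamily C D where
  obj := T.completionObj
  δ _ hS i j h := T.completionδ hS i j h

/-- The morphism from the limit to `S^0 T i ≅ T i`. -/
def completionτ : FamilyHom T.completion T.toConnectedFamily := fun i =>
  T.completionπ i 0 ≫
    { app N := satelliteDesc _ _ _ _ ((T.obj _).map (cosyzygyZero N)) (by
        have := T.additive (i + (0 : ℕ))
        rw [(res N).toCycles_eq_zero (by simp), (T.obj _).map_zero, zero_comp])
      naturality N N' f := by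
        rw [← cancel_epi (satelliteπ (T.obj (i + (0 : ℕ))) (T.additive (i + (0 : ℕ))) 0 N)]
        rw [satelliteπ_naturality_assoc, satelliteπ_desc, satelliteπ_desc_assoc,
          ← Functor.map_comp, ← Functor.map_comp, cosyzygyZero_naturality] } ≫
    eqToHom (by simp)

end HomologicalFunctor

end General

/-! ### The tensor product over an associative algebra -/

section Tensor

open scoped TensorProduct

/-- A module over a `k`-algebra as a `k`-module. -/
@[reducible]
def moduleOverBase (k : Type w) [CommRing k] {A : Type u} [Ring A] [Algebra k A]
    (M : ModuleCat.{u} A) : Module k M :=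
  Module.restrictScalars k A M

attribute [local instance 50] moduleOverBase

lemma isScalarTower_base (k : Type w) [CommRing k] {A : Type u} [Ring A] [Algebra k A]
    (M : ModuleCat.{u} A) : IsScalarTower k A M :=
  IsScalarTower.restrictScalars k A M

attribute [local instance] isScalarTower_base

variable (k : Type w) [CommRing k] {R : Type u} [Ring R] [Algebra k R]

/-- The relations `m r ⊗ n = m ⊗ r n`; a right `R`-module is a module over `Rᵐᵒᵖ`, with
`m r = MulOpposite.op r • m`. -/
def balancedRelations (M : ModuleCat.{u} Rᵐᵒᵖ) (N : ModuleCat.{u} R) : Submodule k (M ⊗[k] N) :=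
  Submodule.span k {x | ∃ (m : M) (r : R) (n : N),
    x = (MulOpposite.op r • m) ⊗ₜ[k] n - m ⊗ₜ[k] (r • n)}

/-- The tensor product `M ⊗_R N` of a right `R`-module and a left `R`-module, as a `k`-module. -/
abbrev Tensor (M : ModuleCat.{u} Rᵐᵒᵖ) (N : ModuleCat.{u} R) : Type u :=
  (M ⊗[k] N) ⧸ balancedRelations k M N

variable {k} in
/-- The element `m ⊗ n` of `M ⊗_R N`. -/
def Tensor.tmul {M : ModuleCat.{u} Rᵐᵒᵖ} {N : ModuleCat.{u} R} (m : M) (n : N) :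
    Tensor k M N :=
  Submodule.Quotient.mk (m ⊗ₜ[k] n)

lemma Tensor.smul_tmul {M : ModuleCat.{u} Rᵐᵒᵖ} {N : ModuleCat.{u} R} (m : M) (r : R) (n : N) :
    Tensor.tmul (k := k) (MulOpposite.op r • m) n = Tensor.tmul m (r • n) :=
  (Submodule.Quotient.eq _).2 (Submodule.subset_span ⟨m, r, n, rfl⟩)

lemma Tensor.hom_ext {M : ModuleCat.{u} Rᵐᵒᵖ} {N : ModuleCat.{u} R} {X : Type*}
    [AddCommGroup X] [Module k X] {f g : Tensor k M N →ₗ[k] X}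
    (h : ∀ m n, f (Tensor.tmul m n) = g (Tensor.tmul m n)) : f = g := by
  apply Submodule.linearMap_qext
  apply TensorProduct.ext'
  exact h

/-- The map `f ⊗ g`. -/
def Tensor.map {M M' : ModuleCat.{u} Rᵐᵒᵖ} {N N' : ModuleCat.{u} R} (f : M ⟶ M') (g : N ⟶ N') :
    Tensor k M N →ₗ[k] Tensor k M' N' :=
  Submodule.mapQ _ _
    (TensorProduct.map (f.hom.restrictScalars k) (g.hom.restrictScalars k)) (by
      refine Submodule.span_le.2 ?_
      rintro _ ⟨m, r, n, rfl⟩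
      refine Submodule.subset_span ⟨f.hom m, r, g.hom n, ?_⟩
      simp)

@[simp]
lemma Tensor.map_tmul {M M' : ModuleCat.{u} Rᵐᵒᵖ} {N N' : ModuleCat.{u} R} (f : M ⟶ M')
    (g : N ⟶ N') (m : M) (n : N) :
    Tensor.map k f g (Tensor.tmul m n) = Tensor.tmul (f.hom m) (g.hom n) := rfl

/-- The bifunctor `M ⊗_R N`. -/
@[simps]
def tensor (R : Type u) [Ring R] [Algebra k R] :
    ModuleCat.{u} Rᵐᵒᵖ ⥤ ModuleCat.{u} R ⥤ ModuleCat.{u} k where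
  obj M :=
    { obj N := ModuleCat.of k (Tensor k M N)
      map g := ModuleCat.ofHom (Tensor.map k (𝟙 M) g)
      map_id N := ModuleCat.hom_ext (Tensor.hom_ext k fun _ _ => rfl)
      map_comp f g := ModuleCat.hom_ext (Tensor.hom_ext k fun _ _ => rfl) }
  map f :=
    { app N := ModuleCat.ofHom (Tensor.map k f (𝟙 N))
      naturality _ _ _ := ModuleCat.hom_ext (Tensor.hom_ext k fun _ _ => rfl) }
  map_id M := by
    ext N : 2
    exact ModuleCat.hom_ext (Tensor.hom_ext k fun _ _ => rfl)
  map_comp f g := by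
    ext N : 2
    exact ModuleCat.hom_ext (Tensor.hom_ext k fun _ _ => rfl)

instance (M : ModuleCat.{u} Rᵐᵒᵖ) : ((tensor k R).obj M).Additive where
  map_add {_ _ f g} := ModuleCat.hom_ext (Tensor.hom_ext k fun m n =>
    congrArg Submodule.Quotient.mk (TensorProduct.tmul_add m (f.hom n) (g.hom n)))

instance : (tensor k R).Additive where
  map_add {_ _ f g} := by
    ext N : 2
    exact ModuleCat.hom_ext (Tensor.hom_ext k fun m n =>
      congrArg Submodule.Quotient.mk (TensorProduct.add_tmul (f.hom m) (g.hom m) n))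

lemma base_smul {A : Type u} [Ring A] [Algebra k A] (M : ModuleCat.{u} A) (c : k) (m : M) :
    c • m = algebraMap k A c • m := rfl

lemma Tensor.span_tmul {M : ModuleCat.{u} Rᵐᵒᵖ} {N : ModuleCat.{u} R}
    (p : Submodule k (Tensor k M N)) (h : ∀ m n, Tensor.tmul m n ∈ p) (x : Tensor k M N) :
    x ∈ p := by
  obtain ⟨x, rfl⟩ := Submodule.Quotient.mk_surjective _ x
  induction x using TensorProduct.induction_on with
  | zero => exact p.zero_mem
  | tmul m n => exact h m n
  | add x y hx hy => exact p.add_mem hx hy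

/-- For a right module `P` and a linear map `s : P ⟶ R^(P)`, the map
`P ⊗_R N ⟶ N^(P)` that takes `p ⊗ n` to the family `(s(p)_q n)_q`. -/
def Tensor.coordinates {P : ModuleCat.{u} Rᵐᵒᵖ} (s : P →ₗ[Rᵐᵒᵖ] (P →₀ Rᵐᵒᵖ))
    (N : ModuleCat.{u} R) : Tensor k P N →ₗ[k] (P →₀ N) :=
  Submodule.liftQ _ (TensorProduct.lift (LinearMap.mk₂ k
    (fun (p : P) (n : N) => (s p).mapRange (fun r => r.unop • n) (by simp))
    (fun p p' n => by ext q; simp [add_smul])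
    (fun c p n => by
      ext q
      simp only [base_smul, map_smul, Finsupp.mapRange_apply, Finsupp.smul_apply, smul_eq_mul,
        MulOpposite.unop_mul, MulOpposite.algebraMap_apply, MulOpposite.unop_op]
      rw [← Algebra.commutes, mul_smul])
    (fun p n n' => by ext q; simp)
    (fun c p n => by
      ext q
      simp only [base_smul, Finsupp.mapRange_apply, Finsupp.smul_apply, ← mul_smul,
        Algebra.commutes]))) (by
      refine Submodule.span_le.2 ?_
      rintro _ ⟨m, r, n, rfl⟩
      simp only [SetLike.mem_coe, LinearMap.mem_ker, map_sub, TensorProduct.lift.tmul,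
        LinearMap.mk₂_apply, sub_eq_zero]
      ext q
      simp [mul_smul])

lemma Tensor.coordinates_tmul {P : ModuleCat.{u} Rᵐᵒᵖ} (s : P →ₗ[Rᵐᵒᵖ] (P →₀ Rᵐᵒᵖ))
    {N : ModuleCat.{u} R} (p : P) (n : N) :
    Tensor.coordinates k s N (Tensor.tmul p n) =
      (s p).mapRange (fun r => r.unop • n) (by simp) := rfl

/-- The map `N^(P) ⟶ P ⊗_R N` that takes a family `(n_q)_q` to the sum of the `q ⊗ n_q`. -/
def Tensor.ofCoordinates (P : ModuleCat.{u} Rᵐᵒᵖ) (N : ModuleCat.{u} R) :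
    (P →₀ N) →ₗ[k] Tensor k P N :=
  Finsupp.lsum k fun q => (Submodule.mkQ _).comp (TensorProduct.mk k P N q)

lemma Tensor.ofCoordinates_single {P : ModuleCat.{u} Rᵐᵒᵖ} {N : ModuleCat.{u} R} (q : P) (n : N) :
    Tensor.ofCoordinates k P N (Finsupp.single q n) = Tensor.tmul q n := by
  simp [ofCoordinates, tmul]

lemma Tensor.ofCoordinates_coordinates {P : ModuleCat.{u} Rᵐᵒᵖ} (s : P →ₗ[Rᵐᵒᵖ] (P →₀ Rᵐᵒᵖ))
    (hs : ∀ p, Finsupp.linearCombination Rᵐᵒᵖ (id : P → P) (s p) = p) (N : ModuleCat.{u} R)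
    (x : Tensor k P N) :
    Tensor.ofCoordinates k P N (Tensor.coordinates k s N x) = x := by
  suffices h : (Tensor.ofCoordinates k P N).comp (Tensor.coordinates k s N) = LinearMap.id from
    LinearMap.congr_fun h x
  refine Tensor.hom_ext k fun p n => ?_
  have key : ∀ t : P →₀ Rᵐᵒᵖ, Tensor.ofCoordinates k P N
      (t.mapRange (fun r => r.unop • n) (by simp)) =
      Tensor.tmul (Finsupp.linearCombination Rᵐᵒᵖ (id : P → P) t) n := by
    intro t
    induction t using Finsupp.induction_linear with
    | zero => simp [tmul]
    | add f g hf hg =>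
      rw [Finsupp.mapRange_add (by intro a b; simp [add_smul]), map_add, hf, hg, map_add]
      simp [tmul, TensorProduct.add_tmul]
    | single q r =>
      rw [Finsupp.mapRange_single, ofCoordinates_single, Finsupp.linearCombination_single,
        ← Tensor.smul_tmul]
      rfl
  rw [LinearMap.comp_apply, coordinates_tmul, key, hs]
  rfl

lemma Tensor.coordinates_map {P : ModuleCat.{u} Rᵐᵒᵖ} (s : P →ₗ[Rᵐᵒᵖ] (P →₀ Rᵐᵒᵖ))
    {N N' : ModuleCat.{u} R} (f : N ⟶ N') (x : Tensor k P N) :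
    Tensor.coordinates k s N' (Tensor.map k (𝟙 P) f x) =
      (Tensor.coordinates k s N x).mapRange f.hom (map_zero _) := by
  suffices h : (Tensor.coordinates k s N').comp (Tensor.map k (𝟙 P) f) =
      (Finsupp.mapRange.linearMap (f.hom.restrictScalars k)).comp (Tensor.coordinates k s N) from
    LinearMap.congr_fun h x
  refine Tensor.hom_ext k fun p n => ?_
  ext q
  simp [coordinates_tmul]

lemma Tensor.ofCoordinates_mapRange {P : ModuleCat.{u} Rᵐᵒᵖ}
    {N N' : ModuleCat.{u} R} (f : N ⟶ N') (x : P →₀ N) :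
    Tensor.ofCoordinates k P N' (x.mapRange f.hom (map_zero _)) =
      Tensor.map k (𝟙 P) f (Tensor.ofCoordinates k P N x) := by
  induction x using Finsupp.induction_linear with
  | zero => simp
  | add x y hx hy => rw [Finsupp.mapRange_add (fun a b => map_add _ a b), map_add, hx, hy, map_add,
      map_add]
  | single q n => simp [ofCoordinates_single]

lemma exists_section (P : ModuleCat.{u} Rᵐᵒᵖ) [Projective P] :
    ∃ s : P →ₗ[Rᵐᵒᵖ] (P →₀ Rᵐᵒᵖ),
      ∀ p, Finsupp.linearCombination Rᵐᵒᵖ (id : P → P) (s p) = p := by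
  have hP : Module.Projective Rᵐᵒᵖ P := (IsProjective.iff_projective P).2 inferInstance
  obtain ⟨s, hs⟩ := (Module.projective_def'.1 hP)
  exact ⟨s, fun p => LinearMap.congr_fun hs p⟩

lemma Tensor.exact (P : ModuleCat.{u} Rᵐᵒᵖ) [Projective P] {N N' N'' : ModuleCat.{u} R}
    {f : N ⟶ N'} {g : N' ⟶ N''} (he : ∀ y, g.hom y = 0 → ∃ x, f.hom x = y)
    (y : Tensor k P N') (hy : Tensor.map k (𝟙 P) g y = 0) :
    ∃ x, Tensor.map k (𝟙 P) f x = y := by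
  obtain ⟨s, hs⟩ := exists_section P
  have h := congrArg (Tensor.coordinates k s N'') hy
  rw [map_zero, Tensor.coordinates_map] at h
  have h0 : ∀ q, ∃ x, f.hom x = Tensor.coordinates k s N' y q ∧
      (Tensor.coordinates k s N' y q = 0 → x = 0) := fun q => by
    by_cases hq : Tensor.coordinates k s N' y q = 0
    · exact ⟨0, by rw [hq, map_zero], fun _ => rfl⟩
    · obtain ⟨x, hx⟩ := he _ (DFunLike.congr_fun h q)
      exact ⟨x, hx, fun h => absurd h hq⟩
  choose x hx hx0 using h0
  let z : P →₀ N := Finsupp.onFinset (Tensor.coordinates k s N' y).support x (by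
    intro q hq
    rw [Finsupp.mem_support_iff]
    exact fun h1 => hq (hx0 q h1))
  refine ⟨Tensor.ofCoordinates k P N z, ?_⟩
  have hz : z.mapRange f.hom (map_zero _) = Tensor.coordinates k s N' y := by
    ext q
    exact hx q
  rw [← Tensor.ofCoordinates_mapRange, hz, Tensor.ofCoordinates_coordinates k s hs]

lemma Tensor.map_injective (P : ModuleCat.{u} Rᵐᵒᵖ) [Projective P] {N N' : ModuleCat.{u} R}
    {f : N ⟶ N'} (hf : Function.Injective f.hom) :
    Function.Injective (Tensor.map k (𝟙 P) f) := by
  obtain ⟨s, hs⟩ := exists_section P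
  intro x y hxy
  have h := congrArg (Tensor.coordinates k s N') hxy
  rw [Tensor.coordinates_map, Tensor.coordinates_map] at h
  rw [← Tensor.ofCoordinates_coordinates k s hs N x, Finsupp.mapRange_injective _ (map_zero _) hf h,
    Tensor.ofCoordinates_coordinates k s hs]

lemma Tensor.map_surjective (P : ModuleCat.{u} Rᵐᵒᵖ) {N N' : ModuleCat.{u} R}
    {f : N ⟶ N'} (hf : Function.Surjective f.hom) :
    Function.Surjective (Tensor.map k (𝟙 P) f) := by
  rw [← LinearMap.range_eq_top, eq_top_iff]
  rintro y -
  refine Tensor.span_tmul k _ (fun p n => ?_) y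
  obtain ⟨m, rfl⟩ := hf n
  exact ⟨Tensor.tmul p m, rfl⟩

lemma tensor_shortExact (P : ModuleCat.{u} Rᵐᵒᵖ) [Projective P] {S : ShortComplex (ModuleCat.{u} R)}
    (hS : S.ShortExact) : (S.map ((tensor k R).obj P)).ShortExact := by
  have hf : Function.Injective S.f := (ModuleCat.mono_iff_injective _).1 hS.mono_f
  have hg : Function.Surjective S.g := (ModuleCat.epi_iff_surjective _).1 hS.epi_g
  have he : Function.Exact S.f S.g :=
    (ShortComplex.ShortExact.moduleCat_exact_iff_function_exact S).1 hS.exact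
  have hmf : Mono (S.map ((tensor k R).obj P)).f :=
    (ModuleCat.mono_iff_injective _).2 (Tensor.map_injective k P hf)
  have heg : Epi (S.map ((tensor k R).obj P)).g :=
    (ModuleCat.epi_iff_surjective _).2 (Tensor.map_surjective k P hg)
  refine { exact := ?_ }
  rw [ShortComplex.ShortExact.moduleCat_exact_iff_function_exact]
  intro x
  refine ⟨fun hx => Tensor.exact k P (fun y hy => (he y).1 hy) x hx, ?_⟩
  rintro ⟨y, rfl⟩
  exact congrArg (fun f => ModuleCat.Hom.hom f y) (S.map ((tensor k R).obj P)).zero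

/-! ### The complexes `P ⊗_R N` and `P ⊗_R I` -/

/-- The complex `P ⊗_R N`. -/
@[simps]
def tensorModule (P : ChainComplex (ModuleCat.{u} Rᵐᵒᵖ) ℤ) :
    ModuleCat.{u} R ⥤ ChainComplex (ModuleCat.{u} k) ℤ where
  obj N :=
    { X n := ((tensor k R).obj (P.X n)).obj N
      d i j := ((tensor k R).map (P.d i j)).app N
      shape i j h := by rw [P.shape i j h, Functor.map_zero]; rfl
      d_comp_d' i j l _ _ := by
        rw [← NatTrans.comp_app, ← Functor.map_comp, P.d_comp_d, Functor.map_zero]; rfl }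
  map f :=
    { f n := ((tensor k R).obj (P.X n)).map f
      comm' i j _ := ((tensor k R).map (P.d i j)).naturality f }
  map_id N := by ext1 n; exact ((tensor k R).obj (P.X n)).map_id N
  map_comp f g := by ext1 n; exact ((tensor k R).obj (P.X n)).map_comp f g

instance (P : ChainComplex (ModuleCat.{u} Rᵐᵒᵖ) ℤ) : (tensorModule k (R := R) P).Additive where
  map_add := by
    intros
    ext1 n
    exact ((tensor k R).obj (P.X n)).map_add

lemma tensorModule_shortExact (P : ChainComplex (ModuleCat.{u} Rᵐᵒᵖ) ℤ)
    (hP : ∀ n, Projective (P.X n)) {S : ShortComplex (ModuleCat.{u} R)} (hS : S.ShortExact) :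
    (S.map (tensorModule k P)).ShortExact :=
  HomologicalComplex.shortExact_of_degreewise_shortExact _ fun n =>
    have := hP n
    tensor_shortExact k (P.X n) hS

/-- The homological functor `H_i (P ⊗_R N)` for a complex `P` of projective right modules. -/
def torOfComplex (P : ChainComplex (ModuleCat.{u} Rᵐᵒᵖ) ℤ) (hP : ∀ n, Projective (P.X n)) :
    HomologicalFunctor (ModuleCat.{u} R) (ModuleCat.{u} k) where
  obj i := tensorModule k P ⋙ HomologicalComplex.homologyFunctor _ _ i
  δ S hS i j h := (tensorModule_shortExact k P hP hS).δ i j h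
  additive i := inferInstance
  naturality φ hS hS' i j h :=
    HomologicalComplex.HomologySequence.δ_naturality ((tensorModule k P).mapShortComplex.map φ)
      (tensorModule_shortExact k P hP hS) (tensorModule_shortExact k P hP hS') i j h
  comp_δ S hS i j h := (tensorModule_shortExact k P hP hS).comp_δ i j h
  δ_comp S hS i j h := (tensorModule_shortExact k P hP hS).δ_comp i j h
  map_comp S hS i := by rw [← Functor.map_comp, S.zero, Functor.map_zero]
  exact₁ S hS i j h := (tensorModule_shortExact k P hP hS).homology_exact₁ i j h
  exact₂ S hS i := (tensorModule_shortExact k P hP hS).homology_exact₂ i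
  exact₃ S hS i j h := (tensorModule_shortExact k P hP hS).homology_exact₃ i j h

/-- The positions `(a, b)` of the terms `P_a ⊗_R I^b` of degree `n`. -/
abbrev Position (n : ℤ) : Type := {p : ℤ × ℕ // p.1 = p.2 + n}

/-- The product over `b` of the modules `P_(b+n) ⊗_R I^b`. -/
abbrev ProdTerm (P : ChainComplex (ModuleCat.{u} Rᵐᵒᵖ) ℤ) (I : CochainComplex (ModuleCat.{u} R) ℕ)
    (n : ℤ) : Type u :=
  ∀ p : Position n, Tensor k (P.X p.1.1) (I.X p.1.2)

section Complexes

variable (P : ChainComplex (ModuleCat.{u} Rᵐᵒᵖ) ℤ) (I J : CochainComplex (ModuleCat.{u} R) ℕ)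

/-- The differential of the product complex, induced by
`p ⊗ x ↦ ∂ p ⊗ x + (-1) ^ |p| p ⊗ ∂ x`: its component at `(a, b)` is the sum of the image of the
component at `(a + 1, b)` and of `(-1) ^ a` times the image of the component at `(a, b - 1)`. -/
def prodD (i j : ℤ) (h : j + 1 = i) : ProdTerm k P I i →ₗ[k] ProdTerm k P I j :=
  LinearMap.pi fun
    | ⟨(a, 0), hp⟩ =>
      (Tensor.map k (P.d (a + 1) a) (𝟙 (I.X 0))).comp
        (LinearMap.proj (⟨(a + 1, 0), by simp at hp ⊢; omega⟩ : Position i))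
    | ⟨(a, b + 1), hp⟩ =>
      (Tensor.map k (P.d (a + 1) a) (𝟙 (I.X (b + 1)))).comp
        (LinearMap.proj (⟨(a + 1, b + 1), by simp at hp ⊢; omega⟩ : Position i)) +
      a.negOnePow • (Tensor.map k (𝟙 (P.X a)) (I.d b (b + 1))).comp
        (LinearMap.proj (⟨(a, b), by simp at hp ⊢; omega⟩ : Position i))

lemma prodD_zero (i j : ℤ) (h : j + 1 = i) (z : ProdTerm k P I i) (a : ℤ) (hp hp') :
    prodD k P I i j h z ⟨(a, 0), hp⟩ =
      Tensor.map k (P.d (a + 1) a) (𝟙 (I.X 0)) (z ⟨(a + 1, 0), hp'⟩) := rfl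

lemma prodD_succ (i j : ℤ) (h : j + 1 = i) (z : ProdTerm k P I i) (a : ℤ) (b : ℕ)
    (hp hp' hp'') :
    prodD k P I i j h z ⟨(a, b + 1), hp⟩ =
      Tensor.map k (P.d (a + 1) a) (𝟙 (I.X (b + 1))) (z ⟨(a + 1, b + 1), hp'⟩) +
      a.negOnePow • Tensor.map k (𝟙 (P.X a)) (I.d b (b + 1)) (z ⟨(a, b), hp''⟩) := rfl

lemma Tensor.map_map {M M' M'' : ModuleCat.{u} Rᵐᵒᵖ} {N N' N'' : ModuleCat.{u} R} (f : M ⟶ M')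
    (f' : M' ⟶ M'') (g : N ⟶ N') (g' : N' ⟶ N'') (x : Tensor k M N) :
    Tensor.map k f' g' (Tensor.map k f g x) = Tensor.map k (f ≫ f') (g ≫ g') x := by
  suffices h : (Tensor.map k f' g').comp (Tensor.map k f g) = Tensor.map k (f ≫ f') (g ≫ g') from
    LinearMap.congr_fun h x
  exact Tensor.hom_ext k fun m n => rfl

@[simp]
lemma Tensor.map_zero_left {M M' : ModuleCat.{u} Rᵐᵒᵖ} {N N' : ModuleCat.{u} R} (g : N ⟶ N') :
    Tensor.map k (0 : M ⟶ M') g = 0 :=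
  Tensor.hom_ext k fun _ n => congrArg Submodule.Quotient.mk (TensorProduct.zero_tmul _ (g.hom n))

@[simp]
lemma Tensor.map_zero_right {M M' : ModuleCat.{u} Rᵐᵒᵖ} {N N' : ModuleCat.{u} R} (f : M ⟶ M') :
    Tensor.map k f (0 : N ⟶ N') = 0 :=
  Tensor.hom_ext k fun m _ => congrArg Submodule.Quotient.mk (TensorProduct.tmul_zero _ (f.hom m))

lemma prodD_prodD (i j l : ℤ) (h : j + 1 = i) (h' : l + 1 = j) (z : ProdTerm k P I i) :
    prodD k P I j l h' (prodD k P I i j h z) = 0 := by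
  funext ⟨⟨a, b⟩, hp⟩
  simp only at hp
  rcases b with _ | _ | b
  · rw [prodD_zero _ _ _ _ _ _ _ _ _ (by simp at hp ⊢; omega),
      prodD_zero _ _ _ _ _ _ _ _ _ (by simp at hp ⊢; omega), Tensor.map_map]
    simp
  · rw [prodD_succ _ _ _ _ _ _ _ _ _ _ (by simp at hp ⊢; omega) (by simp at hp ⊢; omega),
      prodD_succ _ _ _ _ _ _ _ _ _ _ (by simp at hp ⊢; omega) (by simp at hp ⊢; omega),
      prodD_zero _ _ _ _ _ _ _ _ _ (by simp at hp ⊢; omega)]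
    rw [map_add, Tensor.map_map]
    simp [Tensor.map_map, Int.negOnePow_succ]
  · rw [prodD_succ _ _ _ _ _ _ _ _ _ _ (by simp at hp ⊢; omega) (by simp at hp ⊢; omega),
      prodD_succ _ _ _ _ _ _ _ _ _ _ (by simp at hp ⊢; omega) (by simp at hp ⊢; omega),
      prodD_succ _ _ _ _ _ _ _ _ _ _ (by simp at hp ⊢; omega) (by simp at hp ⊢; omega)]
    rw [map_add, Tensor.map_map]
    simp [Tensor.map_map, Int.negOnePow_succ]

/-- The elements of the product with finitely many nonzero components. -/
def finiteSupport (n : ℤ) : Submodule k (ProdTerm k P I n) where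
  carrier := {z | ∃ B : ℕ, ∀ p : Position n, B ≤ p.1.2 → z p = 0}
  zero_mem' := ⟨0, fun _ _ => rfl⟩
  add_mem' := by
    rintro x y ⟨B, hB⟩ ⟨B', hB'⟩
    refine ⟨max B B', fun p hp => ?_⟩
    rw [Pi.add_apply, hB p (le_trans (le_max_left _ _) hp),
      hB' p (le_trans (le_max_right _ _) hp), add_zero]
  smul_mem' := by
    rintro c x ⟨B, hB⟩
    exact ⟨B, fun p hp => by rw [Pi.smul_apply, hB p hp, smul_zero]⟩

lemma mem_finiteSupport_iff (n : ℤ) (z : ProdTerm k P I n) :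
    z ∈ finiteSupport k P I n ↔ {p | z p ≠ 0}.Finite := by
  constructor
  · rintro ⟨B, hB⟩
    refine Set.Finite.of_finite_image (f := fun p : Position n => p.1.2)
      ((Set.finite_lt_nat B).subset ?_) ?_
    · rintro _ ⟨p, hp, rfl⟩
      by_contra h
      exact hp (hB p (not_lt.1 h))
    · rintro ⟨⟨a, b⟩, hp⟩ _ ⟨⟨a', b'⟩, hp'⟩ _ h
      simp only at hp hp' h
      subst h
      simp [hp, hp']
  · intro h
    obtain ⟨B, hB⟩ := (h.image (fun p : Position n => p.1.2)).bddAbove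
    refine ⟨B + 1, fun p hp => ?_⟩
    by_contra h0
    have := hB ⟨p, h0, rfl⟩
    simp only at this
    omega

lemma prodD_mem (i j : ℤ) (h : j + 1 = i) (z : ProdTerm k P I i)
    (hz : z ∈ finiteSupport k P I i) : prodD k P I i j h z ∈ finiteSupport k P I j := by
  obtain ⟨B, hB⟩ := hz
  refine ⟨B + 1, ?_⟩
  rintro ⟨⟨a, b⟩, hp⟩ hb
  simp only at hp hb
  rcases b with _ | b
  · omega
  · rw [prodD_succ _ _ _ _ _ _ _ _ _ _ (by simp at hp ⊢; omega) (by simp at hp ⊢; omega),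
      hB _ (by simp; omega), hB _ (by simp; omega)]
    simp

variable {I J}

/-- The map of products induced by a chain map `φ : I ⟶ J`. -/
def prodMap (φ : I ⟶ J) (n : ℤ) : ProdTerm k P I n →ₗ[k] ProdTerm k P J n :=
  LinearMap.pi fun p => (Tensor.map k (𝟙 (P.X p.1.1)) (φ.f p.1.2)).comp (LinearMap.proj p)

lemma prodMap_apply (φ : I ⟶ J) (n : ℤ) (z : ProdTerm k P I n) (p : Position n) :
    prodMap k P φ n z p = Tensor.map k (𝟙 (P.X p.1.1)) (φ.f p.1.2) (z p) := rfl

lemma prodMap_mem (φ : I ⟶ J) (n : ℤ) (z : ProdTerm k P I n) (hz : z ∈ finiteSupport k P I n) :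
    prodMap k P φ n z ∈ finiteSupport k P J n := by
  obtain ⟨B, hB⟩ := hz
  exact ⟨B, fun p hp => by rw [prodMap_apply, hB p hp, map_zero]⟩

lemma prodMap_prodD (φ : I ⟶ J) (i j : ℤ) (h : j + 1 = i) (z : ProdTerm k P I i) :
    prodMap k P φ j (prodD k P I i j h z) = prodD k P J i j h (prodMap k P φ i z) := by
  funext ⟨⟨a, b⟩, hp⟩
  simp only at hp
  rcases b with _ | b
  · rw [prodMap_apply, prodD_zero _ _ _ _ _ _ _ _ _ (by simp at hp ⊢; omega),
      prodD_zero _ _ _ _ _ _ _ _ _ (by simp at hp ⊢; omega), prodMap_apply]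
    simp [Tensor.map_map]
  · rw [prodMap_apply,
      prodD_succ _ _ _ _ _ _ _ _ _ _ (by simp at hp ⊢; omega) (by simp at hp ⊢; omega),
      prodD_succ _ _ _ _ _ _ _ _ _ _ (by simp at hp ⊢; omega) (by simp at hp ⊢; omega),
      prodMap_apply, prodMap_apply]
    simp [Tensor.map_map]

lemma Tensor.map_id (M : ModuleCat.{u} Rᵐᵒᵖ) (N : ModuleCat.{u} R) :
    Tensor.map k (𝟙 M) (𝟙 N) = LinearMap.id :=
  Tensor.hom_ext k fun _ _ => rfl

lemma prodMap_id (n : ℤ) : prodMap k P (𝟙 I) n = LinearMap.id := by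
  refine LinearMap.ext fun z => funext fun p => ?_
  rw [prodMap_apply]
  simp [Tensor.map_id]

lemma prodMap_comp {L : CochainComplex (ModuleCat.{u} R) ℕ} (φ : I ⟶ J) (ψ : J ⟶ L) (n : ℤ) :
    prodMap k P (φ ≫ ψ) n = (prodMap k P ψ n).comp (prodMap k P φ n) := by
  refine LinearMap.ext fun z => funext fun p => ?_
  rw [LinearMap.comp_apply, prodMap_apply, prodMap_apply, prodMap_apply, Tensor.map_map]
  simp

/-- The map of products of degree `1` that is induced by maps `I^(b+1) ⟶ J^b`. -/
def prodHomotopy (s : ∀ i j, I.X i ⟶ J.X j) (i j : ℤ) (h : j = i + 1) :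
    ProdTerm k P I i →ₗ[k] ProdTerm k P J j :=
  LinearMap.pi fun p => p.1.1.negOnePow •
    (Tensor.map k (𝟙 (P.X p.1.1)) (s (p.1.2 + 1) p.1.2)).comp
      (LinearMap.proj (⟨(p.1.1, p.1.2 + 1), by have := p.2; push_cast; omega⟩ : Position i))

lemma prodHomotopy_apply (s : ∀ i j, I.X i ⟶ J.X j) (i j : ℤ) (h : j = i + 1)
    (z : ProdTerm k P I i) (a : ℤ) (b : ℕ) (hp hp') :
    prodHomotopy k P s i j h z ⟨(a, b), hp⟩ =
      a.negOnePow • Tensor.map k (𝟙 (P.X a)) (s (b + 1) b) (z ⟨(a, b + 1), hp'⟩) := rfl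

lemma prodHomotopy_mem (s : ∀ i j, I.X i ⟶ J.X j) (i j : ℤ) (h : j = i + 1)
    (z : ProdTerm k P I i) (hz : z ∈ finiteSupport k P I i) :
    prodHomotopy k P s i j h z ∈ finiteSupport k P J j := by
  obtain ⟨B, hB⟩ := hz
  refine ⟨B, ?_⟩
  rintro ⟨⟨a, b⟩, hp⟩ hb
  simp only at hp hb
  rw [prodHomotopy_apply _ _ _ _ _ _ _ _ _ _ (by simp; omega), hB _ (by simp; omega)]
  simp

lemma Tensor.map_add_right {M M' : ModuleCat.{u} Rᵐᵒᵖ} {N N' : ModuleCat.{u} R} (f : M ⟶ M')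
    (g g' : N ⟶ N') : Tensor.map k f (g + g') = Tensor.map k f g + Tensor.map k f g' :=
  Tensor.hom_ext k fun m n =>
    congrArg Submodule.Quotient.mk (TensorProduct.tmul_add (f.hom m) (g.hom n) (g'.hom n))

lemma prodMap_homotopy {f g : I ⟶ J} (s : Homotopy f g) (i j l : ℤ) (h : j = i + 1)
    (h' : l + 1 = i) (z : ProdTerm k P I i) :
    prodMap k P f i z = prodD k P J j i h.symm (prodHomotopy k P s.hom i j h z) +
      prodHomotopy k P s.hom l i h'.symm (prodD k P I i l h' z) + prodMap k P g i z := by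
  funext ⟨⟨a, b⟩, hp⟩
  simp only at hp
  have hs := s.comm b
  rw [dNext_eq s.hom (show (ComplexShape.up ℕ).Rel b (b + 1) from rfl)] at hs
  rw [Pi.add_apply, Pi.add_apply, prodMap_apply, prodMap_apply,
    prodHomotopy_apply _ _ _ _ _ _ _ _ _ _ (by simp; omega),
    prodD_succ _ _ _ _ _ _ _ _ _ _ (by simp at hp ⊢; omega) (by simp at hp ⊢; omega)]
  rcases b with _ | b
  · rw [prodD_zero _ _ _ _ _ _ _ _ _ (by simp at hp ⊢; omega),
      prodHomotopy_apply _ _ _ _ _ _ _ _ _ _ (by simp at hp ⊢; omega)]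
    rw [prevD_eq_zero _ _ (by simp)] at hs
    simp [Tensor.map_map, Tensor.map_add_right, hs, Int.negOnePow_succ, smul_smul]
  · rw [prodD_succ _ _ _ _ _ _ _ _ _ _ (by simp at hp ⊢; omega) (by simp at hp ⊢; omega),
      prodHomotopy_apply _ _ _ _ _ _ _ _ _ _ (by simp at hp ⊢; omega),
      prodHomotopy_apply _ _ _ _ _ _ _ _ _ _ (by simp at hp ⊢; omega)]
    rw [prevD_eq s.hom (show (ComplexShape.up ℕ).Rel b (b + 1) from rfl)] at hs
    simp [Tensor.map_map, Tensor.map_add_right, hs, Int.negOnePow_succ, smul_smul]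
    abel

/-- The map of products of degree `-1` that is induced by maps `ψ^b : I^b ⟶ J^(b+1)`. -/
def prodConn (ψ : ∀ b, I.X b ⟶ J.X (b + 1)) (i j : ℤ) (h : j + 1 = i) :
    ProdTerm k P I i →ₗ[k] ProdTerm k P J j :=
  LinearMap.pi fun
    | ⟨(_, 0), _⟩ => 0
    | ⟨(a, b + 1), hp⟩ => (Tensor.map k (𝟙 (P.X a)) (ψ b)).comp
        (LinearMap.proj (⟨(a, b), by simp at hp ⊢; omega⟩ : Position i))

lemma prodConn_zero (ψ : ∀ b, I.X b ⟶ J.X (b + 1)) (i j : ℤ) (h : j + 1 = i)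
    (z : ProdTerm k P I i) (a : ℤ) (hp) : prodConn k P ψ i j h z ⟨(a, 0), hp⟩ = 0 := rfl

lemma prodConn_succ (ψ : ∀ b, I.X b ⟶ J.X (b + 1)) (i j : ℤ) (h : j + 1 = i)
    (z : ProdTerm k P I i) (a : ℤ) (b : ℕ) (hp hp') :
    prodConn k P ψ i j h z ⟨(a, b + 1), hp⟩ =
      Tensor.map k (𝟙 (P.X a)) (ψ b) (z ⟨(a, b), hp'⟩) := rfl

lemma prodConn_mem (ψ : ∀ b, I.X b ⟶ J.X (b + 1)) (i j : ℤ) (h : j + 1 = i)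
    (z : ProdTerm k P I i) (hz : z ∈ finiteSupport k P I i) :
    prodConn k P ψ i j h z ∈ finiteSupport k P J j := by
  obtain ⟨B, hB⟩ := hz
  refine ⟨B + 1, ?_⟩
  rintro ⟨⟨a, b⟩, hp⟩ hb
  simp only at hp hb
  rcases b with _ | b
  · omega
  · rw [prodConn_succ _ _ _ _ _ _ _ _ _ _ (by simp at hp ⊢; omega), hB _ (by simp; omega), map_zero]

lemma prodConn_prodD (ψ : ∀ b, I.X b ⟶ J.X (b + 1))
    (hψ : ∀ b c, ψ b ≫ J.d (b + 1) (c + 1) = I.d b c ≫ ψ c) (i j l : ℤ) (h : j + 1 = i)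
    (h' : l + 1 = j) (z : ProdTerm k P I i) :
    prodConn k P ψ j l h' (prodD k P I i j h z) =
      prodD k P J j l h' (prodConn k P ψ i j h z) := by
  funext ⟨⟨a, b⟩, hp⟩
  simp only at hp
  rcases b with _ | _ | b
  · rw [prodConn_zero, prodD_zero _ _ _ _ _ _ _ _ _ (by simp at hp ⊢; omega), prodConn_zero,
      map_zero]
  · rw [prodConn_succ _ _ _ _ _ _ _ _ _ _ (by simp at hp ⊢; omega),
      prodD_zero _ _ _ _ _ _ _ _ _ (by simp at hp ⊢; omega),
      prodD_succ _ _ _ _ _ _ _ _ _ _ (by simp at hp ⊢; omega) (by simp at hp ⊢; omega),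
      prodConn_zero, prodConn_succ _ _ _ _ _ _ _ _ _ _ (by simp at hp ⊢; omega)]
    simp [Tensor.map_map]
  · rw [prodConn_succ _ _ _ _ _ _ _ _ _ _ (by simp at hp ⊢; omega),
      prodD_succ _ _ _ _ _ _ _ _ _ _ (by simp at hp ⊢; omega) (by simp at hp ⊢; omega),
      prodD_succ _ _ _ _ _ _ _ _ _ _ (by simp at hp ⊢; omega) (by simp at hp ⊢; omega),
      prodConn_succ _ _ _ _ _ _ _ _ _ _ (by simp at hp ⊢; omega),
      prodConn_succ _ _ _ _ _ _ _ _ _ _ (by simp at hp ⊢; omega)]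
    simp [Tensor.map_map, hψ]

/-- The chain complex with terms `X n` and differentials `d`. -/
def complexOf (X : ℤ → ModuleCat.{u} k) (d : ∀ i j : ℤ, j + 1 = i → (X i ⟶ X j))
    (hd : ∀ (i j l : ℤ) (h : j + 1 = i) (h' : l + 1 = j), d i j h ≫ d j l h' = 0) :
    ChainComplex (ModuleCat.{u} k) ℤ where
  X := X
  d i j := if h : j + 1 = i then d i j h else 0
  shape i j h := dif_neg h
  d_comp_d' i j l h h' := by
    rw [dif_pos (show j + 1 = i from h), dif_pos (show l + 1 = j from h'), hd]

lemma complexOf_d (X : ℤ → ModuleCat.{u} k) (d : ∀ i j : ℤ, j + 1 = i → (X i ⟶ X j)) (hd)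
    (i j : ℤ) (h : j + 1 = i) : (complexOf k X d hd).d i j = d i j h := dif_pos h

variable (I J)

/-- The complex with terms `∏_b P_(b+n) ⊗_R I^b`. -/
abbrev prodComplex : ChainComplex (ModuleCat.{u} k) ℤ :=
  complexOf k (fun n => ModuleCat.of k (ProdTerm k P I n))
    (fun i j h => ModuleCat.ofHom (prodD k P I i j h))
    (fun i j l h h' => ModuleCat.hom_ext (LinearMap.ext (prodD_prodD k P I i j l h h')))

/-- The complex `P ⊗_R I` with terms `∐_b P_(b+n) ⊗_R I^b`, a subcomplex of the product. -/
abbrev sumComplex : ChainComplex (ModuleCat.{u} k) ℤ :=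
  complexOf k (fun n => ModuleCat.of k (finiteSupport k P I n))
    (fun i j h => ModuleCat.ofHom ((prodD k P I i j h).restrict (prodD_mem k P I i j h)))
    (fun i j l h h' => ModuleCat.hom_ext (LinearMap.ext fun z =>
      Subtype.ext (prodD_prodD k P I i j l h h' z.1)))

/-- The quotient of the product complex by the subcomplex `P ⊗_R I`. -/
abbrev stableComplex : ChainComplex (ModuleCat.{u} k) ℤ :=
  complexOf k (fun n => ModuleCat.of k (ProdTerm k P I n ⧸ finiteSupport k P I n))
    (fun i j h => ModuleCat.ofHom (Submodule.mapQ _ _ (prodD k P I i j h) (prodD_mem k P I i j h)))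
    (fun i j l h h' => ModuleCat.hom_ext (Submodule.linearMap_qext _ (LinearMap.ext fun z =>
      congrArg (Submodule.mkQ _) (prodD_prodD k P I i j l h h' z))))

/-- The inclusion of `P ⊗_R I` in the product complex. -/
def sumToProd : sumComplex k P I ⟶ prodComplex k P I where
  f n := ModuleCat.ofHom (finiteSupport k P I n).subtype
  comm' i j h := by
    rw [complexOf_d _ _ _ _ _ _ h, complexOf_d _ _ _ _ _ _ h]
    rfl

/-- The projection from the product complex to the quotient complex. -/
def prodToStable : prodComplex k P I ⟶ stableComplex k P I where
  f n := ModuleCat.ofHom (finiteSupport k P I n).mkQ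
  comm' i j h := by
    rw [complexOf_d _ _ _ _ _ _ h, complexOf_d _ _ _ _ _ _ h]
    rfl

/-- The short exact sequence that defines the quotient complex. -/
@[simps]
def stableSES : ShortComplex (ChainComplex (ModuleCat.{u} k) ℤ) where
  f := sumToProd k P I
  g := prodToStable k P I
  zero := by
    ext n : 1
    exact ModuleCat.hom_ext (LinearMap.ext fun z => (Submodule.Quotient.mk_eq_zero _).2 z.2)

lemma stableSES_shortExact : (stableSES k P I).ShortExact := by
  refine HomologicalComplex.shortExact_of_degreewise_shortExact _ fun n => ?_
  have : Mono ((stableSES k P I).map (HomologicalComplex.eval _ _ n)).f :=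
    (ModuleCat.mono_iff_injective _).2 (finiteSupport k P I n).injective_subtype
  have : Epi ((stableSES k P I).map (HomologicalComplex.eval _ _ n)).g :=
    (ModuleCat.epi_iff_surjective _).2 (finiteSupport k P I n).mkQ_surjective
  refine { exact := ?_ }
  rw [ShortComplex.ShortExact.moduleCat_exact_iff_function_exact]
  intro x
  refine ⟨fun hx => ⟨⟨x, (Submodule.Quotient.mk_eq_zero _).1 hx⟩, rfl⟩, ?_⟩
  rintro ⟨y, rfl⟩
  exact (Submodule.Quotient.mk_eq_zero _).2 y.2

variable {I J}

/-- The chain map of products induced by `φ : I ⟶ J`. -/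
def prodComplexMap (φ : I ⟶ J) : prodComplex k P I ⟶ prodComplex k P J where
  f n := ModuleCat.ofHom (prodMap k P φ n)
  comm' i j h := by
    rw [complexOf_d _ _ _ _ _ _ h, complexOf_d _ _ _ _ _ _ h]
    exact ModuleCat.hom_ext (LinearMap.ext fun z => (prodMap_prodD k P φ i j h z).symm)

/-- The chain map `P ⊗_R φ`. -/
def sumComplexMap (φ : I ⟶ J) : sumComplex k P I ⟶ sumComplex k P J where
  f n := ModuleCat.ofHom ((prodMap k P φ n).restrict (prodMap_mem k P φ n))
  comm' i j h := by
    rw [complexOf_d _ _ _ _ _ _ h, complexOf_d _ _ _ _ _ _ h]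
    exact ModuleCat.hom_ext (LinearMap.ext fun z =>
      Subtype.ext (prodMap_prodD k P φ i j h z.1).symm)

/-- The chain map of quotient complexes induced by `φ : I ⟶ J`. -/
def stableComplexMap (φ : I ⟶ J) : stableComplex k P I ⟶ stableComplex k P J where
  f n := ModuleCat.ofHom (Submodule.mapQ _ _ (prodMap k P φ n) (prodMap_mem k P φ n))
  comm' i j h := by
    rw [complexOf_d _ _ _ _ _ _ h, complexOf_d _ _ _ _ _ _ h]
    exact ModuleCat.hom_ext (Submodule.linearMap_qext _ (LinearMap.ext fun z =>
      congrArg (Submodule.mkQ _) (prodMap_prodD k P φ i j h z).symm))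

/-- The induced morphism of short exact sequences. -/
def stableSESMap (φ : I ⟶ J) : stableSES k P I ⟶ stableSES k P J where
  τ₁ := sumComplexMap k P φ
  τ₂ := prodComplexMap k P φ
  τ₃ := stableComplexMap k P φ
  comm₁₂ := by ext n : 1; rfl
  comm₂₃ := by ext n : 1; rfl

/-- The functor that takes `I` to the quotient of the product complex by `P ⊗_R I`. -/
@[simps]
def stableTensor : CochainComplex (ModuleCat.{u} R) ℕ ⥤ ChainComplex (ModuleCat.{u} k) ℤ where
  obj I := stableComplex k P I
  map φ := stableComplexMap k P φ
  map_id I := by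
    ext n : 1
    refine ModuleCat.hom_ext (Submodule.linearMap_qext _ (LinearMap.ext fun z => ?_))
    exact congrArg (Submodule.mkQ _) (LinearMap.congr_fun (prodMap_id k P n) z)
  map_comp φ ψ := by
    ext n : 1
    refine ModuleCat.hom_ext (Submodule.linearMap_qext _ (LinearMap.ext fun z => ?_))
    exact congrArg (Submodule.mkQ _) (LinearMap.congr_fun (prodMap_comp k P φ ψ n) z)

/-- A homotopy between chain maps from its components of degree `1`. -/
def homotopyOfComponents {K L : ChainComplex (ModuleCat.{u} k) ℤ} {f g : K ⟶ L}
    (s : ∀ i j : ℤ, j = i + 1 → (K.X i ⟶ L.X j))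
    (hs : ∀ (i j l : ℤ) (h : j = i + 1) (h' : i = l + 1),
      f.f i = K.d i l ≫ s l i h' + s i j h ≫ L.d j i + g.f i) : Homotopy f g where
  hom i j := if h : j = i + 1 then s i j h else 0
  zero i j h := dif_neg fun h' => h h'.symm
  comm i := by
    rw [dNext_eq _ (show (ComplexShape.down ℤ).Rel i (i - 1) from by simp),
      prevD_eq _ (show (ComplexShape.down ℤ).Rel (i + 1) i from rfl),
      dif_pos (by omega), dif_pos rfl]
    exact hs _ _ _ _ _

/-- Homotopic maps `I ⟶ J` induce homotopic maps of the quotient complexes. -/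
def stableHomotopy {φ ψ : I ⟶ J} (s : Homotopy φ ψ) :
    Homotopy (stableComplexMap k P φ) (stableComplexMap k P ψ) :=
  homotopyOfComponents k
    (fun i j h => ModuleCat.ofHom (Submodule.mapQ _ _ (prodHomotopy k P s.hom i j h)
      (prodHomotopy_mem k P s.hom i j h)))
    (fun i j l h h' => by
      rw [complexOf_d _ _ _ _ _ _ h.symm, complexOf_d _ _ _ _ _ _ h'.symm]
      refine ModuleCat.hom_ext (Submodule.linearMap_qext _ (LinearMap.ext fun z => ?_))
      refine (congrArg (Submodule.mkQ _)
        (prodMap_homotopy k P s i j l h h'.symm z)).trans ?_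
      rw [add_comm (prodD k P J _ _ _ _)]
      rfl)

/-- The map of homology induced by a chain map of degree `-1`. -/
def homologyMapDegreeNegOne {K L : ChainComplex (ModuleCat.{u} k) ℤ}
    (s : ∀ i j : ℤ, j + 1 = i → (K.X i ⟶ L.X j))
    (hs : ∀ (i i' j j' : ℤ) (h : j + 1 = i) (h' : j' + 1 = i') (_ : i' + 1 = i),
      s i j h ≫ L.d j j' = K.d i i' ≫ s i' j' h') (i j : ℤ) (h : j + 1 = i) :
    K.homology i ⟶ L.homology j :=
  ShortComplex.homologyMap (S₁ := K.sc i) (S₂ := L.sc j)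
    { τ₁ := s _ _ (by simp; omega)
      τ₂ := s i j h
      τ₃ := s _ _ (by simp; omega)
      comm₁₂ := hs _ _ _ _ _ _ (by simp)
      comm₂₃ := hs _ _ _ _ _ _ (by simp) }

/-- The map of degree `-1` of quotient complexes that is induced by maps
`ψ^b : I^b ⟶ J^(b+1)` that commute with the differentials. -/
def stableConn (ψ : ∀ b, I.X b ⟶ J.X (b + 1))
    (hψ : ∀ b c, ψ b ≫ J.d (b + 1) (c + 1) = I.d b c ≫ ψ c) (i j : ℤ) (h : j + 1 = i) :
    (stableComplex k P I).homology i ⟶ (stableComplex k P J).homology j :=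
  homologyMapDegreeNegOne k
    (fun i j h => ModuleCat.ofHom (Submodule.mapQ _ _ (prodConn k P ψ i j h)
      (prodConn_mem k P ψ i j h)))
    (fun i i' j j' h h' hi => by
      obtain rfl : j = i' := by omega
      rw [complexOf_d _ _ _ _ _ _ h', complexOf_d _ _ _ _ _ _ h]
      refine ModuleCat.hom_ext (Submodule.linearMap_qext _ (LinearMap.ext fun z => ?_))
      exact congrArg (Submodule.mkQ _) (prodConn_prodD k P ψ hψ i j j' h h' z).symm) i j h

end Complexes

/-! ### The comparison of `P ⊗_R N` with `P ⊗_R I` -/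

section Augmentation

variable (P : ChainComplex (ModuleCat.{u} Rᵐᵒᵖ) ℤ) (N : ModuleCat.{u} R)

/-- The map `P_n ⊗_R N ⟶ P_n ⊗_R I^0` into the product of the `P_(b+n) ⊗_R I^b`. -/
def augProd (n : ℤ) : Tensor k (P.X n) N →ₗ[k] ProdTerm k P (res N) n :=
  LinearMap.pi fun
    | ⟨(_, 0), hp⟩ => Tensor.map k (P.XIsoOfEq (by simp at hp; exact hp.symm)).hom (aug N)
    | ⟨(_, _ + 1), _⟩ => 0

lemma augProd_zero (n a : ℤ) (hp) (x : Tensor k (P.X n) N) :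
    augProd k P N n x ⟨(a, 0), hp⟩ =
      Tensor.map k (P.XIsoOfEq (by simp at hp; exact hp.symm)).hom (aug N) x := rfl

lemma augProd_zero' (n : ℤ) (hp) (x : Tensor k (P.X n) N) :
    augProd k P N n x ⟨(n, 0), hp⟩ = Tensor.map k (𝟙 (P.X n)) (aug N) x := rfl

lemma augProd_succ (n a : ℤ) (b : ℕ) (hp) (x : Tensor k (P.X n) N) :
    augProd k P N n x ⟨(a, b + 1), hp⟩ = 0 := rfl

lemma augProd_mem (n : ℤ) (x : Tensor k (P.X n) N) :
    augProd k P N n x ∈ finiteSupport k P (res N) n := by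
  refine ⟨1, ?_⟩
  rintro ⟨⟨a, b⟩, hp⟩ hb
  simp only at hb
  obtain ⟨b, rfl⟩ : ∃ c, b = c + 1 := ⟨b - 1, by omega⟩
  rfl

lemma augProd_d (i j : ℤ) (h : j + 1 = i) (x : Tensor k (P.X i) N) :
    augProd k P N j (Tensor.map k (P.d i j) (𝟙 N) x) =
      prodD k P (res N) i j h (augProd k P N i x) := by
  subst h
  funext ⟨⟨a, b⟩, hp⟩
  simp only at hp
  rcases b with _ | _ | b
  · obtain rfl : a = j := by simpa using hp
    rw [augProd_zero', prodD_zero _ _ _ _ _ _ _ _ _ (by simp), augProd_zero']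
    simp [Tensor.map_map]
  · obtain rfl : a = 1 + j := by simpa using hp
    rw [augProd_succ, prodD_succ _ _ _ _ _ _ _ _ _ _ (by simp; omega) (by simp; omega),
      augProd_succ, augProd_zero, Tensor.map_map, aug_d]
    simp
  · rw [augProd_succ,
      prodD_succ _ _ _ _ _ _ _ _ _ _ (by simp at hp ⊢; omega) (by simp at hp ⊢; omega),
      augProd_succ, augProd_succ]
    simp

/-- The chain map `P ⊗_R N ⟶ P ⊗_R I` induced by the injective resolution `N ⟶ I`. -/
def augComplex : (tensorModule k P).obj N ⟶ sumComplex k P (res N) where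
  f n := ModuleCat.ofHom ((augProd k P N n).codRestrict _ (augProd_mem k P N n))
  comm' i j h := by
    rw [complexOf_d _ _ _ _ _ _ h]
    exact ModuleCat.hom_ext (LinearMap.ext fun x =>
      Subtype.ext (augProd_d k P N i j h x).symm)

lemma augProd_naturality {N N' : ModuleCat.{u} R} (f : N ⟶ N') (n : ℤ)
    (x : Tensor k (P.X n) N) :
    augProd k P N' n (Tensor.map k (𝟙 (P.X n)) f x) =
      prodMap k P (resMap f) n (augProd k P N n x) := by
  funext ⟨⟨a, b⟩, hp⟩
  rcases b with _ | b
  · rw [augProd_zero, prodMap_apply, augProd_zero, Tensor.map_map, Tensor.map_map,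
      aug_naturality]
    simp
  · rw [augProd_succ, prodMap_apply, augProd_succ, map_zero]

lemma augComplex_naturality {N N' : ModuleCat.{u} R} (f : N ⟶ N') :
    (tensorModule k P).map f ≫ augComplex k P N' =
      augComplex k P N ≫ sumComplexMap k P (resMap f) := by
  ext n : 1
  exact ModuleCat.hom_ext (LinearMap.ext fun x => Subtype.ext (augProd_naturality k P f n x))

lemma aug_exact (x : (res N).X 0) (hx : ((res N).d 0 1).hom x = 0) : ∃ y, (aug N).hom y = x :=
  ((ShortComplex.ShortExact.moduleCat_exact_iff_function_exact _).1
    (injectiveResolution N).exact₀ x).1 hx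

lemma res_exact (b : ℕ) (x : (res N).X (b + 1)) (hx : ((res N).d (b + 1) (b + 2)).hom x = 0) :
    ∃ y, ((res N).d b (b + 1)).hom y = x :=
  ((ShortComplex.ShortExact.moduleCat_exact_iff_function_exact _).1
    ((injectiveResolution N).exact_succ b) x).1 hx

lemma augProd_injective (hP : ∀ n, Projective (P.X n)) (n : ℤ) :
    Function.Injective (augProd k P N n) := by
  intro x y h
  have := hP n
  have h0 := congrFun h ⟨(n, 0), by simp⟩
  rw [augProd_zero', augProd_zero'] at h0
  exact Tensor.map_injective k (P.X n)
    ((ModuleCat.mono_iff_injective _).1 (inferInstanceAs (Mono (aug N)))) h0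

/-- Modulo boundaries, an element of `P ⊗_R I` whose boundary comes from `P ⊗_R N` comes from
`P ⊗_R N`. -/
lemma exists_of_prodD_eq (hP : ∀ n, Projective (P.X n)) (i j l : ℤ) (h : j + 1 = i)
    (h' : l + 1 = j) (B : ℕ) (y : ProdTerm k P (res N) j)
    (hy : ∀ p : Position j, B < p.1.2 → y p = 0) (w : Tensor k (P.X l) N)
    (hw : prodD k P (res N) j l h' y = augProd k P N l w) :
    ∃ (x : Tensor k (P.X j) N), ∃ v ∈ finiteSupport k P (res N) i,
      y = augProd k P N j x + prodD k P (res N) i j h v := by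
  induction B generalizing y with
  | zero =>
    have := hP j
    have h1 := congrFun hw ⟨(j, 1), by simp; omega⟩
    rw [augProd_succ, prodD_succ _ _ _ _ _ _ _ _ _ _ (by simp; omega) (by simp),
      hy _ (by simp), map_zero, zero_add] at h1
    have h2 : Tensor.map k (𝟙 (P.X j)) ((res N).d 0 1) (y ⟨(j, 0), by simp⟩) = 0 := by
      simpa [smul_smul] using congrArg (j.negOnePow • ·) h1
    obtain ⟨x, hx⟩ := Tensor.exact k (P.X j) (aug_exact N) _ h2
    refine ⟨x, 0, Submodule.zero_mem _, ?_⟩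
    rw [map_zero, add_zero]
    funext ⟨⟨a, b⟩, hp⟩
    rcases b with _ | b
    · obtain rfl : a = j := by simpa using hp
      rw [augProd_zero', hx]
    · rw [augProd_succ, hy _ (by simp)]
  | succ B ih =>
    let a : ℤ := (B + 1 : ℕ) + j
    have := hP a
    have h1 := congrFun hw ⟨(a, B + 2), by simp [a]; omega⟩
    rw [augProd_succ, prodD_succ _ _ _ _ _ _ _ _ _ _ (by simp [a]; omega) (by simp [a]),
      hy _ (by simp), map_zero, zero_add] at h1
    have h2 : Tensor.map k (𝟙 (P.X a)) ((res N).d (B + 1) (B + 2))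
        (y ⟨(a, B + 1), by simp [a]⟩) = 0 := by
      simpa [smul_smul] using congrArg (a.negOnePow • ·) h1
    obtain ⟨x, hx⟩ := Tensor.exact k (P.X a) (res_exact N B) _ h2
    let v : ProdTerm k P (res N) i := Pi.single ⟨(a, B), by simp [a]; omega⟩ (a.negOnePow • x)
    have hv0 : ∀ p : Position i, p.1.2 ≠ B → v p = 0 := fun p hp =>
      Pi.single_eq_of_ne (fun h => hp (by rw [h])) _
    have hv1 : v ⟨(a, B), by simp [a]; omega⟩ = a.negOnePow • x := Pi.single_eq_same _ _
    have hv : v ∈ finiteSupport k P (res N) i := ⟨B + 1, fun p hp => hv0 p (by omega)⟩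
    obtain ⟨x', v', hv', e⟩ := ih (y - prodD k P (res N) i j h v) (by
      rintro ⟨⟨c, b⟩, hp⟩ hb
      simp only at hp hb
      obtain ⟨b, rfl⟩ : ∃ b', b = b' + 1 := ⟨b - 1, by omega⟩
      rw [Pi.sub_apply, prodD_succ _ _ _ _ _ _ _ _ _ _ (by simp at hp ⊢; omega)
        (by simp at hp ⊢; omega), hv0 _ (by simp; omega), map_zero, zero_add]
      by_cases hbB : b = B
      · subst hbB
        obtain rfl : c = a := by simp [a]; simpa using hp
        rw [hv1]
        simp [hx, smul_smul]
      · rw [hv0 _ (by simpa using hbB), hy _ (by simp; omega)]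
        simp) (by rw [map_sub, prodD_prodD, sub_zero, hw])
    refine ⟨x', v + v', Submodule.add_mem _ hv hv', ?_⟩
    rw [map_add, add_left_comm, ← e]
    abel

lemma quasiIso_augComplex (hP : ∀ n, Projective (P.X n)) : QuasiIso (augComplex k P N) := by
  have hm : ∀ n, Mono ((augComplex k P N).f n) := fun n => by
    refine (ModuleCat.mono_iff_injective _).2 fun x y hxy => ?_
    exact augProd_injective k P N hP n (congrArg Subtype.val hxy)
  have : Mono (augComplex k P N) := HomologicalComplex.mono_of_mono_f _ hm
  let S := ShortComplex.mk _ _ (cokernel.condition (augComplex k P N))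
  have hS : S.ShortExact := { exact := ShortComplex.exact_cokernel _ }
  have hX : ∀ j, IsZero (S.X₃.homology j) := fun j => by
    rw [← HomologicalComplex.exactAt_iff_isZero_homology,
      HomologicalComplex.exactAt_iff' _ (j + 1) j (j - 1) (by simp) (by simp),
      ShortComplex.moduleCat_exact_iff]
    intro x hx
    have hπ : ∀ n, Function.Surjective (S.g.f n) := fun n =>
      (ModuleCat.epi_iff_surjective _).1 (inferInstanceAs (Epi ((cokernel.π _ : _ ⟶ S.X₃).f n)))
    obtain ⟨y, rfl⟩ := hπ j x
    have h1 : S.g.f (j - 1) (S.X₂.d j (j - 1) y) = 0 := by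
      refine Eq.trans ?_ hx
      exact congrArg (fun f => ModuleCat.Hom.hom f y) (S.g.comm j (j - 1)).symm
    obtain ⟨w, hw⟩ := ((ShortComplex.ShortExact.moduleCat_exact_iff_function_exact _).1
      (hS.map_of_exact (HomologicalComplex.eval _ _ (j - 1))).exact _).1 h1
    obtain ⟨B, hB⟩ := y.2
    have hw' : prodD k P (res N) j (j - 1) (by omega) y.1 = augProd k P N (j - 1) w := by
      rw [complexOf_d _ _ _ _ _ _ (show j - 1 + 1 = j by omega)] at hw
      exact (congrArg Subtype.val hw).symm
    obtain ⟨x, v, hv, e⟩ := exists_of_prodD_eq k P N hP (j + 1) j (j - 1) rfl (by omega) B y.1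
      (fun p hp => hB p hp.le) w hw'
    refine ⟨S.g.f (j + 1) (⟨v, hv⟩ : finiteSupport k P (res N) (j + 1)), ?_⟩
    have e' : y = (augComplex k P N).f j x + S.X₂.d (j + 1) j (⟨v, hv⟩ : finiteSupport k P (res N) (j + 1)) := by
      rw [complexOf_d _ _ _ _ _ _ rfl]
      exact Subtype.ext e
    have e₁ : S.g.f j ((augComplex k P N).f j x) = 0 :=
      congrArg (fun f : S.X₁ ⟶ S.X₃ => ModuleCat.Hom.hom (f.f j) x) S.zero
    rw [e', map_add, e₁, zero_add]
    exact congrArg (fun f => ModuleCat.Hom.hom f (⟨v, hv⟩ : finiteSupport k P (res N) (j + 1)))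
      (S.g.comm (j + 1) j)
  refine ⟨fun j => (quasiIsoAt_iff_isIso_homologyMap _ _).2 ?_⟩
  have : Mono (HomologicalComplex.homologyMap (augComplex k P N) j) :=
    (hS.homology_exact₁ (j + 1) j rfl).mono_g ((hX (j + 1)).eq_of_src _ _)
  have : Epi (HomologicalComplex.homologyMap (augComplex k P N) j) :=
    (hS.homology_exact₂ j).epi_f ((hX j).eq_of_tgt _ _)
  exact isIso_of_mono_of_epi _

/-- The isomorphism `H_n (P ⊗_R N) ⟶ H_n (P ⊗_R I)` induced by the injective resolution `N ⟶ I`,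
for a complex `P` of projective modules. -/
def augIso (hP : ∀ n, Projective (P.X n)) (n : ℤ) :
    ((tensorModule k P).obj N).homology n ≅ (sumComplex k P (res N)).homology n :=
  haveI := quasiIso_augComplex k P N hP
  asIso (HomologicalComplex.homologyMap (augComplex k P N) n)

lemma augIso_hom (hP : ∀ n, Projective (P.X n)) (n : ℤ) :
    (augIso k P N hP n).hom = HomologicalComplex.homologyMap (augComplex k P N) n := rfl

lemma augIso_naturality (hP : ∀ n, Projective (P.X n)) (n : ℤ) {N N' : ModuleCat.{u} R}
    (f : N ⟶ N') :
    HomologicalComplex.homologyMap (sumComplexMap k P (resMap f)) n ≫ (augIso k P N' hP n).inv =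
      (augIso k P N hP n).inv ≫ HomologicalComplex.homologyMap ((tensorModule k P).map f) n := by
  rw [Iso.comp_inv_eq, Category.assoc, Iso.eq_inv_comp, augIso_hom, augIso_hom,
    ← HomologicalComplex.homologyMap_comp, ← HomologicalComplex.homologyMap_comp,
    augComplex_naturality]

end Augmentation

/-! ### Tor, stable homology and complete homology -/

/-- The embedding of the degrees of nonnegatively graded chain complexes in `ℤ`. -/
def degreeEmbedding : ComplexShape.Embedding (ComplexShape.down ℕ) (ComplexShape.down ℤ) :=
  ComplexShape.Embedding.mk' _ _ (fun n : ℕ => (n : ℤ)) (fun _ _ h => Int.ofNat.inj h)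
    (fun i j => by simp; omega)

/-- The chosen projective resolution of `M`, extended by `0` to negative degrees. -/
def resolutionComplex (M : ModuleCat.{u} Rᵐᵒᵖ) : ChainComplex (ModuleCat.{u} Rᵐᵒᵖ) ℤ :=
  (projectiveResolution M).complex.extend degreeEmbedding

lemma projective_resolutionComplex (M : ModuleCat.{u} Rᵐᵒᵖ) (n : ℤ) :
    Projective ((resolutionComplex M).X n) := by
  by_cases h : ∃ m, degreeEmbedding.f m = n
  · obtain ⟨m, rfl⟩ := h
    exact Projective.of_iso ((projectiveResolution M).complex.extendXIso degreeEmbedding rfl).symm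
      ((projectiveResolution M).projective m)
  · exact ((projectiveResolution M).complex.isZero_extend_X degreeEmbedding n
      (by simpa using h)).projective

variable (M : ModuleCat.{u} Rᵐᵒᵖ)

/-- The homological functor `Tor_i^R(M, N)`, the homology of `P ⊗_R N` for a projective
resolution `P` of `M`; it is `0` for `i < 0`. -/
def tor : HomologicalFunctor (ModuleCat.{u} R) (ModuleCat.{u} k) :=
  torOfComplex k (resolutionComplex M) (projective_resolutionComplex M)

/-- Stable homology: `T̃or_i(M, N)` is the homology in degree `i + 1` of the quotient of the
product complex with terms `∏_b P_(b+n) ⊗_R I^b` by its subcomplex `P ⊗_R I`, for a projective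
resolution `P` of `M` and an injective resolution `I` of `N`.
The connecting homomorphism is induced by `p ⊗ x ↦ (-1) ^ (i + 1) p ⊗ ψ x`, where `ψ` is the map of
degree `1` between injective resolutions that represents the short exact sequence. -/
def stor : ConnectedFamily (ModuleCat.{u} R) (ModuleCat.{u} k) where
  obj i := ofResolution (stableTensor k (resolutionComplex M) ⋙
    HomologicalComplex.homologyFunctor _ _ (i + 1))
    (fun _ _ _ _ s => (stableHomotopy k (resolutionComplex M) s).homologyMap_eq (i + 1))
  δ _ hS i j _ := (i + 1).negOnePow • stableConn k (resolutionComplex M) (connLift hS)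
    (connLift_d hS) (i + 1) (j + 1) (by omega)

/-- Complete homology: `Ťor_i(M, N)` is the limit of the right satellites
`S^b Tor_(i+b)(M, N)`. -/
def ctor : ConnectedFamily (ModuleCat.{u} R) (ModuleCat.{u} k) := (tor k M).completion

/-- The canonical morphism `Ťor_i(M, N) ⟶ Tor_i(M, N)`. -/
def ctorτ : FamilyHom (ctor k M) (tor k M).toConnectedFamily := (tor k M).completionτ

/-- The canonical morphism `T̃or_i(M, N) ⟶ Tor_i(M, N)`: the connecting homomorphism
`T̃or_i(M, N) ⟶ H_i(P ⊗_R I)` of the short exact sequence that defines stable homology, followed by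
the inverse of the isomorphism `H_i(P ⊗_R N) ⟶ H_i(P ⊗_R I)`. -/
def storToTor : FamilyHom (stor k M) (tor k M).toConnectedFamily := fun i =>
  { app N := (stableSES_shortExact k (resolutionComplex M) (res N)).δ (i + 1) i rfl ≫
      (augIso k (resolutionComplex M) N (projective_resolutionComplex M) i).inv
    naturality N N' f := by
      have h := HomologicalComplex.HomologySequence.δ_naturality
        (stableSESMap k (resolutionComplex M) (resMap f))
        (stableSES_shortExact k (resolutionComplex M) (res N))
        (stableSES_shortExact k (resolutionComplex M) (res N')) (i + 1) i rfl
      refine (Category.assoc _ _ _).symm.trans ?_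
      refine (congrArg (· ≫ _) h.symm).trans ?_
      refine (Category.assoc _ _ _).trans ((congrArg _
        (augIso_naturality k (resolutionComplex M) (projective_resolutionComplex M) i f)).trans ?_)
      exact (Category.assoc _ _ _).symm }

/-- `M` has finite copure flat dimension: there is an `n` with `Tor_i(M, E) = 0` for every
injective module `E` and every `i ≥ n`. -/
def HasFiniteCopureFlatDimension : Prop :=
  ∃ n : ℤ, ∀ i : ℤ, n ≤ i → ∀ E : ModuleCat.{u} R, Injective E → IsZero (((tor k M).obj i).obj E)

end Tensor

end CompleteHomology

end

/-! Only two properties of a connected family `U` are needed to map it to the completion of `T`: its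
connecting homomorphisms are natural (`Natural`), and they are invertible for sequences with
injective middle term (`ShiftsInjectives`). A homological functor that vanishes on injectives has
both. For stable homology both are proved on complexes, without recourse to its long exact sequence.

Existence. Dimension shifting identifies `U i N` with `U (i + k) (Ω^k N)` (`isIso_iterδ`). Applying
`υ` and projecting to the satellite `S^k T (i + k) (N)` gives components that are compatible with
the inverse system, because `υ` commutes with the connecting homomorphisms of the cosyzygy
sequences; they assemble to `completionLift`. It is connected because naturality moves a connecting
homomorphism past the iterated ones (`iterδ_δ`).

Uniqueness. The component at stage 0 is determined by the composite with `τ`, since `S^0 T ≅ T`.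
Embed `N` in an injective module with cokernel `N''`. By `δ_proj_succ`, the component at stage `k +
1` on `N` is determined by the one at stage `k` on `N''`. The limit vanishes on an injective `E`
because the cosyzygy sequences of `E` split, which kills all satellites of positive order.

Stable homology. The quotient complex sees only the tail of `I`. Hence the maps `ψ` need to be
natural only up to homotopy and up to one component (`connLift_naturality`). If the middle term of
`0 ⟶ N' ⟶ N ⟶ N'' ⟶ 0` is injective, then splicing `N` to a resolution of `N''` resolves `N'`, and
the connecting homomorphism becomes an index shift. A chase with representatives shows that `ð` is
connected.

Isomorphism. Let Tor vanish on injectives from degree `n` on. The columns `P ⊗ I^b` are then exact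
in these degrees, hence so is the product complex (`exists_prodD_eq`), and `ð` is invertible there.
In the same range the inverse system is constant. So for `i + k ≥ n` the composite of `σ i` with the
invertible projection to stage `k` is a composite of isomorphisms. -/

noncomputable section

namespace CompleteHomology

universe v₁ v₂ u₁ u₂

/-! ### Connecting homomorphisms and dimension shifting along cosyzygies -/

section General

variable {C : Type u₁} [Category.{v₁} C] [Abelian C] {D : Type u₂} [Category.{v₂} D] [Abelian D]

namespace ConnectedFamily

/-- The connecting homomorphisms are natural in the short exact sequence. -/
def Natural (U : ConnectedFamily C D) : Prop :=
  ∀ {S S' : ShortComplex C} (φ : S ⟶ S') (hS : S.ShortExact) (hS' : S'.ShortExact)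
    (i j : ℤ) (h : j + 1 = i),
    U.δ S hS i j h ≫ (U.obj j).map φ.τ₁ = (U.obj i).map φ.τ₃ ≫ U.δ S' hS' i j h

/-- The connecting homomorphisms of short exact sequences with injective middle term are
isomorphisms. -/
def ShiftsInjectives (U : ConnectedFamily C D) : Prop :=
  ∀ (S : ShortComplex C) (hS : S.ShortExact), Injective S.X₂ →
    ∀ (i j : ℤ) (h : j + 1 = i), IsIso (U.δ S hS i j h)

end ConnectedFamily

namespace HomologicalFunctor

lemma isIso_δ (T : HomologicalFunctor C D) {S : ShortComplex C} (hS : S.ShortExact) (i j : ℤ)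
    (h : j + 1 = i) (hi : IsZero ((T.obj i).obj S.X₂)) (hj : IsZero ((T.obj j).obj S.X₂)) :
    IsIso (T.δ S hS i j h) := by
  have : Mono (T.δ S hS i j h) := (T.exact₃ S hS i j h).mono_g (hi.eq_of_src _ _)
  have : Epi (T.δ S hS i j h) := (T.exact₁ S hS i j h).epi_f (hj.eq_of_tgt _ _)
  exact isIso_of_mono_of_epi _

lemma shiftsInjectives (T : HomologicalFunctor C D)
    (hT : VanishesOnInjectives T.toConnectedFamily) : T.toConnectedFamily.ShiftsInjectives :=
  fun _ hS hE i j h => T.isIso_δ hS i j h (hT i _ hE) (hT j _ hE)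

lemma natural (T : HomologicalFunctor C D) : T.toConnectedFamily.Natural :=
  fun φ hS hS' i j h => T.naturality φ hS hS' i j h

end HomologicalFunctor

variable [EnoughInjectives C]

lemma injective_res (N : C) (k : ℕ) : Injective ((res N).X k) :=
  (injectiveResolution N).injective k

instance isIso_cosyzygyZero (N : C) : IsIso (cosyzygyZero N) := by
  refine ⟨(res N).liftCycles (aug N) 1 (by simp) (by simp), ?_, ?_⟩
  · rw [← cancel_mono ((res N).iCycles 0)]
    simp [cosyzygyZero_aug]
  · rw [← cancel_mono (aug N), Category.assoc, cosyzygyZero_aug]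
    simp

/-- The map `ψ` lifts `toCosyzygy` to resolutions, and the augmentation of the truncated resolution
is the inclusion of `Ω^1 N'` in `I^1`. This is the only link between `ψ` and the given sequence. -/
lemma aug_connLift {S : ShortComplex C} (hS : S.ShortExact) :
    aug S.X₃ ≫ connLift hS 0 = toCosyzygy hS ≫ (res S.X₁).iCycles 1 := by
  refine (InjectiveResolution.desc_commutes_zero (toCosyzygy hS)
    (truncRes (injectiveResolution S.X₁)) (injectiveResolution S.X₃)).trans ?_
  refine congrArg (toCosyzygy hS ≫ ·) ?_
  exact CochainComplex.fromSingle₀Equiv_symm_apply_f_zero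
    (C := CochainComplex.truncate.obj (res S.X₁))
    ((res S.X₁).iCycles 1) ((res S.X₁).iCycles_d 1 2)

lemma connCosyzygy_zero {S : ShortComplex C} (hS : S.ShortExact) :
    connCosyzygy hS 0 = cosyzygyZero S.X₃ ≫ toCosyzygy hS := by
  rw [← cancel_mono ((res S.X₁).iCycles (0 + 1)), connCosyzygy_i, Category.assoc]
  refine Eq.trans ?_ (congrArg (cosyzygyZero S.X₃ ≫ ·) (aug_connLift hS))
  rw [cosyzygyZero_aug_assoc]

/-- The morphism from a short exact sequence `0 ⟶ N' ⟶ N ⟶ N'' ⟶ 0` to the short exact sequence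
`0 ⟶ Ω^0 N' ⟶ I^0 ⟶ Ω^1 N' ⟶ 0`. -/
def toCosyzygySES {S : ShortComplex C} (hS : S.ShortExact) : S ⟶ cosyzygySES S.X₁ 0 where
  τ₁ := inv (cosyzygyZero S.X₁)
  τ₂ := extendAug hS
  τ₃ := toCosyzygy hS
  comm₁₂ := by
    dsimp
    rw [IsIso.inv_comp_eq, f_extendAug, cosyzygyZero_aug]
  comm₂₃ := (g_toCosyzygy hS).symm

/-- Inductively `Ω^k E` is injective, so its sequence splits and `Ω^(k+1) E` is a retract of `I^k`.
-/
lemma injective_cycles (E : C) [Injective E] (k : ℕ) : Injective ((res E).cycles k) := by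
  induction k with
  | zero => exact Injective.of_iso (asIso (cosyzygyZero E)).symm inferInstance
  | succ k ih =>
    let s := (cosyzygySES_shortExact E k).splittingOfInjective
    have := injective_res E k
    exact Retract.injective (Y := (res E).X k) ⟨s.s, (res E).toCycles k (k + 1), s.s_g⟩

/-- A section of `I^k ⟶ Ω^(k+1) E` makes the identity of `T (Ω^(k+1) E)` factor through `T (I^k)`,
which dies in the satellite. Positive order is essential: `S^0 T (E)` is `T (E)`. -/
lemma isZero_satellite_of_injective (T : C ⥤ D) (hT : T.Additive) (k : ℕ) (E : C) [Injective E] :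
    IsZero ((satellite T hT (k + 1)).obj E) := by
  have := injective_cycles E k
  let s := (cosyzygySES_shortExact E k).splittingOfInjective
  have h : satelliteπ T hT (k + 1) E = 0 := by
    rw [← Category.id_comp (satelliteπ T hT (k + 1) E), ← T.map_id]
    rw [show 𝟙 ((res E).cycles (k + 1)) = s.s ≫ (res E).toCycles k (k + 1) from s.s_g.symm,
      T.map_comp, Category.assoc, toCycles_satelliteπ, comp_zero]
  exact IsZero.of_epi_eq_zero _ h

lemma isIso_satelliteπ (T : C ⥤ D) (hT : T.Additive) (k : ℕ) (N : C)
    (h : T.map ((res N).toCycles ((ComplexShape.up ℕ).prev k) k) = 0) :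
    IsIso (satelliteπ T hT k N) :=
  coequalizer.π_of_eq h

/-- The isomorphism `S^0 T ≅ T`. -/
def satelliteZero (T : C ⥤ D) (hT : T.Additive) (N : C) : (satellite T hT 0).obj N ⟶ T.obj N :=
  satelliteDesc T hT 0 N (T.map (cosyzygyZero N)) (by
    rw [(res N).toCycles_eq_zero (by simp), T.map_zero, zero_comp])

@[simp]
lemma satelliteπ_satelliteZero (T : C ⥤ D) (hT : T.Additive) (N : C) :
    satelliteπ T hT 0 N ≫ satelliteZero T hT N = T.map (cosyzygyZero N) :=
  satelliteπ_desc _ _ _ _ _ _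

instance (T : C ⥤ D) (hT : T.Additive) (N : C) : IsIso (satelliteZero T hT N) := by
  have : IsIso (satelliteπ T hT 0 N) :=
    isIso_satelliteπ T hT 0 N (by rw [(res N).toCycles_eq_zero (by simp), T.map_zero])
  exact IsIso.of_isIso_fac_left (satelliteπ_satelliteZero T hT N)

namespace ConnectedFamily

variable (U : ConnectedFamily C D)

/-- The composite `U i (Ω^k N) ⟶ U (i - 1) (Ω^(k-1) N) ⟶ ⋯ ⟶ U j (Ω^0 N) ≅ U j (N)` of connecting
homomorphisms, where `i = j + k`. -/
def iterδ : ∀ (k : ℕ) (i j : ℤ) (_ : j + k = i) (N : C),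
    (U.obj i).obj ((res N).cycles k) ⟶ (U.obj j).obj N
  -- The degrees `i` and `j` are equal only through `h`, hence the transport; `iterδ_zero` removes
  -- it.
  | 0, i, j, h, N => (U.obj i).map (cosyzygyZero N) ≫
      (eqToHom (by rw [← h, Nat.cast_zero, add_zero]) : U.obj i ⟶ U.obj j).app N
  | k + 1, i, j, h, N => U.δ (cosyzygySES N k) (cosyzygySES_shortExact N k) i (i - 1) (by omega) ≫
      iterδ k (i - 1) j (by push_cast at h; omega) N

lemma iterδ_zero (i : ℤ) (h : i + (0 : ℕ) = i) (N : C) :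
    U.iterδ 0 i i h N = (U.obj i).map (cosyzygyZero N) := by
  simp [iterδ]

lemma iterδ_succ (k : ℕ) (i i' j : ℤ) (h : j + (k + 1 : ℕ) = i) (hi : i' + 1 = i)
    (h' : j + k = i') (N : C) :
    U.iterδ (k + 1) i j h N = U.δ (cosyzygySES N k) (cosyzygySES_shortExact N k) i i' hi ≫
      U.iterδ k i' j h' N := by
  obtain rfl : i' = i - 1 := by omega
  rfl

variable {U}

lemma ShiftsInjectives.isIso_iterδ (hU : U.ShiftsInjectives) (k : ℕ) (i j : ℤ) (h : j + k = i)
    (N : C) : IsIso (U.iterδ k i j h N) := by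
  induction k generalizing i with
  | zero =>
    obtain rfl : i = j := by simpa using h.symm
    rw [iterδ_zero]
    infer_instance
  | succ k ih =>
    rw [iterδ_succ U k i (j + k) j h (by push_cast at h; omega) rfl]
    have := hU _ (cosyzygySES_shortExact N k) (injective_res N k) i (j + k)
      (by push_cast at h; omega)
    have := ih (j + k) rfl
    infer_instance

/-- The morphism of short exact sequences of cosyzygies that is induced by `f`. -/
@[simps]
def _root_.CompleteHomology.cosyzygySESMap {N N' : C} (f : N ⟶ N') (k : ℕ) :
    cosyzygySES N k ⟶ cosyzygySES N' k where
  τ₁ := HomologicalComplex.cyclesMap (resMap f) k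
  τ₂ := (resMap f).f k
  τ₃ := HomologicalComplex.cyclesMap (resMap f) (k + 1)
  comm₂₃ := by
    dsimp
    rw [← cancel_mono ((res N').iCycles (k + 1))]
    simp

/-- The morphism between short exact sequences of cosyzygies of `N''` and of `N'` that is induced by
a short exact sequence `0 ⟶ N' ⟶ N ⟶ N'' ⟶ 0`. -/
@[simps]
def _root_.CompleteHomology.cosyzygySESConn {S : ShortComplex C} (hS : S.ShortExact) (k : ℕ) :
    cosyzygySES S.X₃ k ⟶ cosyzygySES S.X₁ (k + 1) where
  τ₁ := connCosyzygy hS k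
  τ₂ := connLift hS k
  τ₃ := connCosyzygy hS (k + 1)
  comm₁₂ := by simp
  comm₂₃ := (toCycles_connCosyzygy hS k (k + 1)).symm

lemma Natural.cosyzygyδ_naturality (hU : U.Natural) (k : ℕ) (i j : ℤ) (h : j + 1 = i) {N N' : C}
    (f : N ⟶ N') :
    U.δ (cosyzygySES N k) (cosyzygySES_shortExact N k) i j h ≫
        (U.obj j).map (HomologicalComplex.cyclesMap (resMap f) k) =
      (U.obj i).map (HomologicalComplex.cyclesMap (resMap f) (k + 1)) ≫
        U.δ (cosyzygySES N' k) (cosyzygySES_shortExact N' k) i j h :=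
  hU (cosyzygySESMap f k) _ _ i j h

lemma Natural.cosyzygyδ_conn (hU : U.Natural) (k : ℕ) (i j : ℤ) (h : j + 1 = i)
    {S : ShortComplex C} (hS : S.ShortExact) :
    U.δ (cosyzygySES S.X₃ k) (cosyzygySES_shortExact S.X₃ k) i j h ≫
        (U.obj j).map (connCosyzygy hS k) =
      (U.obj i).map (connCosyzygy hS (k + 1)) ≫
        U.δ (cosyzygySES S.X₁ (k + 1)) (cosyzygySES_shortExact S.X₁ (k + 1)) i j h :=
  hU (cosyzygySESConn hS k) _ _ i j h

/-- Every short exact sequence starting at `N'` maps to the first cosyzygy sequence of `N'`, by a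
morphism that is invertible on the left term. Naturality thus reduces all connecting homomorphisms
to those of cosyzygy sequences. -/
lemma Natural.δ_eq (hU : U.Natural) (i j : ℤ) (h : j + 1 = i)
    {S : ShortComplex C} (hS : S.ShortExact) :
    U.δ S hS i j h = (U.obj i).map (toCosyzygy hS) ≫
      U.δ (cosyzygySES S.X₁ 0) (cosyzygySES_shortExact S.X₁ 0) i j h ≫
        (U.obj j).map (cosyzygyZero S.X₁) := by
  have e : U.δ S hS i j h ≫ (U.obj j).map (inv (cosyzygyZero S.X₁)) =
      (U.obj i).map (toCosyzygy hS) ≫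
        U.δ (cosyzygySES S.X₁ 0) (cosyzygySES_shortExact S.X₁ 0) i j h :=
    hU (toCosyzygySES hS) _ _ i j h
  rw [← reassoc_of% e, ← Functor.map_comp, IsIso.inv_hom_id, CategoryTheory.Functor.map_id,
    Category.comp_id]

lemma Natural.iterδ_naturality (hU : U.Natural) (k : ℕ) (i j : ℤ) (h : j + k = i) {N N' : C}
    (f : N ⟶ N') :
    U.iterδ k i j h N ≫ (U.obj j).map f =
      (U.obj i).map (HomologicalComplex.cyclesMap (resMap f) k) ≫ U.iterδ k i j h N' := by
  induction k generalizing i with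
  | zero =>
    obtain rfl : i = j := by simpa using h.symm
    rw [iterδ_zero, iterδ_zero, ← Functor.map_comp, ← Functor.map_comp, cosyzygyZero_naturality]
  | succ k ih =>
    have hi : j + k + 1 = i := by push_cast at h; omega
    rw [iterδ_succ U k i (j + k) j h hi rfl, iterδ_succ U k i (j + k) j h hi rfl, Category.assoc,
      ih _ rfl]
    rw [← Category.assoc, hU.cosyzygyδ_naturality, Category.assoc]

/-- For `k = 0` this is `Natural.δ_eq`. In the induction the maps `Ω^k N'' ⟶ Ω^(k+1) N'` form a
morphism of cosyzygy sequences, so they pass through one more connecting homomorphism without a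
sign. -/
lemma Natural.iterδ_δ (hU : U.Natural) (k : ℕ) (i i' j j' : ℤ) (h : j + k = i) (hj : j' + 1 = j)
    (hi : i' + 1 = i) (h' : j' + (k + 1 : ℕ) = i) {S : ShortComplex C} (hS : S.ShortExact) :
    U.iterδ k i j h S.X₃ ≫ U.δ S hS j j' hj =
      (U.obj i).map (connCosyzygy hS k) ≫ U.iterδ (k + 1) i j' h' S.X₁ := by
  induction k generalizing i i' with
  | zero =>
    obtain rfl : i = j := by simpa using h.symm
    rw [iterδ_succ U 0 i j' j' h' hj (by simp), iterδ_zero, iterδ_zero, connCosyzygy_zero,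
      Functor.map_comp, Category.assoc, ← hU.δ_eq]
  | succ k ih =>
    obtain rfl : i' = j + k := by push_cast at h; omega
    rw [iterδ_succ U k i (j + k) j h hi rfl, iterδ_succ U (k + 1) i (j + k) j' h' hi
      (by push_cast; omega), Category.assoc,
      ih (j + k) (j + k - 1) rfl (by omega) (by push_cast; omega),
      ← Category.assoc, hU.cosyzygyδ_conn, Category.assoc]

end ConnectedFamily

end General

/-! ### The limit of the satellites and its universal property -/

section Completion

variable {C : Type u₁} [Category.{v₁} C] [Abelian C] [EnoughInjectives C]
  {D : Type u₂} [Category.{v₂} D] [Abelian D]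

namespace HomologicalFunctor

variable (T : HomologicalFunctor C D)

/-- The map `S^k T i (N'') ⟶ S^(k+1) T i (N')` that is induced by the map of cosyzygies
`Ω^k N'' ⟶ Ω^(k+1) N'` of a short exact sequence `0 ⟶ N' ⟶ N ⟶ N'' ⟶ 0`. -/
def satelliteShift (k : ℕ) (i : ℤ) {S : ShortComplex C} (hS : S.ShortExact) :
    (satellite (T.obj i) (T.additive i) k).obj S.X₃ ⟶
      (satellite (T.obj i) (T.additive i) (k + 1)).obj S.X₁ :=
  satelliteDesc _ _ _ _ ((T.obj i).map (connCosyzygy hS k) ≫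
    satelliteπ (T.obj i) (T.additive i) (k + 1) S.X₁) (by
      have := T.additive i
      by_cases h : (ComplexShape.up ℕ).Rel ((ComplexShape.up ℕ).prev k) k
      · rw [← Category.assoc, ← Functor.map_comp, toCycles_connCosyzygy, Functor.map_comp,
          Category.assoc, toCycles_satelliteπ, comp_zero]
      · rw [(res S.X₃).toCycles_eq_zero h, Functor.map_zero, zero_comp])

lemma satelliteπ_transition (k : ℕ) (i j : ℤ) (h : j + 1 = i) (N : C) :
    satelliteπ (T.obj i) (T.additive i) (k + 1) N ≫ (T.transition k i j h).app N =
      T.cosyzygyδ k i j h N ≫ satelliteπ (T.obj j) (T.additive j) k N :=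
  satelliteπ_desc _ _ _ _ _ _

lemma satelliteπ_satelliteδ (k : ℕ) (i j : ℤ) (h : j + 1 = i) {S : ShortComplex C}
    (hS : S.ShortExact) :
    satelliteπ (T.obj i) (T.additive i) k S.X₃ ≫ T.satelliteδ k i j h hS =
      (T.obj i).map (connCosyzygy hS k) ≫ T.cosyzygyδ k i j h S.X₁ ≫
        satelliteπ (T.obj j) (T.additive j) k S.X₁ :=
  satelliteπ_desc _ _ _ _ _ _

lemma satelliteπ_satelliteShift (k : ℕ) (i : ℤ) {S : ShortComplex C} (hS : S.ShortExact) :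
    satelliteπ (T.obj i) (T.additive i) k S.X₃ ≫ T.satelliteShift k i hS =
      (T.obj i).map (connCosyzygy hS k) ≫
        satelliteπ (T.obj i) (T.additive i) (k + 1) S.X₁ :=
  satelliteπ_desc _ _ _ _ _ _

/-- Naturality for the morphism of cosyzygy sequences interchanges the connecting homomorphism and
the map of cosyzygies. The transition map, split off on the left, is then absorbed by the
projections from the limit. -/
lemma satelliteδ_succ (k : ℕ) (i j : ℤ) (h : j + 1 = i) {S : ShortComplex C}
    (hS : S.ShortExact) :
    T.satelliteδ (k + 1) i j h hS =
      (T.transition k i j h).app S.X₃ ≫ T.satelliteShift k j hS := by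
  rw [← cancel_epi (satelliteπ (T.obj i) (T.additive i) (k + 1) S.X₃), satelliteπ_satelliteδ,
    ← Category.assoc (satelliteπ _ _ _ _), satelliteπ_transition, Category.assoc,
    satelliteπ_satelliteShift, T.cosyzygyδ_conn_assoc]

/-- When `T i` and `T j` vanish on the terms of the resolution, nothing is divided out in either
satellite, and the transition map is the connecting homomorphism of a sequence whose middle term is
killed. -/
lemma isIso_transition (k : ℕ) (i j : ℤ) (h : j + 1 = i)
    (hi : ∀ E : C, Injective E → IsZero ((T.obj i).obj E))
    (hj : ∀ E : C, Injective E → IsZero ((T.obj j).obj E)) : IsIso (T.transition k i j h) := by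
  have (N : C) : IsIso ((T.transition k i j h).app N) := by
    have := isIso_satelliteπ (T.obj i) (T.additive i) (k + 1) N
      ((hi _ (injective_res N _)).eq_of_src _ _)
    have := isIso_satelliteπ (T.obj j) (T.additive j) k N
      ((hj _ (injective_res N _)).eq_of_src _ _)
    have : IsIso (T.cosyzygyδ k i j h N) := T.isIso_δ (cosyzygySES_shortExact N k) i j h
      (hi _ (injective_res N k)) (hj _ (injective_res N k))
    have h' : IsIso (satelliteπ (T.obj i) (T.additive i) (k + 1) N ≫
        (T.transition k i j h).app N) := by
      rw [satelliteπ_transition]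
      infer_instance
    exact IsIso.of_isIso_comp_left (satelliteπ (T.obj i) (T.additive i) (k + 1) N) _
  exact NatIso.isIso_of_isIso_app _

section Lift

variable {U : ConnectedFamily C D}

variable (hU : U.ShiftsInjectives) (hN : U.Natural) (υ : FamilyHom U T.toConnectedFamily)

/-- The composite `U i (N) ≅ U m (Ω^k N) ⟶ T m (Ω^k N) ⟶ S^k T m (N)`, where `m = i + k`. -/
def liftComponent (k : ℕ) (i m : ℤ) (h : i + k = m) :
    U.obj i ⟶ satellite (T.obj m) (T.additive m) k where
  app N :=
    haveI := hU.isIso_iterδ k m i h N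
    inv (U.iterδ k m i h N) ≫ (υ m).app _ ≫ satelliteπ (T.obj m) (T.additive m) k N
  naturality N N' f := by
    have := hU.isIso_iterδ k m i h N
    have := hU.isIso_iterδ k m i h N'
    rw [Category.assoc, Category.assoc, IsIso.eq_inv_comp, ← Category.assoc (U.iterδ k m i h N),
      hN.iterδ_naturality, Category.assoc, IsIso.hom_inv_id_assoc, satelliteπ_naturality,
      ← Category.assoc, ← Category.assoc, (υ m).naturality]

lemma iterδ_liftComponent (k : ℕ) (i m : ℤ) (h : i + k = m) (N : C) :
    U.iterδ k m i h N ≫ (T.liftComponent hU hN υ k i m h).app N =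
      (υ m).app _ ≫ satelliteπ (T.obj m) (T.additive m) k N := by
  have := hU.isIso_iterδ k m i h N
  exact IsIso.hom_inv_id_assoc _ _

variable {υ}

/-- The first factor of the iterated connecting homomorphism belongs to the sequence that defines
the transition map, so the claim is that `υ` commutes with this one connecting homomorphism. -/
lemma liftComponent_transition (hυ : υ.Connected) (k : ℕ) (i m m' : ℤ) (h : i + (k + 1 : ℕ) = m)
    (h' : i + k = m') (hm : m' + 1 = m) :
    T.liftComponent hU hN υ (k + 1) i m h ≫ T.transition k m m' hm =
      T.liftComponent hU hN υ k i m' h' := by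
  ext N : 2
  have := hU.isIso_iterδ (k + 1) m i h N
  rw [← cancel_epi (U.iterδ (k + 1) m i h N), NatTrans.comp_app, ← Category.assoc,
    iterδ_liftComponent, Category.assoc, satelliteπ_transition, U.iterδ_succ k m m' i h hm h',
    Category.assoc, iterδ_liftComponent, ← Category.assoc, ← Category.assoc]
  exact congrArg (· ≫ _) (hυ (cosyzygySES N k) (cosyzygySES_shortExact N k) m m' hm).symm

/-- After precomposition with the invertible `iterδ`, the left side is rewritten by `iterδ_δ`. What
remains is connectedness of `υ` for one cosyzygy sequence of `N'`. -/
lemma δ_liftComponent (hυ : υ.Connected) {S : ShortComplex C} (hS : S.ShortExact) (k : ℕ)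
    (i j m m' : ℤ) (h : j + 1 = i) (hm : i + k = m) (hm' : j + k = m') (hmm : m' + 1 = m) :
    U.δ S hS i j h ≫ (T.liftComponent hU hN υ k j m' hm').app S.X₁ =
      (T.liftComponent hU hN υ k i m hm).app S.X₃ ≫ T.satelliteδ k m m' hmm hS := by
  have := hU.isIso_iterδ k m i hm S.X₃
  have e : j + (k + 1 : ℕ) = m := by push_cast; omega
  rw [← cancel_epi (U.iterδ k m i hm S.X₃), ← Category.assoc, ← Category.assoc,
    hN.iterδ_δ k m m' i j hm h hmm e, iterδ_liftComponent, Category.assoc, Category.assoc,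
    satelliteπ_satelliteδ, U.iterδ_succ k m m' j e hmm hm', Category.assoc, iterδ_liftComponent,
    ← (υ m).naturality_assoc]
  refine congrArg _ ?_
  rw [← Category.assoc, ← Category.assoc]
  exact congrArg (· ≫ _) (hυ (cosyzygySES S.X₁ k) (cosyzygySES_shortExact S.X₁ k) m m' hmm)

end Lift

variable [HasLimitsOfShape ℕᵒᵖ D]

/-- The projection from the limit to `S^k T m`, where `m = i + k`. -/
def proj (i : ℤ) (k : ℕ) (m : ℤ) (h : i + k = m) :
    T.completion.obj i ⟶ satellite (T.obj m) (T.additive m) k :=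
  T.completionπ i k ≫ eqToHom (by subst h; rfl)

lemma proj_self (i : ℤ) (k : ℕ) : T.proj i k (i + k) rfl = T.completionπ i k := by
  rw [proj, eqToHom_refl]
  exact Category.comp_id _

lemma proj_transition (i : ℤ) (k : ℕ) (m m' : ℤ) (h : i + (k + 1 : ℕ) = m) (h' : i + k = m')
    (hm : m' + 1 = m) : T.proj i (k + 1) m h ≫ T.transition k m m' hm = T.proj i k m' h' := by
  subst h h'
  rw [proj_self, proj_self]
  exact T.completionπ_transition i k

lemma δ_proj {S : ShortComplex C} (hS : S.ShortExact) (i j : ℤ) (h : j + 1 = i) (k : ℕ)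
    (m m' : ℤ) (hm : i + k = m) (hm' : j + k = m') (hmm : m' + 1 = m) :
    T.completion.δ S hS i j h ≫ (T.proj j k m' hm').app S.X₁ =
      (T.proj i k m hm).app S.X₃ ≫ T.satelliteδ k m m' hmm hS := by
  subst hm hm'
  rw [proj_self, proj_self]
  exact T.completionδ_π hS i j h k

/-- A connecting homomorphism raises the stage by one while the degree `m` of `T` stays fixed. This
makes the induction over stages in the uniqueness proof possible. -/
lemma δ_proj_succ {S : ShortComplex C} (hS : S.ShortExact) (i j : ℤ) (h : j + 1 = i) (k : ℕ)
    (m : ℤ) (hm : i + k = m) (hm' : j + (k + 1 : ℕ) = m) :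
    T.completion.δ S hS i j h ≫ (T.proj j (k + 1) m hm').app S.X₁ =
      (T.proj i k m hm).app S.X₃ ≫ T.satelliteShift k m hS := by
  rw [T.δ_proj hS i j h (k + 1) (m + 1) m (by push_cast; omega) hm' rfl, satelliteδ_succ,
    ← Category.assoc, ← NatTrans.comp_app, T.proj_transition i k (m + 1) m _ hm rfl]

variable {T} in
-- Limits of functors are computed objectwise. Leaving the degree `m` free avoids transports between
-- expressions such as `i + 1 + k` and `i + (k + 1)`.
lemma completion_hom_ext {X : D} {N : C} {i : ℤ} {f g : X ⟶ (T.completion.obj i).obj N}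
    (h : ∀ (k : ℕ) (m : ℤ) (hm : i + k = m),
      f ≫ (T.proj i k m hm).app N = g ≫ (T.proj i k m hm).app N) : f = g := by
  refine (isLimitOfPreserves ((evaluation C D).obj N) (limit.isLimit (T.system i))).hom_ext ?_
  rintro ⟨k⟩
  have := h k _ rfl
  rw [proj_self] at this
  exact this

lemma completionτ_app (i : ℤ) (N : C) :
    (T.completionτ i).app N =
      (T.proj i 0 i (by simp)).app N ≫ satelliteZero (T.obj i) (T.additive i) N := by
  -- The stage 0 satellite lives in degree `i + 0`. Replacing this degree by a variable `m` allows
  -- the substitution that turns both transports into identities.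
  have key : ∀ (m : ℤ) (h : m = i)
      (p : T.completion.obj i ⟶ satellite (T.obj m) (T.additive m) 0)
      (q : satellite (T.obj m) (T.additive m) 0 ⟶ T.obj m)
      (_ : ∀ N, q.app N = satelliteZero (T.obj m) (T.additive m) N),
      (p ≫ q ≫ eqToHom (congrArg T.obj h)).app N =
        (p ≫ eqToHom (by subst h; rfl)).app N ≫ satelliteZero (T.obj i) (T.additive i) N := by
    intro m h p q hq
    subst h
    simp [hq]
  exact key _ (by simp) (T.completionπ i 0) _ (fun _ => rfl)

/-- Each projection, also the one to stage 0, factors through a later stage, where the satellite of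
an injective object is zero. -/
lemma vanishesOnInjectives_completion : VanishesOnInjectives T.completion := by
  intro i E hE
  rw [IsZero.iff_id_eq_zero]
  refine completion_hom_ext fun k m hm => ?_
  rw [← T.proj_transition i k (m + 1) m (by push_cast; omega) hm rfl, NatTrans.comp_app,
    (isZero_satellite_of_injective (T.obj (m + 1)) (T.additive _) k E).eq_of_tgt
      ((T.proj i (k + 1) (m + 1) (by push_cast; omega)).app E) 0, zero_comp, comp_zero, comp_zero]

/-- At stage 0 the connecting homomorphism of the limit passes through `toCosyzygy` and the first
cosyzygy sequence, which is the formula of `Natural.δ_eq` for `T`. -/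
lemma connected_completionτ : FamilyHom.Connected T.completionτ := by
  intro S hS i j h
  rw [completionτ_app, completionτ_app, ← Category.assoc,
    T.δ_proj hS i j h 0 i j (by simp) (by simp) h, Category.assoc, Category.assoc]
  refine congrArg _ ?_
  rw [← cancel_epi (satelliteπ (T.obj i) (T.additive i) 0 S.X₃), ← Category.assoc,
    satelliteπ_satelliteδ, Category.assoc, Category.assoc, satelliteπ_satelliteZero,
    ← Category.assoc (satelliteπ _ _ _ _), satelliteπ_satelliteZero,
    ConnectedFamily.Natural.δ_eq (U := T.toConnectedFamily) T.natural,
    connCosyzygy_zero, Functor.map_comp, Category.assoc]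
  rfl

section Lift

variable {U : ConnectedFamily C D}

variable {T} in
/-- Morphisms to the completion are determined by their composites with the canonical morphism. -/
theorem completion_lift_unique (hU : U.ShiftsInjectives) {σ σ' : FamilyHom U T.completion}
    (hσ : σ.Connected) (hσ' : σ'.Connected)
    (h : ∀ i, σ i ≫ T.completionτ i = σ' i ≫ T.completionτ i) : σ = σ' := by
  suffices H : ∀ (k : ℕ) (i m : ℤ) (hm : i + k = m) (N : C),
      (σ i).app N ≫ (T.proj i k m hm).app N = (σ' i).app N ≫ (T.proj i k m hm).app N by
    funext i
    ext N : 2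
    exact completion_hom_ext fun k m hm => H k i m hm N
  intro k
  induction k with
  | zero =>
    intro i m hm N
    obtain rfl : i = m := by simpa using hm
    have := congrArg (fun f => NatTrans.app f N) (h i)
    rw [NatTrans.comp_app, NatTrans.comp_app, completionτ_app, ← Category.assoc,
      ← Category.assoc] at this
    exact (cancel_mono _).1 this
  | succ k ih =>
    intro i m hm N
    -- The induction is over all objects and degrees, so the case `k` may be used for the cokernel
    -- of an embedding of `N` in an injective object, in degree `i + 1`. The connecting homomorphism
    -- of `U` is invertible there and can be cancelled.
    let S := ShortComplex.mk (Injective.ι N) (cokernel.π (Injective.ι N)) (by simp)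
    have hS : S.ShortExact := { exact := ShortComplex.exact_cokernel _ }
    have := hU S hS (inferInstanceAs (Injective (Injective.under N))) (i + 1) i rfl
    rw [← cancel_epi (U.δ S hS (i + 1) i rfl)]
    have h₁ := hσ S hS (i + 1) i rfl
    have h₂ := hσ' S hS (i + 1) i rfl
    have hm' : i + 1 + (k : ℤ) = m := by push_cast at hm; omega
    refine (Category.assoc _ _ _).symm.trans (Eq.trans ?_ (Category.assoc _ _ _))
    refine (congrArg (· ≫ _) h₁).trans (Eq.trans ?_ (congrArg (· ≫ _) h₂).symm)
    rw [Category.assoc, Category.assoc, T.δ_proj_succ hS (i + 1) i rfl k m hm' hm, ← Category.assoc,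
      ih (i + 1) m hm', Category.assoc]

variable (hU : U.ShiftsInjectives) (hN : U.Natural) {υ : FamilyHom U T.toConnectedFamily}

/-- The morphism to the completion that is induced by a morphism `υ : U ⟶ T`. -/
def completionLift (hυ : υ.Connected) : FamilyHom U T.completion := fun i =>
  limit.lift (T.system i)
    { pt := U.obj i
      π := NatTrans.ofOpSequence
        (fun k => T.liftComponent hU hN υ k i (i + k) rfl)
        (fun k => by
          refine (Category.id_comp _).trans ?_
          refine (T.liftComponent_transition hU hN hυ k i _ _ rfl rfl
            (by push_cast; ring)).symm.trans (congrArg _ (T.system_map i k).symm)) }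

lemma completionLift_proj (hυ : υ.Connected) (i : ℤ) (k : ℕ) (m : ℤ) (h : i + k = m) :
    T.completionLift hU hN hυ i ≫ T.proj i k m h = T.liftComponent hU hN υ k i m h := by
  subst h
  rw [proj_self]
  exact limit.lift_π _ _

lemma completionLift_proj_app (hυ : υ.Connected) (i : ℤ) (k : ℕ) (m : ℤ) (h : i + k = m) (N : C) :
    (T.completionLift hU hN hυ i).app N ≫ (T.proj i k m h).app N =
      (T.liftComponent hU hN υ k i m h).app N :=
  congrArg (fun f => NatTrans.app f N) (T.completionLift_proj hU hN hυ i k m h)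

lemma completionLift_τ (hυ : υ.Connected) (i : ℤ) :
    T.completionLift hU hN hυ i ≫ T.completionτ i = υ i := by
  ext N : 2
  have := hU.isIso_iterδ 0 i i (by simp) N
  rw [NatTrans.comp_app, completionτ_app, ← Category.assoc, completionLift_proj_app,
    ← cancel_epi (U.iterδ 0 i i (by simp) N), ← Category.assoc, iterδ_liftComponent,
    U.iterδ_zero, Category.assoc, satelliteπ_satelliteZero, (υ i).naturality]

lemma connected_completionLift (hυ : υ.Connected) :
    FamilyHom.Connected (T.completionLift hU hN hυ) := by
  intro S hS i j h
  refine completion_hom_ext fun k m hm => ?_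
  rw [Category.assoc, Category.assoc, completionLift_proj_app,
    T.δ_proj hS i j h k (m + 1) m (by omega) hm rfl, ← Category.assoc, completionLift_proj_app,
    T.δ_liftComponent hU hN hυ hS k i j (m + 1) m h _ hm rfl]

end Lift

theorem isJCompletion_completion :
    IsJCompletion T.toConnectedFamily T.completion T.completionτ := by
  refine ⟨T.vanishesOnInjectives_completion, T.connected_completionτ, fun U hU υ hυ => ?_⟩
  have hU' := U.shiftsInjectives hU
  refine ⟨T.completionLift hU' U.natural hυ,
    ⟨T.connected_completionLift hU' U.natural hυ, T.completionLift_τ hU' U.natural hυ⟩,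
    fun σ hσ => completion_lift_unique hU' hσ.1 (T.connected_completionLift hU' U.natural hυ)
      fun i => ?_⟩
  rw [hσ.2, completionLift_τ]

/-- From stage `k` on all transition maps are isomorphisms, because only degrees at least `m` occur.
The inverse system is eventually constant, so its limit is the value at `k`. -/
lemma isIso_proj (i : ℤ) (k : ℕ) (m : ℤ) (h : i + k = m)
    (hT : ∀ j, m ≤ j → ∀ E : C, Injective E → IsZero ((T.obj j).obj E)) :
    IsIso (T.proj i k m h) := by
  subst h
  rw [proj_self]
  refine Functor.IsEventuallyConstantTo.isIso_π_of_isLimit (i₀ := Opposite.op k) ?_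
    (limit.isLimit (T.system i))
  rintro ⟨l⟩ f
  obtain ⟨l, rfl⟩ := Nat.exists_eq_add_of_le (leOfHom f.unop)
  induction l with
  | zero =>
    obtain rfl : f = 𝟙 _ := Subsingleton.elim _ _
    infer_instance
  -- A map from stage `k + l + 1` is a transition map followed by the map from stage `k + l`.
  | succ l ih =>
    obtain rfl : f = (homOfLE (Nat.le_add_right (k + l) 1)).op ≫
      (homOfLE (Nat.le_add_right k l)).op := Subsingleton.elim _ _
    rw [Functor.map_comp, system_map]
    have : IsIso ((T.system i).map (homOfLE (Nat.le_add_right k l)).op) := ih _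
    have := T.isIso_transition (k + l) (i + (k + l + 1 : ℕ)) (i + (k + l : ℕ))
      (by push_cast; ring)
      (hT _ (by push_cast; omega)) (hT _ (by push_cast; omega))
    exact IsIso.comp_isIso' this ‹_›

/-- A morphism to the completion is an isomorphism if it is induced by a morphism that is an
isomorphism in high degrees, and the functor vanishes on injective objects in high degrees. -/
lemma isIso_completionLift {U : ConnectedFamily C D} (hU : U.ShiftsInjectives) (hN : U.Natural)
    {υ : FamilyHom U T.toConnectedFamily} (hυ : υ.Connected) (n : ℤ)
    (hT : ∀ j, n ≤ j → ∀ E : C, Injective E → IsZero ((T.obj j).obj E))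
    (hn : ∀ j, n ≤ j → ∀ N : C, IsIso ((υ j).app N)) (i : ℤ) :
    IsIso (T.completionLift hU hN hυ i) := by
  -- Since the index `i` is arbitrary, the stage is chosen so late that `T (i + k)` lies in the
  -- range covered by both `hT` and `hn`.
  obtain ⟨k, hk⟩ : ∃ k : ℕ, n ≤ i + k := ⟨(n - i).toNat, by omega⟩
  have := T.isIso_proj i k (i + k) rfl (fun j hj => hT j (hk.trans hj))
  -- All three factors are invertible: dimension shifting in `U`, the map `υ` in degree `i + k`, and
  -- the projection to the satellite, as `T (i + k)` vanishes on the terms of the resolution.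
  have : IsIso (T.liftComponent hU hN υ k i (i + k) rfl) := by
    have (N : C) : IsIso ((T.liftComponent hU hN υ k i (i + k) rfl).app N) := by
      have := isIso_satelliteπ (T.obj (i + k)) (T.additive (i + k)) k N
        ((hT _ hk _ (injective_res N _)).eq_of_src _ _)
      have := hn _ hk ((res N).cycles k)
      have := hU.isIso_iterδ k (i + k) i rfl N
      dsimp only [liftComponent]
      infer_instance
    exact NatIso.isIso_of_isIso_app _
  exact IsIso.of_isIso_fac_right (T.completionLift_proj hU hN hυ i k (i + k) rfl)

end HomologicalFunctor

end Completion

/-! ### Maps of injective resolutions that represent short exact sequences -/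

section Resolutions

variable {C : Type u₁} [Category.{v₁} C] [Abelian C]

/-- An exact complex `0 ⟶ Z ⟶ K^0 ⟶ K^1 ⟶ ⋯` with injective terms `K^n` as an injective
resolution of `Z`. -/
def injectiveResolutionOfExact {Z : C} (K : CochainComplex C ℕ) (hK : ∀ n, Injective (K.X n))
    (f : Z ⟶ K.X 0) [Mono f] (w : f ≫ K.d 0 1 = 0) (h₀ : (ShortComplex.mk f (K.d 0 1) w).Exact)
    (h : ∀ n, K.ExactAt (n + 1)) : InjectiveResolution Z where
  cocomplex := K
  injective := hK
  ι := (CochainComplex.fromSingle₀Equiv K Z).symm ⟨f, w⟩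
  quasiIso := ⟨fun n => by
    cases n
    · rw [CochainComplex.quasiIsoAt₀_iff, ShortComplex.quasiIso_iff_of_zeros]
      · refine (ShortComplex.exact_and_mono_f_iff_of_iso ?_).2 ⟨h₀, by dsimp; infer_instance⟩
        exact ShortComplex.isoMk (Iso.refl _) (Iso.refl _) (Iso.refl _)
          ((Category.id_comp (X := Z) (Y := K.X 0) _).trans
            ((CochainComplex.fromSingle₀Equiv_symm_apply_f_zero f w).symm.trans
              (Category.comp_id (X := Z) (Y := K.X 0) _).symm))
          ((Category.id_comp (X := K.X 0) (Y := K.X 1) _).trans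
            (Category.comp_id (X := K.X 0) (Y := K.X 1) _).symm)
      · rfl
      · rfl
      · exact K.shape 0 0 (by simp)
    · rw [quasiIsoAt_iff_exactAt]
      · exact h _
      · apply CochainComplex.exactAt_succ_single_obj⟩

/-- Maps of injective resolutions are determined up to homotopy by their effect on the augmentation.
As the resolved object sits in degree 0, a single equation is enough. -/
lemma nonempty_homotopy_zero {Y Z : C} (I : InjectiveResolution Y) (J : InjectiveResolution Z)
    (f : I.cocomplex ⟶ J.cocomplex) (h : I.ι.f 0 ≫ f.f 0 = 0) : Nonempty (Homotopy f 0) :=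
  ⟨InjectiveResolution.descHomotopyZero f (by
    apply HomologicalComplex.from_single_hom_ext
    exact h.trans (HomologicalComplex.zero_f _ _ _).symm)⟩

variable [EnoughInjectives C]

/-- The chain map from `J` to the truncated complex `I^1 ⟶ I^2 ⟶ ⋯` with components `ψ^k`. -/
@[simps]
def toTruncation {I J : CochainComplex C ℕ} (ψ : ∀ b, I.X b ⟶ J.X (b + 1))
    (hψ : ∀ b c, ψ b ≫ J.d (b + 1) (c + 1) = I.d b c ≫ ψ c) :
    I ⟶ CochainComplex.truncate.obj J where
  f := ψ
  comm' i j _ := hψ i j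

/-- The map `toCosyzygy` depends on the chosen extension `N ⟶ I^0`. Two extensions that agree on
`N'` differ by a map `h` on `N''`, and this changes `toCosyzygy` by a map that factors through
`I^0`. -/
lemma toCosyzygy_naturality {S S' : ShortComplex C} (φ : S ⟶ S') (hS : S.ShortExact)
    (hS' : S'.ShortExact) : ∃ h : S.X₃ ⟶ (res S'.X₁).X 0,
      toCosyzygy hS ≫ HomologicalComplex.cyclesMap (resMap φ.τ₁) 1 =
        φ.τ₃ ≫ toCosyzygy hS' + h ≫ (res S'.X₁).toCycles 0 1 := by
  have w : S.f ≫ (extendAug hS ≫ (resMap φ.τ₁).f 0 - φ.τ₂ ≫ extendAug hS') = 0 := by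
    rw [Preadditive.comp_sub, f_extendAug_assoc, aug_naturality, ← φ.comm₁₂_assoc, f_extendAug,
      sub_self]
  refine ⟨hS.gIsCokernel.desc (CokernelCofork.ofπ _ w), ?_⟩
  have := hS.epi_g
  rw [← cancel_epi S.g, Preadditive.comp_add, ← Category.assoc, g_toCosyzygy, ← Category.assoc S.g,
    ← φ.comm₂₃, Category.assoc, Category.assoc, g_toCosyzygy]
  have e : S.g ≫ hS.gIsCokernel.desc (CokernelCofork.ofπ _ w) =
      extendAug hS ≫ (resMap φ.τ₁).f 0 - φ.τ₂ ≫ extendAug hS' :=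
    Cofork.IsColimit.π_desc hS.gIsCokernel
  rw [reassoc_of% e, Preadditive.sub_comp, Category.assoc, Category.assoc, add_sub_cancel]
  refine congrArg _ ?_
  rw [← cancel_mono ((res S'.X₁).iCycles 1)]
  simp

/-- The chain map from `J` to the truncated complex `I^1 ⟶ I^2 ⟶ ⋯` with component `g ≫ d` in
degree `0` and zero components in all other degrees. -/
def bottomMap {I J : CochainComplex C ℕ} (g : J.X 0 ⟶ I.X 0) :
    J ⟶ CochainComplex.truncate.obj I where
  f
    | 0 => g ≫ I.d 0 1
    | _ + 1 => 0
  comm' i j h := by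
    obtain rfl : i + 1 = j := h
    rcases i with _ | i
    · exact (Category.assoc _ _ _).trans ((congrArg (g ≫ ·) (I.d_comp_d 0 1 2)).trans
        (comp_zero.trans comp_zero.symm))
    · exact zero_comp.trans comp_zero.symm

/-- Up to homotopy and up to the component in degree `0`, the maps `ψ` that represent short exact
sequences are natural. -/
lemma connLift_naturality {S S' : ShortComplex C} (φ : S ⟶ S') (hS : S.ShortExact)
    (hS' : S'.ShortExact) : ∃ ρ : res S.X₃ ⟶ CochainComplex.truncate.obj (res S'.X₁),
      Nonempty (Homotopy (toTruncation (connLift hS) (connLift_d hS) ≫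
        CochainComplex.truncate.map (resMap φ.τ₁)) ρ) ∧
      ∀ b, 1 ≤ b → ρ.f b = (resMap φ.τ₃).f b ≫ connLift hS' b := by
  obtain ⟨h, hh⟩ := toCosyzygy_naturality φ hS hS'
  have := injective_res S'.X₁ 0
  -- The error `h` is extended along the augmentation to `J^0`, so that the resulting correction of
  -- the chain map is concentrated in degree 0.
  let g : (res S.X₃).X 0 ⟶ (res S'.X₁).X 0 := Injective.factorThru h (aug S.X₃)
  have hg : aug S.X₃ ≫ g = h := Injective.comp_factorThru _ _
  refine ⟨resMap φ.τ₃ ≫ toTruncation (connLift hS') (connLift_d hS') + bottomMap g, ?_, ?_⟩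
  · obtain ⟨s⟩ := nonempty_homotopy_zero (injectiveResolution S.X₃)
      (truncRes (injectiveResolution S'.X₁))
      (toTruncation (connLift hS) (connLift_d hS) ≫ CochainComplex.truncate.map (resMap φ.τ₁) -
        (resMap φ.τ₃ ≫ toTruncation (connLift hS') (connLift_d hS') + bottomMap g)) (by
        -- On the augmentation the difference vanishes precisely by the identity `hh` for the maps
        -- to the first cosyzygy.
        change aug S.X₃ ≫ (connLift hS 0 ≫ (resMap φ.τ₁).f 1 -
          ((resMap φ.τ₃).f 0 ≫ connLift hS' 0 + g ≫ (res S'.X₁).d 0 1)) = 0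
        rw [Preadditive.comp_sub, Preadditive.comp_add, ← Category.assoc, aug_connLift,
          ← Category.assoc (aug S.X₃), aug_naturality, ← Category.assoc (aug S.X₃) g, hg,
          Category.assoc, Category.assoc, aug_connLift, sub_eq_zero]
        have := congrArg (· ≫ (res S'.X₁).iCycles 1) hh
        simpa using this)
    exact ⟨Homotopy.equivSubZero.symm s⟩
  · rintro (_ | b) hb
    · omega
    · exact add_zero _

lemma splice_w {S : ShortComplex C} : (S.g ≫ aug S.X₃) ≫ (res S.X₃).d 0 1 = 0 := by
  rw [Category.assoc, aug_d, comp_zero]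

/-- For a short exact sequence `0 ⟶ N' ⟶ N ⟶ N'' ⟶ 0` and an injective resolution `J` of `N''`,
the complex `N ⟶ J^0 ⟶ J^1 ⟶ ⋯`. -/
abbrev splice (S : ShortComplex C) : CochainComplex C ℕ :=
  CochainComplex.augment (res S.X₃) (S.g ≫ aug S.X₃) splice_w

lemma splice_w' (S : ShortComplex C) : S.f ≫ S.g ≫ aug S.X₃ = 0 := by
  rw [← Category.assoc, S.zero, zero_comp]

/-- If `N` is injective, then `N ⟶ J^0 ⟶ J^1 ⟶ ⋯` is an injective resolution of `N'`. -/
def spliceRes {S : ShortComplex C} (hS : S.ShortExact) (hE : Injective S.X₂) :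
    InjectiveResolution S.X₁ :=
  haveI : Mono (X := S.X₁) (Y := (splice S).X 0) S.f := hS.mono_f
  injectiveResolutionOfExact (Z := S.X₁) (splice S)
    (fun n => by
      rcases n with _ | n
      · exact hE
      · exact injective_res S.X₃ n)
    S.f (splice_w' S) (by
      -- Composing with the monomorphism `N'' ⟶ J^0` does not change the kernel of `N ⟶ N''`.
      let φ : S ⟶ ShortComplex.mk S.f (S.g ≫ aug S.X₃) (splice_w' S) :=
        { τ₁ := 𝟙 _, τ₂ := 𝟙 _, τ₃ := aug S.X₃ }
      have : Epi φ.τ₁ := inferInstanceAs (Epi (𝟙 _))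
      have : IsIso φ.τ₂ := inferInstanceAs (IsIso (𝟙 _))
      have : Mono φ.τ₃ := inferInstanceAs (Mono (aug S.X₃))
      exact (ShortComplex.exact_iff_of_epi_of_isIso_of_mono φ).1 hS.exact)
    (fun n => by
      rcases n with _ | n
      · rw [HomologicalComplex.exactAt_iff' _ 0 1 2 (by simp) (by simp)]
        have := hS.epi_g
        -- As `N ⟶ N''` is an epimorphism, the maps `N ⟶ J^0` and `N'' ⟶ J^0` have the same image.
        let φ : ShortComplex.mk (S.g ≫ aug S.X₃) ((res S.X₃).d 0 1) splice_w ⟶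
            ShortComplex.mk (aug S.X₃) ((res S.X₃).d 0 1) (by simp) :=
          { τ₁ := S.g, τ₂ := 𝟙 _, τ₃ := 𝟙 _ }
        have : Epi φ.τ₁ := this
        have : IsIso φ.τ₂ := inferInstanceAs (IsIso (𝟙 _))
        have : Mono φ.τ₃ := inferInstanceAs (Mono (𝟙 _))
        exact (ShortComplex.exact_iff_of_epi_of_isIso_of_mono φ).2
          (injectiveResolution S.X₃).exact₀
      · rw [HomologicalComplex.exactAt_iff' _ (n + 1) (n + 2) (n + 3) (by simp) (by simp)]
        exact (injectiveResolution S.X₃).exact_succ n)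

/-- The chain map from `N ⟶ J^0 ⟶ J^1 ⟶ ⋯` to the injective resolution of `N'`. -/
def spliceMap {S : ShortComplex C} (hS : S.ShortExact) : splice S ⟶ res S.X₁ where
  f
    | 0 => extendAug hS
    | b + 1 => connLift hS b
  comm' i j h := by
    obtain rfl : i + 1 = j := h
    rcases i with _ | i
    · dsimp
      rw [Category.assoc, aug_connLift, ← Category.assoc, g_toCosyzygy, Category.assoc,
        HomologicalComplex.toCycles_i]
    · exact connLift_d hS i (i + 1)

/-- Both complexes are injective resolutions of `N'`. The map `spliceMap` lifts the identity of `N'`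
because `extendAug` extends the augmentation, so it is homotopic to the standard comparison of
resolutions. -/
lemma exists_homotopyEquiv_splice {S : ShortComplex C} (hS : S.ShortExact)
    (hE : Injective S.X₂) : ∃ e : HomotopyEquiv (splice S) (res S.X₁),
      Nonempty (Homotopy (spliceMap hS) e.hom) := by
  let e : HomotopyEquiv (splice S) (res S.X₁) :=
    InjectiveResolution.homotopyEquiv (spliceRes hS hE) (injectiveResolution S.X₁)
  have he : (spliceRes hS hE).ι ≫ e.hom = (injectiveResolution S.X₁).ι :=
    InjectiveResolution.homotopyEquiv_hom_ι _ _
  have hι : (spliceRes hS hE).ι.f 0 = S.f :=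
    CochainComplex.fromSingle₀Equiv_symm_apply_f_zero (C := splice S) S.f (splice_w' S)
  refine ⟨e, ?_⟩
  obtain ⟨s⟩ := nonempty_homotopy_zero (spliceRes hS hE) (injectiveResolution S.X₁)
    (spliceMap hS - e.hom) (by
      have h₁ : (spliceRes hS hE).ι.f 0 ≫ e.hom.f 0 = aug S.X₁ :=
        congrArg (fun f => HomologicalComplex.Hom.f f 0) he
      have h₂ : (spliceRes hS hE).ι.f 0 ≫ (spliceMap hS).f 0 = aug S.X₁ :=
        (congrArg (· ≫ extendAug hS) hι).trans (f_extendAug hS)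
      refine (Preadditive.comp_sub _ _ _).trans ?_
      exact sub_eq_zero.2 (h₂.trans h₁.symm))
  exact ⟨Homotopy.equivSubZero.symm s⟩

end Resolutions

/-! ### Naturality and dimension shifting in stable homology -/

section Stable

open scoped TensorProduct

attribute [local instance 50] moduleOverBase

attribute [local instance] isScalarTower_base

variable (k : Type w) [CommRing k] {R : Type u} [Ring R] [Algebra k R]

section DegreeNegOne

variable {K L L' : ChainComplex (ModuleCat.{u} k) ℤ}
    (s : ∀ i j : ℤ, j + 1 = i → (K.X i ⟶ L.X j))
    (hs : ∀ (i i' j j' : ℤ) (h : j + 1 = i) (h' : j' + 1 = i') (_ : i' + 1 = i),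
      s i j h ≫ L.d j j' = K.d i i' ≫ s i' j' h')

lemma homologyMapDegreeNegOne_comp (f : L ⟶ L')
    (s' : ∀ i j : ℤ, j + 1 = i → (K.X i ⟶ L'.X j)) (hs')
    (e : ∀ i j h, s i j h ≫ f.f j = s' i j h) (i j : ℤ) (h : j + 1 = i) :
    homologyMapDegreeNegOne k s hs i j h ≫ HomologicalComplex.homologyMap f j =
      homologyMapDegreeNegOne k s' hs' i j h := by
  refine (ShortComplex.homologyMap_comp _ _).symm.trans ?_
  rw [homologyMapDegreeNegOne]
  congr 1
  ext1
  · exact e _ _ _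
  · exact e _ _ _
  · exact e _ _ _

lemma comp_homologyMapDegreeNegOne (f : L' ⟶ K)
    (s' : ∀ i j : ℤ, j + 1 = i → (L'.X i ⟶ L.X j)) (hs')
    (e : ∀ i j h, f.f i ≫ s i j h = s' i j h) (i j : ℤ) (h : j + 1 = i) :
    HomologicalComplex.homologyMap f i ≫ homologyMapDegreeNegOne k s hs i j h =
      homologyMapDegreeNegOne k s' hs' i j h := by
  refine (ShortComplex.homologyMap_comp _ _).symm.trans ?_
  rw [homologyMapDegreeNegOne]
  congr 1
  ext1
  · exact e _ _ _
  · exact e _ _ _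
  · exact e _ _ _

lemma isIso_homologyMapDegreeNegOne (e : ∀ i j h, IsIso (s i j h)) (i j : ℤ) (h : j + 1 = i) :
    IsIso (homologyMapDegreeNegOne k s hs i j h) := by
  let φ : K.sc i ⟶ L.sc j :=
    { τ₁ := s _ _ (by simp; omega)
      τ₂ := s i j h
      τ₃ := s _ _ (by simp; omega)
      comm₁₂ := hs _ _ _ _ _ _ (by simp)
      comm₂₃ := hs _ _ _ _ _ _ (by simp) }
  have : IsIso φ.τ₁ := e _ _ _
  have : IsIso φ.τ₂ := e _ _ _
  have : IsIso φ.τ₃ := e _ _ _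
  have : IsIso φ := ShortComplex.isIso_of_isIso φ
  exact inferInstanceAs (IsIso (ShortComplex.homologyMap φ))

end DegreeNegOne

variable (P : ChainComplex (ModuleCat.{u} Rᵐᵒᵖ) ℤ) {I J L : CochainComplex (ModuleCat.{u} R) ℕ}

/-- The map of quotient complexes is determined by the components in high degrees. -/
lemma stableComplexMap_congr (φ φ' : I ⟶ J) (B : ℕ) (h : ∀ b, B ≤ b → φ.f b = φ'.f b) :
    stableComplexMap k P φ = stableComplexMap k P φ' := by
  ext n : 1
  refine ModuleCat.hom_ext (Submodule.linearMap_qext _ (LinearMap.ext fun z => ?_))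
  refine (Submodule.Quotient.eq _).2 ⟨B, fun p hp => ?_⟩
  rw [Pi.sub_apply, prodMap_apply, prodMap_apply, h _ hp, sub_self]

lemma homologyMap_stableComplexMap_comp (φ : I ⟶ J) (ψ : J ⟶ L) (n : ℤ) :
    HomologicalComplex.homologyMap (stableComplexMap k P (φ ≫ ψ)) n =
      HomologicalComplex.homologyMap (stableComplexMap k P φ) n ≫
        HomologicalComplex.homologyMap (stableComplexMap k P ψ) n :=
  ((stableTensor k P) ⋙ HomologicalComplex.homologyFunctor _ _ n).map_comp φ ψ

lemma homologyMap_stableComplexMap_id (n : ℤ) :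
    HomologicalComplex.homologyMap (stableComplexMap k P (𝟙 I)) n = 𝟙 _ :=
  ((stableTensor k P) ⋙ HomologicalComplex.homologyFunctor _ _ n).map_id I

lemma isIso_homologyMap_stableComplexMap (e : HomotopyEquiv I J) (n : ℤ) :
    IsIso (HomologicalComplex.homologyMap (stableComplexMap k P e.hom) n) := by
  refine ⟨HomologicalComplex.homologyMap (stableComplexMap k P e.inv) n, ?_, ?_⟩
  · rw [← homologyMap_stableComplexMap_comp, ← homologyMap_stableComplexMap_id]
    exact (stableHomotopy k P e.homotopyHomInvId).homologyMap_eq n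
  · rw [← homologyMap_stableComplexMap_comp, ← homologyMap_stableComplexMap_id]
    exact (stableHomotopy k P e.homotopyInvHomId).homologyMap_eq n

section Conn

variable (ψ : ∀ b, I.X b ⟶ J.X (b + 1))
    (hψ : ∀ b c, ψ b ≫ J.d (b + 1) (c + 1) = I.d b c ≫ ψ c)

lemma stableConn_comp (φ : J ⟶ L) (ψ' : ∀ b, I.X b ⟶ L.X (b + 1)) (hψ')
    (e : ∀ b, ψ b ≫ φ.f (b + 1) = ψ' b) (i j : ℤ) (h : j + 1 = i) :
    stableConn k P ψ hψ i j h ≫ HomologicalComplex.homologyMap (stableComplexMap k P φ) j =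
      stableConn k P ψ' hψ' i j h := by
  obtain rfl : (fun b => ψ b ≫ φ.f (b + 1)) = ψ' := funext e
  refine homologyMapDegreeNegOne_comp k _ _ _ _ _ (fun i j h => ?_) i j h
  refine ModuleCat.hom_ext (Submodule.linearMap_qext _ (LinearMap.ext fun z => ?_))
  refine congrArg (Submodule.mkQ _) (a₁ := prodMap k P φ j (prodConn k P ψ i j h z)) ?_
  funext ⟨⟨a, b⟩, hp⟩
  rcases b with _ | b
  · rw [prodMap_apply, prodConn_zero, prodConn_zero, map_zero]
  · rw [prodMap_apply, prodConn_succ _ _ _ _ _ _ _ _ _ _ (by simp at hp ⊢; omega),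
      prodConn_succ _ _ _ _ _ _ _ _ _ _ (by simp at hp ⊢; omega), Tensor.map_map, Category.comp_id]

lemma comp_stableConn (φ : L ⟶ I) (ψ' : ∀ b, L.X b ⟶ J.X (b + 1)) (hψ')
    (e : ∀ b, φ.f b ≫ ψ b = ψ' b) (i j : ℤ) (h : j + 1 = i) :
    HomologicalComplex.homologyMap (stableComplexMap k P φ) i ≫ stableConn k P ψ hψ i j h =
      stableConn k P ψ' hψ' i j h := by
  obtain rfl : (fun b => φ.f b ≫ ψ b) = ψ' := funext e
  refine comp_homologyMapDegreeNegOne k _ _ _ _ _ (fun i j h => ?_) i j h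
  refine ModuleCat.hom_ext (Submodule.linearMap_qext _ (LinearMap.ext fun z => ?_))
  refine congrArg (Submodule.mkQ _) (a₁ := prodConn k P ψ i j h (prodMap k P φ i z)) ?_
  funext ⟨⟨a, b⟩, hp⟩
  rcases b with _ | b
  · rw [prodConn_zero, prodConn_zero]
  · rw [prodConn_succ _ _ _ _ _ _ _ _ _ _ (by simp at hp ⊢; omega),
      prodConn_succ _ _ _ _ _ _ _ _ _ _ (by simp at hp ⊢; omega), prodMap_apply, Tensor.map_map,
      Category.comp_id]

/-- The only position outside the image of the index shift has `b = 0`. A single component has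
finite support, so the shift is bijective on the quotient. -/
lemma isIso_stableConn (e : ∀ b, IsIso (ψ b)) (i j : ℤ) (h : j + 1 = i) :
    IsIso (stableConn k P ψ hψ i j h) := by
  refine isIso_homologyMapDegreeNegOne k _ _ (fun i j h => ?_) i j h
  rw [ConcreteCategory.isIso_iff_bijective]
  constructor
  · refine (injective_iff_map_eq_zero (Submodule.mapQ _ _ (prodConn k P ψ i j h)
      (prodConn_mem k P ψ i j h))).2 fun x hx => ?_
    obtain ⟨z, rfl⟩ := Submodule.Quotient.mk_surjective _ x
    obtain ⟨B, hB⟩ := (Submodule.Quotient.mk_eq_zero _).1 hx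
    refine (Submodule.Quotient.mk_eq_zero _).2 ⟨B, ?_⟩
    rintro ⟨⟨a, b⟩, hp⟩ hb
    have h1 := hB ⟨(a, b + 1), by simp at hp ⊢; omega⟩ (by simp at hb ⊢; omega)
    rw [prodConn_succ _ _ _ _ _ _ _ _ _ _ hp] at h1
    have h2 := congrArg (Tensor.map k (𝟙 _) (inv (ψ b))) h1
    rw [Tensor.map_map] at h2
    simpa [Tensor.map_id] using h2
  · intro y
    obtain ⟨z, rfl⟩ := Submodule.Quotient.mk_surjective _ y
    let x : ProdTerm k P I i := fun p => Tensor.map k (𝟙 _) (inv (ψ p.1.2))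
      (z ⟨(p.1.1, p.1.2 + 1), by have := p.2; push_cast; omega⟩)
    refine ⟨Submodule.Quotient.mk x, ?_⟩
    -- The bound `1` discards the component at `b = 0`, where the image of `x` is zero and `z` is
    -- arbitrary.
    refine (Submodule.Quotient.eq _).2 ⟨1, ?_⟩
    rintro ⟨⟨a, b⟩, hp⟩ hb
    simp only at hb
    obtain ⟨b, rfl⟩ : ∃ c, b = c + 1 := ⟨b - 1, by omega⟩
    rw [Pi.sub_apply, prodConn_succ _ _ _ _ _ _ _ _ _ _ (by simp at hp ⊢; omega), sub_eq_zero]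
    dsimp only [x]
    rw [Tensor.map_map]
    simp [Tensor.map_id]

end Conn

/-- The map of stable homology induced by maps `ψ^b : I^b ⟶ J^(b+1)` depends only on the homotopy
class of the chain map from `I` to the truncation of `J` and on its components in high degrees. -/
lemma stableConn_eq_of_homotopy (ψ ψ' : ∀ b, I.X b ⟶ J.X (b + 1))
    (hψ : ∀ b c, ψ b ≫ J.d (b + 1) (c + 1) = I.d b c ≫ ψ c)
    (hψ' : ∀ b c, ψ' b ≫ J.d (b + 1) (c + 1) = I.d b c ≫ ψ' c)
    (ρ : I ⟶ CochainComplex.truncate.obj J) (s : Homotopy (toTruncation ψ hψ) ρ) (B : ℕ)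
    (hρ : ∀ b, B ≤ b → ρ.f b = ψ' b) (i j : ℤ) (h : j + 1 = i) :
    stableConn k P ψ hψ i j h = stableConn k P ψ' hψ' i j h := by
  have hid : ∀ b c, 𝟙 (J.X (b + 1)) ≫ J.d (b + 1) (c + 1) =
      (CochainComplex.truncate.obj J).d b c ≫ 𝟙 (J.X (c + 1)) := fun b c =>
    (Category.id_comp _).trans (Category.comp_id (J.d (b + 1) (c + 1))).symm
  -- Both maps factor as a chain map to the truncation followed by the same index shift with
  -- identity components. This leaves a comparison of ordinary chain maps, where homotopy invariance
  -- and the independence of low degrees apply.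
  rw [← comp_stableConn k P (I := CochainComplex.truncate.obj J) (fun b => 𝟙 (J.X (b + 1))) hid
      (toTruncation ψ hψ) ψ hψ (fun b => Category.comp_id _),
    ← comp_stableConn k P (I := CochainComplex.truncate.obj J) (fun b => 𝟙 (J.X (b + 1))) hid
      (toTruncation ψ' hψ') ψ' hψ' (fun b => Category.comp_id _),
    (stableHomotopy k P s).homologyMap_eq i,
    stableComplexMap_congr k P ρ (toTruncation ψ' hψ') B hρ]

lemma isIso_units_smul {A B : ModuleCat.{u} k} (f : A ⟶ B) [IsIso f] (a : ℤˣ) :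
    IsIso (a • f) :=
  ⟨a • inv f, by simp [smul_smul], by simp [smul_smul]⟩

variable (M : ModuleCat.{u} Rᵐᵒᵖ)

/-- The two composites around the square come from families `ψ` that agree up to homotopy and a
correction in degree 0, which the quotient by finite support does not see. The sign depends only on
`i` and is common to both sides. -/
lemma natural_stor : (stor (k := k) M).Natural := by
  intro S S' φ hS hS' i j h
  obtain ⟨ρ, ⟨s⟩, hρ⟩ := connLift_naturality φ hS hS'
  have e₁ : ∀ b c, (connLift hS b ≫ (resMap φ.τ₁).f (b + 1)) ≫ (res S'.X₁).d (b + 1) (c + 1) =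
      (res S.X₃).d b c ≫ connLift hS c ≫ (resMap φ.τ₁).f (c + 1) := fun b c => by
    rw [Category.assoc, HomologicalComplex.Hom.comm, ← Category.assoc, connLift_d, Category.assoc]
  have e₂ : ∀ b c, ((resMap φ.τ₃).f b ≫ connLift hS' b) ≫ (res S'.X₁).d (b + 1) (c + 1) =
      (res S.X₃).d b c ≫ (resMap φ.τ₃).f c ≫ connLift hS' c := fun b c => by
    rw [Category.assoc, connLift_d, ← Category.assoc, HomologicalComplex.Hom.comm, Category.assoc]
  have key := stableConn_eq_of_homotopy k (resolutionComplex M) _ _ e₁ e₂ ρ s 1 hρ (i + 1) (j + 1)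
    (by omega)
  rw [← stableConn_comp k (resolutionComplex M) (connLift hS) (connLift_d hS) (resMap φ.τ₁) _ e₁
      (fun _ => rfl),
    ← comp_stableConn k (resolutionComplex M) (connLift hS') (connLift_d hS') (resMap φ.τ₃) _ e₂
      (fun _ => rfl)] at key
  refine (Linear.units_smul_comp _ _ _).trans (Eq.trans ?_ (Linear.comp_units_smul _ _ _).symm)
  exact congrArg ((i + 1).negOnePow • ·) key

/-- The map `ψ` is the shift from `J` to the spliced complex followed by `spliceMap`. The shift is
invertible in stable homology, and `spliceMap` is homotopic to a homotopy equivalence. -/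
lemma shiftsInjectives_stor : (stor (k := k) M).ShiftsInjectives := by
  intro S hS hE i j h
  obtain ⟨e, ⟨s⟩⟩ := exists_homotopyEquiv_splice hS hE
  have : IsIso (stableConn k (resolutionComplex M) (connLift hS) (connLift_d hS) (i + 1) (j + 1)
      (by omega)) := by
    -- In positive degrees the spliced complex is `J` shifted by one, so identity maps serve as the
    -- family `ψ`.
    have hid : ∀ b c, 𝟙 ((res S.X₃).X b) ≫ (splice S).d (b + 1) (c + 1) =
      (res S.X₃).d b c ≫ 𝟙 ((res S.X₃).X c) := fun b c => by
        exact (Category.id_comp _).trans (Category.comp_id ((res S.X₃).d b c)).symm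
    rw [← stableConn_comp k (resolutionComplex M) (J := splice S) (fun b => 𝟙 ((res S.X₃).X b)) hid
      (spliceMap hS) _ _ (fun b => Category.id_comp (connLift hS b)),
      (stableHomotopy k (resolutionComplex M) s).homologyMap_eq]
    have := isIso_homologyMap_stableComplexMap k (resolutionComplex M) e (j + 1)
    have := isIso_stableConn k (resolutionComplex M) (J := splice S)
      (fun b => 𝟙 ((res S.X₃).X b)) hid (fun b => inferInstanceAs (IsIso (𝟙 _))) (i + 1) (j + 1)
      (by omega)
    infer_instance
  exact isIso_units_smul k (stableConn k (resolutionComplex M) (connLift hS) (connLift_d hS)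
    (i + 1) (j + 1) _) (i + 1).negOnePow

end Stable

/-! ### Homology classes and their representatives -/

section Classes

variable {k : Type w} [CommRing k]

/-- The homology class `ξ` is represented by the cycle `x`. -/
def Represents (K : ChainComplex (ModuleCat.{u} k) ℤ) (i : ℤ) (x : K.X i) (ξ : K.homology i) :
    Prop :=
  ∃ c : K.cycles i, K.iCycles i c = x ∧ K.homologyπ i c = ξ

namespace Represents

variable {K L : ChainComplex (ModuleCat.{u} k) ℤ} {i : ℤ}

lemma exists_representative (ξ : K.homology i) : ∃ x, Represents K i x ξ := by
  obtain ⟨c, rfl⟩ := (ModuleCat.epi_iff_surjective (K.homologyπ i)).1 inferInstance ξ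
  exact ⟨_, c, rfl, rfl⟩

lemma d_eq_zero {x : K.X i} {ξ : K.homology i} (h : Represents K i x ξ) (j : ℤ) :
    K.d i j x = 0 := by
  obtain ⟨c, rfl, rfl⟩ := h
  exact congrArg (fun f => ModuleCat.Hom.hom f c) (K.iCycles_d i j)

lemma of_cycle {x : K.X i} (j : ℤ) (hj : j + 1 = i) (h : K.d i j x = 0) :
    ∃ ξ, Represents K i x ξ := by
  have e := ShortComplex.exact_of_f_is_kernel (.mk (K.iCycles i) (K.d i j) (by simp))
    (K.cyclesIsKernel i j (by simp; omega))
  obtain ⟨c, hc⟩ := ((ShortComplex.ShortExact.moduleCat_exact_iff_function_exact _).1 e x).1 h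
  exact ⟨_, c, hc, rfl⟩

lemma map {x : K.X i} {ξ : K.homology i} (h : Represents K i x ξ) (f : K ⟶ L) :
    Represents L i (f.f i x) (HomologicalComplex.homologyMap f i ξ) := by
  obtain ⟨c, rfl, rfl⟩ := h
  refine ⟨HomologicalComplex.cyclesMap f i c, ?_, ?_⟩
  · exact congrArg (fun f => ModuleCat.Hom.hom f c) (HomologicalComplex.cyclesMap_i f i)
  · exact congrArg (fun f => ModuleCat.Hom.hom f c)
      (HomologicalComplex.homologyπ_naturality f i).symm

lemma smul {x : K.X i} {ξ : K.homology i} (h : Represents K i x ξ) (a : ℤˣ) :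
    Represents K i (a • x) (a • ξ) := by
  obtain ⟨c, rfl, rfl⟩ := h
  refine ⟨a • c, ?_, ?_⟩ <;>
    rcases Int.units_eq_one_or a with rfl | rfl <;> simp

lemma eq_of_boundary {x y : K.X i} {ξ η : K.homology i} (hx : Represents K i x ξ)
    (hy : Represents K i y η) (j : ℤ) (w : K.X j) (hw : x = y + K.d j i w) : ξ = η := by
  obtain ⟨c, rfl, rfl⟩ := hx
  obtain ⟨c', rfl, rfl⟩ := hy
  have e : c = c' + K.toCycles j i w := by
    apply (ModuleCat.mono_iff_injective (K.iCycles i)).1 inferInstance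
    rw [hw, map_add]
    exact congrArg (_ + ·) (congrArg (fun f => ModuleCat.Hom.hom f w) (K.toCycles_i j i)).symm
  rw [e, map_add]
  refine (congrArg (_ + ·) (congrArg (fun f => ModuleCat.Hom.hom f w)
    (K.toCycles_comp_homologyπ j i))).trans (add_zero _)

lemma exists_boundary {x y : K.X i} {ξ : K.homology i} (hx : Represents K i x ξ)
    (hy : Represents K i y ξ) (j : ℤ) (hj : i + 1 = j) : ∃ w : K.X j, x = y + K.d j i w := by
  obtain ⟨c, rfl, rfl⟩ := hx
  obtain ⟨c', rfl, h⟩ := hy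
  have e := ShortComplex.exact_of_g_is_cokernel
    (.mk (K.toCycles j i) (K.homologyπ i) (by simp)) (K.homologyIsCokernel j i (by simp; omega))
  obtain ⟨w, hw⟩ := ((ShortComplex.ShortExact.moduleCat_exact_iff_function_exact _).1 e (c - c')).1
    (by rw [map_sub]; exact sub_eq_zero.2 h.symm)
  refine ⟨w, ?_⟩
  have := congrArg (K.iCycles i) hw
  rw [map_sub] at this
  rw [← sub_eq_iff_eq_add', ← this]
  exact congrArg (fun f => ModuleCat.Hom.hom f w) (K.toCycles_i j i)

/-- This is the snake construction on elements: lift to the middle complex, take the boundary, pull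
back. The abstract connecting homomorphism is described by cycles and opcycles, and the inclusions
of cycles translate between the two. -/
lemma δ {S : ShortComplex (ChainComplex (ModuleCat.{u} k) ℤ)} (hS : S.ShortExact) {j : ℤ}
    (h : (ComplexShape.down ℤ).Rel i j) {x₃ : S.X₃.X i} {ξ : S.X₃.homology i}
    (hx : Represents S.X₃ i x₃ ξ) (x₂ : S.X₂.X i) (h₂ : S.g.f i x₂ = x₃) (x₁ : S.X₁.X j)
    (h₁ : S.f.f j x₁ = S.X₂.d i j x₂) : Represents S.X₁ j x₁ (hS.δ i j h ξ) := by
  obtain ⟨c, rfl, rfl⟩ := hx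
  have hd : S.X₁.d j (j - 1) x₁ = 0 := by
    have := hS.mono_f
    apply (ModuleCat.mono_iff_injective (S.f.f (j - 1))).1 inferInstance
    rw [map_zero]
    refine (congrArg (fun f => ModuleCat.Hom.hom f x₁) (S.f.comm j (j - 1)).symm).trans ?_
    refine (congrArg (S.X₂.d j (j - 1)) h₁).trans ?_
    exact congrArg (fun f => ModuleCat.Hom.hom f x₂) (S.X₂.d_comp_d i j (j - 1))
  obtain ⟨_, c', rfl, rfl⟩ := of_cycle (K := S.X₁) (j - 1) (by simp) hd
  refine ⟨c', rfl, ?_⟩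
  symm
  refine hS.δ_apply' i j h (S.X₃.homologyπ i c) (S.X₂.pOpcycles i x₂) c' ?_ ?_
  · refine (congrArg (fun f => ModuleCat.Hom.hom f x₂)
      (HomologicalComplex.p_opcyclesMap S.g i)).trans ?_
    refine (congrArg (S.X₃.pOpcycles i) h₂).trans ?_
    exact (congrArg (fun f => ModuleCat.Hom.hom f c) (S.X₃.homology_π_ι i)).symm
  · apply (ModuleCat.mono_iff_injective (S.X₂.iCycles j)).1 inferInstance
    refine (congrArg (fun f => ModuleCat.Hom.hom f c')
      (HomologicalComplex.cyclesMap_i S.f j)).trans ?_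
    have e : S.X₂.pOpcycles i ≫ S.X₂.opcyclesToCycles i j ≫ S.X₂.iCycles j = S.X₂.d i j := by
      simp
    exact Eq.trans h₁ (congrArg (fun f => ModuleCat.Hom.hom f x₂) e.symm)

lemma degreeNegOne (s : ∀ i j : ℤ, j + 1 = i → (K.X i ⟶ L.X j))
    (hs : ∀ (i i' j j' : ℤ) (h : j + 1 = i) (h' : j' + 1 = i') (_ : i' + 1 = i),
      s i j h ≫ L.d j j' = K.d i i' ≫ s i' j' h') {j : ℤ} (h : j + 1 = i) {x : K.X i}
    {ξ : K.homology i} (hx : Represents K i x ξ) :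
    Represents L j (s i j h x) (homologyMapDegreeNegOne k s hs i j h ξ) := by
  obtain ⟨c, rfl, rfl⟩ := hx
  let φ : K.sc i ⟶ L.sc j :=
    { τ₁ := s _ _ (by simp; omega)
      τ₂ := s i j h
      τ₃ := s _ _ (by simp; omega)
      comm₁₂ := hs _ _ _ _ _ _ (by simp)
      comm₂₃ := hs _ _ _ _ _ _ (by simp) }
  refine ⟨ShortComplex.cyclesMap φ c, ?_, ?_⟩
  · exact congrArg (fun f => ModuleCat.Hom.hom f c) (ShortComplex.cyclesMap_i φ)
  · exact congrArg (fun f => ModuleCat.Hom.hom f c) (ShortComplex.homologyπ_naturality φ).symm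

end Represents

end Classes

/-! ### Exactness of the product complex and comparison of connecting homomorphisms -/

section Comparison

open scoped TensorProduct

attribute [local instance 50] moduleOverBase

attribute [local instance] isScalarTower_base

variable (k : Type w) [CommRing k] {R : Type u} [Ring R] [Algebra k R]
  (P : ChainComplex (ModuleCat.{u} Rᵐᵒᵖ) ℤ)

/-- If the complexes `P ⊗_R I^b` are exact in high degrees, then so is the product complex. -/
lemma exists_prodD_eq (I : CochainComplex (ModuleCat.{u} R) ℕ) (m l : ℤ) (hl : l + 1 = m)
    (hex : ∀ (b : ℕ) (a : ℤ), b + l = a → ∀ x : Tensor k (P.X (a + 1)) (I.X b),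
      Tensor.map k (P.d (a + 1) a) (𝟙 (I.X b)) x = 0 →
        ∃ y : Tensor k (P.X (a + 1 + 1)) (I.X b),
          Tensor.map k (P.d (a + 1 + 1) (a + 1)) (𝟙 (I.X b)) y = x)
    (z : ProdTerm k P I m) (hz : prodD k P I m l hl z = 0) :
    ∃ w : ProdTerm k P I (m + 1), prodD k P I (m + 1) m rfl w = z := by
  -- A preimage is built column by column. An element of `W b` is its component at `(b + m + 1, b)`,
  -- with the first index left as a variable to avoid transports.
  let W (b : ℕ) : Type u := ∀ a : ℤ, a = b + (m + 1) → Tensor k (P.X a) (I.X b)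
  -- The equation for column `b`, after application of `1 ⊗ d`. The term from column `b - 1` drops
  -- out as `d ∘ d = 0`, so the invariant involves a single component, and it is what makes the next
  -- obstruction a cycle.
  let Inv (b : ℕ) (w : W b) : Prop := ∀ (a : ℤ) (h : a = b + m) (h' : a + 1 = b + (m + 1)),
    Tensor.map k (P.d (a + 1) a) (I.d b (b + 1)) (w (a + 1) h') =
      Tensor.map k (𝟙 (P.X a)) (I.d b (b + 1)) (z ⟨(a, b), h⟩)
  have hW (b : ℕ) (a : ℤ) (h : a = b + (m + 1)) (y : Tensor k (P.X a) (I.X b)) :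
      ∃ w : W b, w a h = y := by
    refine ⟨fun a' h' => ?_, ?_⟩
    · obtain rfl : a = a' := h.trans h'.symm
      exact y
    · rfl
  have h₀ : ∃ w : W 0, Inv 0 w ∧ ∀ (a : ℤ) (h : a = (0 : ℕ) + m) (h' : a + 1 = (0 : ℕ) + (m + 1)),
      Tensor.map k (P.d (a + 1) a) (𝟙 (I.X 0)) (w (a + 1) h') = z ⟨(a, 0), h⟩ := by
    obtain ⟨y, hy⟩ := hex 0 l (by simp) (z ⟨(l + 1, 0), by simp; omega⟩) (by
      have := congrFun hz ⟨(l, 0), by simp⟩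
      rwa [prodD_zero] at this)
    obtain ⟨w, hw⟩ := hW 0 (l + 1 + 1) (by simp; omega) y
    have e : ∀ (a : ℤ) (h : a = (0 : ℕ) + m) (h' : a + 1 = (0 : ℕ) + (m + 1)),
        Tensor.map k (P.d (a + 1) a) (𝟙 (I.X 0)) (w (a + 1) h') = z ⟨(a, 0), h⟩ := by
      intro a h h'
      obtain rfl : a = l + 1 := by simp at h; omega
      rw [hw, hy]
    refine ⟨w, fun a h h' => ?_, e⟩
    rw [← e a h h', Tensor.map_map]
    simp
  have hstep (b : ℕ) (w : W b) (hw : Inv b w) : ∃ w' : W (b + 1), Inv (b + 1) w' ∧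
      ∀ (a : ℤ) (h : a = (b + 1 : ℕ) + m) (h' : a + 1 = (b + 1 : ℕ) + (m + 1))
        (h'' : a = b + (m + 1)), Tensor.map k (P.d (a + 1) a) (𝟙 (I.X (b + 1))) (w' (a + 1) h') +
          a.negOnePow • Tensor.map k (𝟙 (P.X a)) (I.d b (b + 1)) (w a h'') =
            z ⟨(a, b + 1), h⟩ := by
    obtain ⟨c, hc⟩ : ∃ c : ℤ, c = b + m := ⟨_, rfl⟩
    have h1 := congrFun hz ⟨(c, b + 1), by simp; omega⟩
    rw [prodD_succ _ _ _ _ _ _ _ _ _ _ (by simp; omega) hc] at h1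
    have h2 := hw c hc (by omega)
    -- The equation to be solved in column `b + 1` has right side `z - (-1)^(c+1) (1 ⊗ d) w`. It is
    -- a cycle by the vanishing of the boundary of `z` at `(c, b + 1)` together with the invariant.
    obtain ⟨y, hy⟩ := hex (b + 1) c (by push_cast; omega)
      (z ⟨(c + 1, b + 1), by simp; omega⟩ - (c + 1).negOnePow •
        Tensor.map k (𝟙 (P.X (c + 1))) (I.d b (b + 1)) (w (c + 1) (by omega))) (by
      rw [map_sub, eq_neg_of_add_eq_zero_left h1, ← h2]
      simp [Tensor.map_map, Int.negOnePow_succ])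
    obtain ⟨w', hw'⟩ := hW (b + 1) (c + 1 + 1) (by push_cast; omega) y
    have e : ∀ (a : ℤ) (h : a = (b + 1 : ℕ) + m) (h' : a + 1 = (b + 1 : ℕ) + (m + 1))
        (h'' : a = b + (m + 1)), Tensor.map k (P.d (a + 1) a) (𝟙 (I.X (b + 1))) (w' (a + 1) h') +
          a.negOnePow • Tensor.map k (𝟙 (P.X a)) (I.d b (b + 1)) (w a h'') =
            z ⟨(a, b + 1), h⟩ := by
      intro a h h' h''
      obtain rfl : a = c + 1 := by push_cast at h; omega
      rw [hw', hy, sub_add_cancel]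
    refine ⟨w', fun a h h' => ?_, e⟩
    rw [← e a h h' (by push_cast at h; omega), map_add, Tensor.map_map]
    simp [Tensor.map_map]
  choose w₀ hw₀ using h₀
  choose step hstep using hstep
  -- The recursion need not stop, so the preimage may have infinitely many nonzero components. It
  -- exists in the product, not necessarily in the direct sum.
  let seq : ∀ b, {w : W b // Inv b w} := Nat.rec ⟨w₀, hw₀.1⟩
    (fun b p => ⟨step b p.1 p.2, (hstep b p.1 p.2).1⟩)
  refine ⟨fun p => (seq p.1.2).1 p.1.1 p.2, ?_⟩
  funext ⟨⟨a, b⟩, hp⟩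
  rcases b with _ | b
  · rw [prodD_zero _ _ _ _ _ _ _ _ _ (by simp at hp ⊢; omega)]
    exact hw₀.2 a hp _
  · rw [prodD_succ _ _ _ _ _ _ _ _ _ _ (by simp at hp ⊢; omega) (by simp at hp ⊢; omega)]
    exact (hstep b (seq b).1 (seq b).2).2 a hp _ _

lemma exactAt_iff_forall (K : ChainComplex (ModuleCat.{u} k) ℤ) (i j l : ℤ) (h : j + 1 = i)
    (h' : l + 1 = j) :
    K.ExactAt j ↔ ∀ x : K.X j, K.d j l x = 0 → ∃ y : K.X i, K.d i j y = x := by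
  rw [HomologicalComplex.exactAt_iff' _ i j l (by simp; omega) (by simp; omega),
    ShortComplex.moduleCat_exact_iff]
  rfl

variable (M : ModuleCat.{u} Rᵐᵒᵖ)

lemma isZero_homology_prodComplex (n : ℤ)
    (hn : ∀ i, n ≤ i → ∀ E : ModuleCat.{u} R, Injective E → IsZero (((tor k M).obj i).obj E))
    (N : ModuleCat.{u} R) (m : ℤ) (hm : n ≤ m) :
    IsZero ((prodComplex k (resolutionComplex M) (res N)).homology m) := by
  rw [← HomologicalComplex.exactAt_iff_isZero_homology,
    exactAt_iff_forall k _ (m + 1) m (m - 1) rfl (by omega)]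
  intro z hz
  rw [complexOf_d _ _ _ _ _ _ (show m - 1 + 1 = m by omega)] at hz
  obtain ⟨w, hw⟩ := exists_prodD_eq k (resolutionComplex M) (res N) m (m - 1) (by omega)
    -- The degree in column `b` is `a + 1 = b + m`, which is at least `n`, so `Tor (a + 1)` vanishes
    -- on the injective module `I^b`.
    (fun b a ha x hx => by
      have h := hn (a + 1) (by omega) _ (injective_res N b)
      have h' := (exactAt_iff_forall k ((tensorModule k (resolutionComplex M)).obj ((res N).X b))
        (a + 1 + 1) (a + 1) a rfl rfl).1 ((HomologicalComplex.exactAt_iff_isZero_homology _ _).2 h)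
      exact h' x hx) z hz
  refine ⟨w, ?_⟩
  rw [complexOf_d _ _ _ _ _ _ rfl]
  exact hw

/-- In the long exact sequence of the three complexes the homology of the product vanishes in the
degrees `i` and `i + 1`, so the connecting homomorphism between them is invertible. -/
lemma isIso_storToTor (n : ℤ)
    (hn : ∀ i, n ≤ i → ∀ E : ModuleCat.{u} R, Injective E → IsZero (((tor k M).obj i).obj E))
    (N : ModuleCat.{u} R) (i : ℤ) (hi : n ≤ i) : IsIso ((storToTor k M i).app N) := by
  have hS := stableSES_shortExact k (resolutionComplex M) (res N)
  have h₁ := isZero_homology_prodComplex k M n hn N (i + 1) (by omega)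
  have h₀ := isZero_homology_prodComplex k M n hn N i hi
  have : Mono (hS.δ (i + 1) i rfl) := (hS.homology_exact₃ (i + 1) i rfl).mono_g (h₁.eq_of_src _ _)
  have : Epi (hS.δ (i + 1) i rfl) := (hS.homology_exact₁ (i + 1) i rfl).epi_f (h₀.eq_of_tgt _ _)
  have : IsIso (hS.δ (i + 1) i rfl) := isIso_of_mono_of_epi _
  exact IsIso.comp_isIso' this
    (augIso k (resolutionComplex M) N (projective_resolutionComplex M) i).isIso_inv

/-- The boundary in `P ⊗_R I` that compares the connecting homomorphism of `P ⊗_R -` with the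
map that is induced by `ψ`. -/
lemma augProd_extendAug {S : ShortComplex (ModuleCat.{u} R)} (hS : S.ShortExact) (i j : ℤ)
    (h : j + 1 = i) (y : Tensor k (P.X i) S.X₂) (x : Tensor k (P.X j) S.X₁)
    (hx : Tensor.map k (𝟙 (P.X j)) S.f x = Tensor.map k (P.d i j) (𝟙 S.X₂) y) :
    ∃ v ∈ finiteSupport k P (res S.X₁) i, augProd k P S.X₁ j x =
      (i + 1).negOnePow • prodConn k P (connLift hS) i j h
        (augProd k P S.X₃ i (Tensor.map k (𝟙 (P.X i)) S.g y)) + prodD k P (res S.X₁) i j h v := by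
  subst h
  -- The extension `N ⟶ I^0` moves `y` to `P_i ⊗ I^0`. The boundary of this one component has a part
  -- at `(j, 0)`, which is the image of `x`, and a part at `(i, 1)`, which is the image under `ψ` up
  -- to sign.
  let v : ProdTerm k P (res S.X₁) (j + 1) := Pi.single ⟨(j + 1, 0), by simp⟩
    (Tensor.map k (𝟙 (P.X (j + 1))) (extendAug hS) y)
  have hv0 : ∀ p : Position (j + 1), p.1.2 ≠ 0 → v p = 0 := fun p hp =>
    Pi.single_eq_of_ne (fun h => hp (by rw [h])) _
  have hv1 : v ⟨(j + 1, 0), by simp⟩ = Tensor.map k (𝟙 (P.X (j + 1))) (extendAug hS) y :=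
    Pi.single_eq_same _ _
  refine ⟨v, ⟨1, fun p hp => hv0 p (by omega)⟩, ?_⟩
  funext ⟨⟨a, b⟩, hp⟩
  rw [Pi.add_apply, Pi.smul_apply]
  rcases b with _ | _ | b
  · obtain rfl : a = j := by simpa using hp
    rw [prodConn_zero, smul_zero, zero_add, prodD_zero _ _ _ _ _ _ _ _ _ (by simp), hv1,
      augProd_zero', Tensor.map_map, ← f_extendAug hS]
    have := congrArg (Tensor.map k (𝟙 (P.X a)) (extendAug hS)) hx
    rw [Tensor.map_map, Tensor.map_map] at this
    simpa using this
  · obtain rfl : a = j + 1 := by simp at hp; omega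
    rw [augProd_succ, prodConn_succ _ _ _ _ _ _ _ _ _ _ (by simp), augProd_zero',
      prodD_succ _ _ _ _ _ _ _ _ _ _ (by simp; omega) (by simp), hv0 _ (by simp), hv1, map_zero]
    refine Eq.trans ?_ (congrArg (_ + ·) (zero_add _).symm)
    rw [Tensor.map_map, Tensor.map_map, Tensor.map_map]
    have e : S.g ≫ aug S.X₃ ≫ connLift hS 0 = extendAug hS ≫ (res S.X₁).d 0 1 := by
      rw [aug_connLift, ← Category.assoc, g_toCosyzygy, Category.assoc,
        HomologicalComplex.toCycles_i]
    -- The differential contributes `(-1)^i` at `(i, 1)`. The sign `(-1)^(i+1)` in the connecting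
    -- homomorphism of stable homology makes the two terms cancel.
    rw [e, Int.negOnePow_succ (j + 1)]
    simp
  · rw [augProd_succ, prodConn_succ _ _ _ _ _ _ _ _ _ _ (by simp at hp ⊢; omega), augProd_succ,
      prodD_succ _ _ _ _ _ _ _ _ _ _ (by simp at hp ⊢; omega) (by simp at hp ⊢; omega),
      hv0 _ (by simp), hv0 _ (by simp)]
    simp

end Comparison

/-! ### The morphism from stable homology to Tor commutes with connecting homomorphisms -/

section Main

open scoped TensorProduct

attribute [local instance 50] moduleOverBase

attribute [local instance] isScalarTower_base

variable (k : Type w) [CommRing k] {R : Type u} [Ring R] [Algebra k R]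
  (M : ModuleCat.{u} Rᵐᵒᵖ)

/-- Every class in stable homology is represented by an element of the product complex whose
boundary comes from a cycle in `P ⊗_R N`. -/
lemma exists_representative_stable (P : ChainComplex (ModuleCat.{u} Rᵐᵒᵖ) ℤ)
    (hP : ∀ n, Projective (P.X n)) (N : ModuleCat.{u} R) (i : ℤ)
    (ξ : (stableComplex k P (res N)).homology (i + 1)) :
    ∃ (z : ProdTerm k P (res N) (i + 1)) (y : Tensor k (P.X i) N),
      prodD k P (res N) (i + 1) i rfl z = augProd k P N i y ∧
      Represents (stableComplex k P (res N)) (i + 1) (Submodule.Quotient.mk z) ξ ∧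
      Represents ((tensorModule k P).obj N) i y
        ((augIso k P N hP i).inv ((stableSES_shortExact k P (res N)).δ (i + 1) i rfl ξ)) := by
  obtain ⟨s, hs⟩ := Represents.exists_representative ξ
  obtain ⟨z, rfl⟩ := Submodule.Quotient.mk_surjective _ s
  have hz : prodD k P (res N) (i + 1) i rfl z ∈ finiteSupport k P (res N) i := by
    have := hs.d_eq_zero i
    rw [complexOf_d _ _ _ _ _ _ rfl] at this
    exact (Submodule.Quotient.mk_eq_zero _).1 this
  have hδ := hs.δ (stableSES_shortExact k P (res N)) rfl z rfl
    (⟨prodD k P (res N) (i + 1) i rfl z, hz⟩ : finiteSupport k P (res N) i) (by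
      dsimp only [stableSES]
      rw [complexOf_d _ _ _ _ _ _ rfl]
      rfl)
  obtain ⟨y, hy⟩ := Represents.exists_representative
    ((augIso k P N hP i).inv ((stableSES_shortExact k P (res N)).δ (i + 1) i rfl ξ))
  have hy' := hy.map (augComplex k P N)
  have e : HomologicalComplex.homologyMap (augComplex k P N) i
      ((augIso k P N hP i).inv ((stableSES_shortExact k P (res N)).δ (i + 1) i rfl ξ)) =
      (stableSES_shortExact k P (res N)).δ (i + 1) i rfl ξ :=
    congrArg (fun f => ModuleCat.Hom.hom f
      ((stableSES_shortExact k P (res N)).δ (i + 1) i rfl ξ)) (augIso k P N hP i).inv_hom_id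
  rw [e] at hy'
  obtain ⟨v, hv⟩ := hy'.exists_boundary hδ (i + 1) rfl
  rw [complexOf_d _ _ _ _ _ _ rfl] at hv
  have hv' : augProd k P N i y = prodD k P (res N) (i + 1) i rfl z +
    prodD k P (res N) (i + 1) i rfl v.1 := congrArg Subtype.val hv
  -- The element `v` has finite support. Adding it turns an equality of homology classes into an
  -- equality of boundaries and does not change the class of `z` in the quotient.
  refine ⟨z + v.1, y, by rw [map_add, hv'], ?_, hy⟩
  have hm : (Submodule.Quotient.mk (z + v.1) : _ ⧸ finiteSupport k P (res N) (i + 1)) =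
      Submodule.Quotient.mk z := (Submodule.Quotient.eq _).2 (by
      rw [add_sub_cancel_left]; exact v.2)
  rw [hm]
  exact hs

lemma Represents.stableConn {P : ChainComplex (ModuleCat.{u} Rᵐᵒᵖ) ℤ}
    {I J : CochainComplex (ModuleCat.{u} R) ℕ} (ψ : ∀ b, I.X b ⟶ J.X (b + 1))
    (hψ : ∀ b c, ψ b ≫ J.d (b + 1) (c + 1) = I.d b c ≫ ψ c) (i j : ℤ) (h : j + 1 = i)
    {z : ProdTerm k P I i} {ξ : (stableComplex k P I).homology i}
    (hz : Represents (stableComplex k P I) i (Submodule.Quotient.mk z) ξ) :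
    Represents (stableComplex k P J) j (Submodule.Quotient.mk (prodConn k P ψ i j h z))
      (stableConn k P ψ hψ i j h ξ) :=
  hz.degreeNegOne (L := stableComplex k P J)
    (fun i j h => ModuleCat.ofHom (Submodule.mapQ _ _ (prodConn k P ψ i j h)
      (prodConn_mem k P ψ i j h)))
    (fun i i' j j' h h' hi => by
      obtain rfl : j = i' := by omega
      rw [complexOf_d _ _ _ _ _ _ h', complexOf_d _ _ _ _ _ _ h]
      refine ModuleCat.hom_ext (Submodule.linearMap_qext _ (LinearMap.ext fun z => ?_))
      exact congrArg (Submodule.mkQ _) (prodConn_prodD k P ψ hψ i j j' h h' z).symm) h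

/-- Both composites are computed on one representative `z` with boundary the image of a cycle `y`.
They give classes in the homology of `P ⊗ I` that differ by the boundary found in
`augProd_extendAug`. -/
lemma connected_storToTor : FamilyHom.Connected (storToTor k M) := by
  intro S hS i j h
  subst h
  let P := resolutionComplex M
  have hP := projective_resolutionComplex M
  refine ModuleCat.hom_ext (LinearMap.ext fun ξ => ?_)
  obtain ⟨z, y, hzy, hz, hy⟩ := exists_representative_stable k P hP S.X₃ (j + 1) ξ
  have hj := hP j
  have hj1 := hP (j + 1)
  have hSj := tensorModule_shortExact k P hP hS
  obtain ⟨y', hy'⟩ := Tensor.map_surjective k (P.X (j + 1))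
    ((ModuleCat.epi_iff_surjective _).1 hS.epi_g) y
  have hdy : Tensor.map k (P.d (j + 1) j) (𝟙 S.X₃) y = 0 := hy.d_eq_zero j
  -- The zigzag for Tor: `y` lifts to `y'` in `P ⊗ N`, and the boundary of `y'` comes from `x` in `P
  -- ⊗ N'`.
  obtain ⟨x, hx⟩ := Tensor.exact k (P.X j) (f := S.f) (g := S.g) (fun a ha =>
      ((ShortComplex.ShortExact.moduleCat_exact_iff_function_exact S).1 hS.exact a).1 ha)
    (Tensor.map k (P.d (j + 1) j) (𝟙 S.X₂) y') (by
      rw [← hy', Tensor.map_map] at hdy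
      rw [Tensor.map_map]
      simpa using hdy)
  have hright := hy.δ hSj (j := j) rfl y' hy' x hx
  obtain ⟨v, hv, hvx⟩ := augProd_extendAug k P hS (j + 1) j rfl y' x hx
  have hconn := (Represents.stableConn k (connLift hS) (connLift_d hS) (j + 1 + 1) (j + 1) rfl
    hz).smul (j + 1 + 1).negOnePow
  -- The zigzag for stable homology: `ψ z` lifts the image class to the product, and since `ψ`
  -- commutes with differentials its boundary is `ψ` applied to the image of `y`, which has finite
  -- support.
  have hleft := hconn.δ (stableSES_shortExact k P (res S.X₁)) (j := j) rfl
    ((j + 1 + 1).negOnePow • prodConn k P (connLift hS) (j + 1 + 1) (j + 1) rfl z) rfl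
    ((j + 1 + 1).negOnePow • (⟨prodConn k P (connLift hS) (j + 1) j rfl
      (augProd k P S.X₃ (j + 1) y), prodConn_mem k P _ _ _ _ _ (augProd_mem k P _ _ _)⟩ :
        finiteSupport k P (res S.X₁) j)) (by
      dsimp only [stableSES]
      rw [complexOf_d _ _ _ _ _ _ rfl]
      refine Eq.trans ?_ (map_zsmul_unit (prodD k P (res S.X₁) (j + 1) j rfl) _ _).symm
      rw [← prodConn_prodD k P (connLift hS) (connLift_d hS), hzy]
      rfl)
  have key := (hright.map (augComplex k P S.X₁)).eq_of_boundary hleft (j + 1)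
    (⟨v, hv⟩ : finiteSupport k P (res S.X₁) (j + 1)) (by
      rw [complexOf_d _ _ _ _ _ _ rfl]
      refine Subtype.ext ?_
      rw [hy'] at hvx
      exact hvx)
  -- The classes were compared in `P ⊗ I`; the inverse of the augmentation isomorphism carries the
  -- equality back to Tor.
  refine (congrArg (augIso k P S.X₁ hP j).inv key).symm.trans ?_
  exact congrArg (fun f => ModuleCat.Hom.hom f _) (augIso k P S.X₁ hP j).hom_inv_id

end Main

end CompleteHomology

end

/-! ### The proposition -/

theorem mainTheorem2 {k : Type w} [CommRing k] {R : Type u} [Ring R] [Algebra k R]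
    (M : ModuleCat.{u} Rᵐᵒᵖ) (hM : CompleteHomology.HasFiniteCopureFlatDimension k M) :
    CompleteHomology.IsJCompletion (CompleteHomology.tor k M).toConnectedFamily
        (CompleteHomology.ctor k M) (CompleteHomology.ctorτ k M) ∧
      ∃ σ : CompleteHomology.FamilyHom (CompleteHomology.stor k M) (CompleteHomology.ctor k M),
        σ.Connected ∧
        (∀ i : ℤ, σ i ≫ CompleteHomology.ctorτ k M i = CompleteHomology.storToTor k M i) ∧
        (∀ σ' : CompleteHomology.FamilyHom (CompleteHomology.stor k M) (CompleteHomology.ctor k M),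
          σ'.Connected →
          (∀ i : ℤ, σ' i ≫ CompleteHomology.ctorτ k M i = CompleteHomology.storToTor k M i) →
          σ' = σ) ∧
        ∀ i : ℤ, IsIso (σ i) := by
  obtain ⟨n, hn⟩ := hM
  have hU := CompleteHomology.shiftsInjectives_stor k M
  have hN : (CompleteHomology.stor k M).Natural := CompleteHomology.natural_stor k M
  have hυ := CompleteHomology.connected_storToTor k M
  have hσ := (CompleteHomology.tor k M).connected_completionLift hU hN hυ
  have hστ := (CompleteHomology.tor k M).completionLift_τ hU hN hυ
  exact ⟨(CompleteHomology.tor k M).isJCompletion_completion,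
    (CompleteHomology.tor k M).completionLift hU hN hυ, hσ, hστ,
    fun σ' hσ' h => CompleteHomology.HomologicalFunctor.completion_lift_unique hU hσ' hσ fun i =>
      (h i).trans (hστ i).symm,
    (CompleteHomology.tor k M).isIso_completionLift hU hN hυ n hn
      (fun j hj N => CompleteHomology.isIso_storToTor k M n hn N j hj)⟩
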